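/- Let $M$ be a real analytic $n$-manifold, $\pi:TM\to M$ its tangent bundle, $\mathcal TM=TM\setminus 0$ the slit tangent bundle, $J=dx^i\otimes\partial/\partial y^i$ the canonical vertical endomorphism and $C=y^i\,\partial/\partial y^i$ the canonical vertical vector field (in induced coordinates $(x^i,y^i)$ on $TM$). Let $S$ be an analytic spray, i.e. a vector field on $TM$, analytic on $\mathcal TM$, with $JS=C$ and $[C,S]=S$ on $\mathcal TM$; thus $S=y^i\,\partial/\partial x^i+f^i(x,y)\,\partial/\partial y^i$ with $f^i$ positively homogeneous of degree $2$ in $y$. Let $\Gamma=[J,S]$, that is, $\Gamma X=[JX,S]-J[X,S]$, be its connection; a vector field $X$ is horizontal if $\Gamma X=X$. Let $\mathcal H$ be the holonomy distribution of $S$ on $\mathcal TM$: $\mathcal H_p$ is the linear span of the values at $p$ of all vector fields, defined near $p$, that are obtained from smooth horizontal vector fields by successive Lie brackets. For a function $E$ on an open subset of $\mathcal TM$ let $(g_E)_{ij}=\partial^2E/\partial y^i\partial y^j$. An analytic Finsler metric on an open set $U\subset\mathcal TM$ is a positive analytic function $F:U\to\mathbb R$ with $F(x,\lambda y)=\lambda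 F(x,y)$ whenever $\lambda>0$ and $(x,y),(x,\lambda y)\in U$, such that $g_E$ is positive definite on $U$ for the energy $E=\frac12F^2$. Its geodesics are given by $S$ if $i_S\,dd_JE+d\mathcal L_CE-dE=0$ on $U$, i.e. if the Euler–Lagrange equations $$y^j\frac{\partial^2E}{\partial x^j\partial y^i}+f^j\frac{\partial^2E}{\partial y^j\partial y^i}-\frac{\partial E}{\partial x^i}=0,\qquad i=1,\dots,n,$$ hold on $U$. Consider the first order linear system for functions $E$ on $TM$ $$\mathcal L_CE-2E=0,\qquad \mathcal L_XE=0\quad\text{for all smooth sections } X \text{ of } \mathcal H. \tag{$*$}$$ The kernel of its first prolongation at $v$ is the set of second order jets $j_{2,v}(E)$ of smooth functions $E$ defined near $v$ for which the first order jets at $v$ of $\mathcal L_CE-2E$ and of $\mathcal L_XE$, for all smooth sections $X$ of $\mathcal H$ near $v$, vanish. It contains positive definite initial data if it contains a jet $j_{2,v}(E)$ for which the matrix $\bigl(\frac{\partial^2E}{\partial y^i\partial y^j}(v)\bigr)$ is positive definite. **Theorem.** Let $v\in\mathcal TM$, suppose that $C_v\notin\mathcal H_v$ and that $\mathcal H$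 has constant rank in a neighbourhood of $v$. Then there exists an analytic Finsler metric in a neighbourhood of $v$ whose geodesics are given by $S$ if and only if the kernel of the first prolongation of $(*)$ at $v$ contains positive definite initial data. -/

import Mathlib

open scoped Manifold ContDiff Topology

noncomputable section

namespace FinslerMetrizability

section

variable {n : ℕ} {M : Type*} [TopologicalSpace M] [ChartedSpace (EuclideanSpace ℝ (Fin n)) M]
  [IsManifold (𝓡 n) ω M]

variable (n M) in
/-- Vector fields on `TM`, i.e. sections of `TTM`, with no regularity imposed. A vector field on an
open subset of `TM` is represented by an arbitrary extension of it: everything below depends only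
on the values on the open set. -/
abbrev Field : Type _ :=
  (p : TangentBundle (𝓡 n) M) → TangentSpace (𝓡 n).tangent p

variable (n M) in
/-- The slit tangent bundle: `TM` without its zero section. -/
def slit : Set (TangentBundle (𝓡 n) M) := {p | p.2 ≠ 0}

/-- The vector field `X` is of class `C^k` on `U` (`k = ∞`: smooth, `k = ω`: analytic). -/
def SmoothOn (k : WithTop ℕ∞) (X : Field n M) (U : Set (TangentBundle (𝓡 n) M)) : Prop :=
  ContMDiffOn (𝓡 n).tangent (𝓡 n).tangent.tangent k
    (fun p ↦ (⟨p, X p⟩ : TangentBundle (𝓡 n).tangent (TangentBundle (𝓡 n) M))) U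

/-- The derivative `X E = ℒ_X E` of a function `E` on `TM` along the vector field `X`. -/
def derive (X : Field n M) (E : TangentBundle (𝓡 n) M → ℝ) : TangentBundle (𝓡 n) M → ℝ :=
  fun p ↦ mfderiv (𝓡 n).tangent 𝓘(ℝ, ℝ) E p (X p)

/-- The Lie bracket `[X, Y]` of vector fields on `TM`. -/
def bracket (X Y : Field n M) : Field n M :=
  VectorField.mlieBracket (𝓡 n).tangent X Y

/-- The vertical lift of `w ∈ T_xM` to `p = (x, y) ∈ TM`: the image of `w` under the differential
at `y` of the inclusion `T_xM → TM` of the fibre. In induced coordinates, `w^i ∂/∂y^i`. -/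
def verticalLift (p : TangentBundle (𝓡 n) M) (w : TangentSpace (𝓡 n) p.1) :
    TangentSpace (𝓡 n).tangent p :=
  mfderiv 𝓘(ℝ, EuclideanSpace ℝ (Fin n)) (𝓡 n).tangent
    (fun y : EuclideanSpace ℝ (Fin n) ↦ (⟨p.1, y⟩ : TangentBundle (𝓡 n) M)) p.2 w

variable (n M) in
/-- The canonical vertical vector field `C = y^i ∂/∂y^i`. -/
def liouville : Field n M := fun p ↦ verticalLift p p.2

/-- The canonical vertical endomorphism `J = dx^i ⊗ ∂/∂y^i`, applied to a vector field `X`: the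
vertical lift of the projection `π_* X`. -/
def vertEndo (X : Field n M) : Field n M := fun p ↦
  verticalLift p (mfderiv (𝓡 n).tangent (𝓡 n)
    (fun q : TangentBundle (𝓡 n) M ↦ q.1) p (X p))

/-- `S` is an analytic spray: an analytic vector field on the slit tangent bundle such that
`JS = C` and `[C, S] = S`. -/
structure IsAnalyticSpray (S : Field n M) : Prop where
  analytic : SmoothOn ω S (slit n M)
  vertEndo_eq : ∀ p ∈ slit n M, vertEndo S p = liouville n M p
  homogeneous : ∀ p ∈ slit n M, bracket (liouville n M) S p = S p

/-- The connection `Γ = [J, S]` of the spray `S` (Frölicher–Nijenhuis bracket), applied to a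
vector field: `Γ X = [JX, S] - J[X, S]`. -/
def connection (S X : Field n M) : Field n M :=
  fun p ↦ bracket (vertEndo X) S p - vertEndo (bracket X S) p

/-- `X` is a smooth horizontal vector field on `U`: `Γ X = X` on `U`. -/
structure IsHorizontalOn (S : Field n M) (U : Set (TangentBundle (𝓡 n) M)) (X : Field n M) :
    Prop where
  smooth : SmoothOn ∞ X U
  connection_eq : ∀ p ∈ U, connection S X p = X p

/-- The vector fields on `U` obtained from the smooth horizontal vector fields by successive Lie
brackets. -/
inductive IsHolonomyField (S : Field n M) (U : Set (TangentBundle (𝓡 n) M)) : Field n M → Prop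
  | horizontal (X : Field n M) : IsHorizontalOn S U X → IsHolonomyField S U X
  | bracket (X Y : Field n M) : IsHolonomyField S U X → IsHolonomyField S U Y →
      IsHolonomyField S U (bracket X Y)

/-- The holonomy distribution `ℋ ⊆ TTM` of the spray `S` over the slit tangent bundle: the
distribution generated by the (local) horizontal vector fields and their successive brackets. -/
def holonomy (S : Field n M) (p : TangentBundle (𝓡 n) M) :
    Submodule ℝ (TangentSpace (𝓡 n).tangent p) :=
  Submodule.span ℝ {z | ∃ U : Set (TangentBundle (𝓡 n) M), IsOpen U ∧ p ∈ U ∧ U ⊆ slit n M ∧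
    ∃ X : Field n M, IsHolonomyField S U X ∧ X p = z}

/-- The fundamental tensor `g_E(u, w) = ∂²E/∂y^i∂y^j u^i w^j` at `p = (x, y)`: the second
differential at `y` of the restriction of `E` to the fibre `T_xM`. -/
def fundamentalTensor (E : TangentBundle (𝓡 n) M → ℝ) (p : TangentBundle (𝓡 n) M)
    (u w : TangentSpace (𝓡 n) p.1) : ℝ :=
  iteratedFDeriv ℝ 2
    (fun y : EuclideanSpace ℝ (Fin n) ↦ E (⟨p.1, y⟩ : TangentBundle (𝓡 n) M)) p.2 ![u, w]

/-- `g_E` is positive definite at `p`. -/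
def PosDefAt (E : TangentBundle (𝓡 n) M → ℝ) (p : TangentBundle (𝓡 n) M) : Prop :=
  ∀ w : TangentSpace (𝓡 n) p.1, w ≠ 0 → 0 < fundamentalTensor E p w w

/-- `Ω_E(X, Y)` for the two-form `Ω_E = d d_J E`, where `d_J E` is the one-form `X ↦ (JX) E`. -/
def Omega (E : TangentBundle (𝓡 n) M → ℝ) (X Y : Field n M) : TangentBundle (𝓡 n) M → ℝ :=
  fun p ↦ derive X (derive (vertEndo Y) E) p - derive Y (derive (vertEndo X) E) p
    - derive (vertEndo (bracket X Y)) E p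

/-- The Euler–Lagrange operator `P_e E = i_S Ω_E + d ℒ_C E - dE` of the spray `S`, applied to a
vector field `Y`. In induced coordinates and for `S = y^i ∂/∂x^i + f^i ∂/∂y^i`, the equation
`P_e E = 0` reads `y^j ∂²E/∂x^j∂y^i + f^j ∂²E/∂y^j∂y^i - ∂E/∂x^i = 0` for all `i`, i.e. the
integral curves of `S` are extremals of `E`. -/
def eulerLagrange (S : Field n M) (E : TangentBundle (𝓡 n) M → ℝ) (Y : Field n M) :
    TangentBundle (𝓡 n) M → ℝ :=
  fun p ↦ Omega E S Y p + derive Y (derive (liouville n M) E) p - derive Y E p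

/-- `F` is an analytic Finsler metric on the open subset `U` of the slit tangent bundle, and its
geodesics are given by the spray `S`: `F` is analytic and positive on `U`, positively homogeneous
of degree one, the fundamental tensor of the energy `E = F²/2` is positive definite, and `E`
satisfies the Euler–Lagrange equations of `S`. -/
structure IsAnalyticFinslerOn (S : Field n M) (U : Set (TangentBundle (𝓡 n) M))
    (F : TangentBundle (𝓡 n) M → ℝ) : Prop where
  analytic : ContMDiffOn (𝓡 n).tangent 𝓘(ℝ, ℝ) ω F U
  pos : ∀ p ∈ U, 0 < F p
  homogeneous : ∀ p ∈ U, ∀ c : ℝ, 0 < c →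
    (⟨p.1, c • p.2⟩ : TangentBundle (𝓡 n) M) ∈ U →
    F (⟨p.1, c • p.2⟩ : TangentBundle (𝓡 n) M) = c * F p
  posDef : ∀ p ∈ U, PosDefAt (fun q ↦ F q ^ 2 / 2) p
  geodesics : ∀ p ∈ U, ∀ V : Set (TangentBundle (𝓡 n) M), IsOpen V → p ∈ V →
    ∀ Y : Field n M, SmoothOn ∞ Y V → eulerLagrange S (fun q ↦ F q ^ 2 / 2) Y p = 0

/-- `S` is analytically Finsler metrizable in a neighbourhood of `v ∈ TM \ 0`. -/
def LocallyFinslerMetrizable (S : Field n M) (v : TangentBundle (𝓡 n) M) : Prop :=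
  ∃ U : Set (TangentBundle (𝓡 n) M), IsOpen U ∧ v ∈ U ∧ U ⊆ slit n M ∧
    ∃ F : TangentBundle (𝓡 n) M → ℝ, IsAnalyticFinslerOn S U F

/-- The first order jet of `φ` at `v` is zero. -/
def OneJetZero (φ : TangentBundle (𝓡 n) M → ℝ) (v : TangentBundle (𝓡 n) M) : Prop :=
  φ v = 0 ∧ mfderiv (𝓡 n).tangent 𝓘(ℝ, ℝ) φ v = 0

/-- The second order jet at `v` of the function `E` lies in the kernel of the first prolongation
at `v` of the first order system `ℒ_C E - 2E = 0`, `X E = 0` for all sections `X` of `ℋ`: the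
first order jets at `v` of the left-hand sides vanish. Only the second order jet of `E` at `v`
enters. -/
def InProlongedKernel (S : Field n M) (E : TangentBundle (𝓡 n) M → ℝ)
    (v : TangentBundle (𝓡 n) M) : Prop :=
  OneJetZero (fun p ↦ derive (liouville n M) E p - 2 * E p) v ∧
    ∀ U : Set (TangentBundle (𝓡 n) M), IsOpen U → v ∈ U → U ⊆ slit n M →
      ∀ X : Field n M, SmoothOn ∞ X U → (∀ p ∈ U, X p ∈ holonomy S p) →
        OneJetZero (derive X E) v

/-- The kernel of the first prolongation of the reduced system at `v` contains positive definite
initial data: some second order jet at `v`, represented by a function `E` that is smooth near `v`,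
lies in this kernel and has positive definite vertical second derivatives
`(∂²E/∂y^i∂y^j (v))_{ij}`. -/
def HasPosDefInitialData (S : Field n M) (v : TangentBundle (𝓡 n) M) : Prop :=
  ∃ E : TangentBundle (𝓡 n) M → ℝ, ContMDiffAt (𝓡 n).tangent 𝓘(ℝ, ℝ) ∞ E v ∧
    InProlongedKernel S E v ∧ PosDefAt E v

end

end FinslerMetrizability

end

/-!
The reduced system says that the energy `E` is homogeneous of degree two and is constant along the
holonomy distribution `ℋ`. The theorem says that this system is equivalent to the Euler–Lagrange
equations, and that, `ℋ` being involutive, of constant rank and transversal to `C`, its second-order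
jets in the prolonged kernel are all integrable to analytic solutions.

*From a metric to initial data.* Since `JS = C`, the Euler–Lagrange operator of a spray reduces to
`Y ↦ S (JY E) - (J[S, Y]) E - Y E`. For `Y = S` it gives `S E = 0`. Then it becomes
`Y ↦ -(Γ Y + Y) E` (`IsAnalyticSpray.eulerLagrange_eq_neg`), which is `-2 Y E` for `Y` horizontal.
So the horizontal fields annihilate `E`, hence so do their successive brackets
(`IsHolonomyField.derive_eq_zero`), and the jet of `E` at `v` is in the prolonged kernel.

*From initial data to a metric.* In induced coordinates the horizontal vectors at `(x, y)` are the
lifts `h_w = (w, ½ ∂f/∂y · w)`, and `h_w` commutes with `C` because `f` is homogeneous of degree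
two. The iterated brackets of the `h_w` are analytic, commute with `C` by the Jacobi identity
(`IsLiftBracket.analyticAt_and_lieBracket_liouville`), and span `ℋ`: every smooth holonomy field is
a combination of them with smooth coefficients (`IsAnalyticSpray.map_holonomy`). As `ℋ` has constant
rank, finitely many of them, `Z i`, form a local basis of it (`exists_liftBracket_basis`), and
their brackets stay in its span.

It remains to solve `Z i G = 0`, `C G = 2 G` with a prescribed second-order jet satisfying the
equations to first order (`exists_analytic_solution`). The distribution is spanned by commuting
fields `X a` with `X a x_b = δ_ab` for suitable linear functions `x_b` (`exists_commuting_frame`).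
For a first-order operator `P = X + m` and a function `x` with `X x = 1`, `x(v) = 0`, the Lie series
`∑ₖ (-x)ᵏ / k! · Pᵏφ` telescopes under `P`, so that its sum is annihilated by `P`; it is annihilated
by everything that commutes with `P` and annihilates `x` and `φ`; and it keeps the jet of `φ` if the
jet of `Pφ` vanishes (`exists_lieSeries`). Applying this to a polynomial with the given jet and to
the `X a` one after the other makes it constant along `ℋ`. The same construction applied to a
linear function that vanishes on `ℋ_v` but not on `C_v` gives a first integral `x` of `ℋ` with
`C x ≠ 0`, and the Lie series of `(C - 2) / C x` then yields the homogeneity. No integral manifolds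
or flows are needed. Convergence of the Lie series follows from Cauchy estimates, in terms of the
norm `∑ₙ ‖Dⁿf(v)‖ ρⁿ / n!` of germs at `v` (`exists_gaugeSummable_lieTerm`).

Finally `F = √(2G)` is a Finsler metric near `v`. Its geodesics are those of `S`, because
`(Γ Y + Y) / 2` is horizontal for every `Y` and `S` itself is horizontal.
-/

open scoped NNReal ENNReal

noncomputable section

namespace FinslerMetrizability

/-! ### Weighted norms of Taylor coefficients -/

section Gauge

variable {W F G H : Type*} [NormedAddCommGroup W] [NormedSpace ℝ W] [NormedAddCommGroup F]
  [NormedSpace ℝ F] [NormedAddCommGroup G] [NormedSpace ℝ G] [NormedAddCommGroup H]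
  [NormedSpace ℝ H]

/-- The majorant norm `∑ₙ ‖Dⁿf(v)‖ ρⁿ / n!`, possibly infinite. It depends only on the Taylor
series of `f` at `v`. -/
def gauge (v : W) (ρ : ℝ≥0) (f : W → F) : ℝ≥0∞ :=
  ∑' n : ℕ, ‖iteratedFDeriv ℝ n f v‖ₑ * ((ρ ^ n / n.factorial : ℝ≥0) : ℝ≥0∞)

lemma gauge_mono (v : W) {ρ σ : ℝ≥0} (h : ρ ≤ σ) (f : W → F) : gauge v ρ f ≤ gauge v σ f := by
  refine ENNReal.tsum_le_tsum fun n ↦ ?_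
  gcongr

lemma gauge_fderiv_le (v : W) (ρ d : ℝ≥0) (f : W → F) :
    d * gauge v ρ (fderiv ℝ f) ≤ gauge v (ρ + d) f := by
  unfold gauge
  rw [← ENNReal.tsum_mul_left, tsum_eq_zero_add' (f := fun n ↦ ‖iteratedFDeriv ℝ n f v‖ₑ *
    (((ρ + d) ^ n / n.factorial : ℝ≥0) : ℝ≥0∞)) ENNReal.summable]
  refine le_trans (ENNReal.tsum_le_tsum fun n ↦ ?_) le_add_self
  have h1 : ‖iteratedFDeriv ℝ n (fderiv ℝ f) v‖ₑ = ‖iteratedFDeriv ℝ (n + 1) f v‖ₑ := by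
    rw [← ofReal_norm, ← ofReal_norm, norm_iteratedFDeriv_fderiv]
  have h2 : d * (ρ ^ n / n.factorial) ≤ (ρ + d) ^ (n + 1) / (n + 1).factorial := by
    have hn : (0 : ℝ≥0) < n.factorial := by exact_mod_cast n.factorial_pos
    have hb : (n + 1 : ℝ≥0) * (d * ρ ^ n) ≤ (ρ + d) ^ (n + 1) := by
      rw [add_pow]
      refine le_trans (le_of_eq ?_) (Finset.single_le_sum (s := Finset.range (n + 1 + 1))
        (a := n) (fun _ _ ↦ zero_le) (by simp))
      simp [Nat.choose_succ_self_right]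
      ring
    rw [Nat.factorial_succ, mul_div_assoc', div_le_div_iff₀ hn (by positivity)]
    push_cast
    calc d * ρ ^ n * ((n + 1) * n.factorial) = ((n + 1) * (d * ρ ^ n)) * n.factorial := by ring
      _ ≤ _ := by gcongr
  rw [h1, mul_left_comm, ← ENNReal.coe_mul]
  gcongr

lemma gauge_const (v : W) (ρ : ℝ≥0) (c : F) : gauge v ρ (fun _ ↦ c) = ‖c‖ₑ := by
  unfold gauge
  rw [tsum_eq_single 0]
  · rw [← ofReal_norm, norm_iteratedFDeriv_zero, ofReal_norm]; simp
  · intro n hn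
    rw [iteratedFDeriv_const_of_ne hn, ← ofReal_norm]; simp

/-- A function vanishing at the centre has small majorant norm on small balls. -/
lemma gauge_mul_radius_le {v : W} {ρ c : ℝ≥0} (hc : c ≤ 1) {f : W → F} (hf : f v = 0) :
    gauge v (c * ρ) f ≤ c * gauge v ρ f := by
  unfold gauge
  rw [← ENNReal.tsum_mul_left]
  refine ENNReal.tsum_le_tsum fun n ↦ ?_
  rcases n with _ | n
  · rw [← ofReal_norm, norm_iteratedFDeriv_zero, hf]; simp
  · rw [mul_left_comm, ← ENNReal.coe_mul]
    gcongr
    rw [mul_pow, mul_div_assoc]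
    gcongr
    rw [pow_succ]
    exact mul_le_of_le_one_left zero_le (pow_le_one₀ zero_le hc)

/-- The Taylor series of `f` at `v`. -/
def taylor (f : W → F) (v : W) : FormalMultilinearSeries ℝ W F :=
  fun n ↦ (n.factorial : ℝ)⁻¹ • iteratedFDeriv ℝ n f v

lemma gauge_eq_tsum_taylor (v : W) (ρ : ℝ≥0) (f : W → F) :
    gauge v ρ f = ∑' n, ((‖taylor f v n‖₊ * ρ ^ n : ℝ≥0) : ℝ≥0∞) := by
  unfold gauge taylor
  refine tsum_congr fun n ↦ ?_
  rw [enorm_eq_nnnorm, ← ENNReal.coe_mul, nnnorm_smul]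
  congr 1
  simp
  ring

variable [CompleteSpace F] [CompleteSpace G]

lemma gauge_add_le {v : W} {ρ : ℝ≥0} {f g : W → F} (hf : AnalyticAt ℝ f v)
    (hg : AnalyticAt ℝ g v) : gauge v ρ (fun p ↦ f p + g p) ≤ gauge v ρ f + gauge v ρ g := by
  unfold gauge
  rw [← ENNReal.tsum_add]
  refine ENNReal.tsum_le_tsum fun n ↦ ?_
  rw [← add_mul]
  gcongr
  have : iteratedFDeriv ℝ n (fun p ↦ f p + g p) v =
      iteratedFDeriv ℝ n f v + iteratedFDeriv ℝ n g v :=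
    iteratedFDeriv_add_apply (hf.contDiffAt) (hg.contDiffAt)
  rw [this]
  simp only [enorm_eq_nnnorm]
  exact_mod_cast nnnorm_add_le _ _

/-- The majorant norm is submultiplicative: a Cauchy product against the Leibniz formula. -/
lemma gauge_bilinear_le (B : F →L[ℝ] G →L[ℝ] H) (hB : ‖B‖ ≤ 1) {v : W} {ρ : ℝ≥0} {f : W → F}
    {g : W → G} (hf : AnalyticAt ℝ f v) (hg : AnalyticAt ℝ g v) :
    gauge v ρ (fun p ↦ B (f p) (g p)) ≤ gauge v ρ f * gauge v ρ g := by
  obtain ⟨s, hsub, hs, hvs⟩ := eventually_nhds_iff.1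
    (hf.eventually_analyticAt.and hg.eventually_analyticAt)
  have key (n : ℕ) : ‖iteratedFDeriv ℝ n (fun p ↦ B (f p) (g p)) v‖ ≤
      ∑ i ∈ Finset.range (n + 1), (n.choose i : ℝ) * ‖iteratedFDeriv ℝ i f v‖ *
        ‖iteratedFDeriv ℝ (n - i) g v‖ := by
    have := B.norm_iteratedFDerivWithin_le_of_bilinear_of_le_one (N := ω) (s := s) (x := v) (n := n)
      (fun p hp ↦ ((hsub p hp).1).contDiffAt.contDiffWithinAt)
      (fun p hp ↦ ((hsub p hp).2).contDiffAt.contDiffWithinAt) hs.uniqueDiffOn hvs (by simp) hB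
    simpa only [iteratedFDerivWithin_of_isOpen _ hs hvs] using this
  unfold gauge
  rw [← ENNReal.tsum_mul_right]
  simp_rw [← ENNReal.tsum_mul_left]
  rw [← ENNReal.tsum_prod (f := fun i j ↦ ‖iteratedFDeriv ℝ i f v‖ₑ *
      ((ρ ^ i / i.factorial : ℝ≥0) : ℝ≥0∞) * (‖iteratedFDeriv ℝ j g v‖ₑ *
      ((ρ ^ j / j.factorial : ℝ≥0) : ℝ≥0∞))),
    ← (Finset.HasAntidiagonal.sigmaAntidiagonalEquivProd (A := ℕ)).tsum_eq, ENNReal.tsum_sigma']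
  refine ENNReal.tsum_le_tsum fun n ↦ ?_
  rw [tsum_fintype]
  have h2 : ‖iteratedFDeriv ℝ n (fun p ↦ B (f p) (g p)) v‖₊ ≤
      ∑ i ∈ Finset.range (n + 1), (n.choose i : ℝ≥0) * ‖iteratedFDeriv ℝ i f v‖₊ *
        ‖iteratedFDeriv ℝ (n - i) g v‖₊ := by
    rw [← NNReal.coe_le_coe]; push_cast; simpa using key n
  simp only [enorm_eq_nnnorm]
  refine le_trans ?_ (Finset.sum_attach (Finset.HasAntidiagonal.antidiagonal n) (fun q : ℕ × ℕ ↦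
    (‖iteratedFDeriv ℝ q.1 f v‖₊ : ℝ≥0∞) * ((ρ ^ q.1 / q.1.factorial : ℝ≥0) : ℝ≥0∞) *
      ((‖iteratedFDeriv ℝ q.2 g v‖₊ : ℝ≥0∞) *
        ((ρ ^ q.2 / q.2.factorial : ℝ≥0) : ℝ≥0∞)))).symm.le
  norm_cast
  refine (mul_le_mul_left h2 _).trans (le_of_eq ?_)
  rw [Finset.Nat.sum_antidiagonal_eq_sum_range_succ_mk, Finset.sum_mul]
  refine Finset.sum_congr rfl fun i hi ↦ ?_
  have hi' : i ≤ n := by simpa [Nat.lt_succ_iff] using hi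
  have hc : (n.choose i : ℝ≥0) = n.factorial / (i.factorial * (n - i).factorial) := by
    rw [Nat.cast_choose _ hi']
  have hρ : ρ ^ n = ρ ^ i * ρ ^ (n - i) := by rw [← pow_add, Nat.add_sub_cancel' hi']
  have h0 : (n.factorial : ℝ≥0) ≠ 0 := by exact_mod_cast n.factorial_ne_zero
  rw [hc, hρ]
  field_simp

lemma gauge_mul_le {v : W} {ρ : ℝ≥0} {f g : W → ℝ} (hf : AnalyticAt ℝ f v)
    (hg : AnalyticAt ℝ g v) : gauge v ρ (fun p ↦ f p * g p) ≤ gauge v ρ f * gauge v ρ g :=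
  gauge_bilinear_le (ContinuousLinearMap.mul ℝ ℝ) (ContinuousLinearMap.opNorm_mul_le ℝ ℝ) hf hg

lemma gauge_clm_apply_le {v : W} {ρ : ℝ≥0} {f : W → F →L[ℝ] G} {g : W → F}
    (hf : AnalyticAt ℝ f v) (hg : AnalyticAt ℝ g v) :
    gauge v ρ (fun p ↦ f p (g p)) ≤ gauge v ρ f * gauge v ρ g :=
  gauge_bilinear_le (ContinuousLinearMap.id ℝ (F →L[ℝ] G)) ContinuousLinearMap.norm_id_le hf hg

lemma gauge_pow_le {v : W} {ρ : ℝ≥0} {f : W → ℝ} (hf : AnalyticAt ℝ f v) (k : ℕ) :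
    gauge v ρ (fun p ↦ f p ^ k) ≤ gauge v ρ f ^ k := by
  induction k with
  | zero => simp [gauge_const]
  | succ k ih =>
    simp only [pow_succ]
    exact (gauge_mul_le (hf.fun_pow k) hf).trans (by gcongr)

lemma sub_mem_eball_zero {V : Type*} [SeminormedAddCommGroup V] {v p : V} {r : ℝ≥0∞}
    (h : p ∈ Metric.eball v r) : p - v ∈ Metric.eball (0 : V) r := by
  rwa [Metric.mem_eball, edist_eq_enorm_sub, sub_zero, ← edist_eq_enorm_sub]

/-- Taylor's theorem for analytic functions, on every ball on which the majorant norm is finite: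
both sides are analytic there and agree near the centre. -/
lemma hasFPowerSeriesOnBall_taylor {v : W} {ρ : ℝ≥0} (hρ : 0 < ρ) {f : W → F}
    (hf : AnalyticOnNhd ℝ f (Metric.eball v ρ)) (hg : gauge v ρ f ≠ ⊤) :
    HasFPowerSeriesOnBall f (taylor f v) v ρ := by
  have hrad : (ρ : ℝ≥0∞) ≤ (taylor f v).radius := by
    apply FormalMultilinearSeries.le_radius_of_summable_nnnorm
    rw [gauge_eq_tsum_taylor] at hg
    exact ENNReal.tsum_coe_ne_top_iff_summable.1 hg
  have hρ' : (0 : ℝ≥0∞) < ρ := by exact_mod_cast hρ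
  have hT := (taylor f v).hasFPowerSeriesOnBall (hρ'.trans_le hrad)
  have hT' : HasFPowerSeriesOnBall (fun p ↦ (taylor f v).sum (p - v)) (taylor f v) v ρ := by
    simpa using (hT.mono hρ' hrad).comp_sub v
  refine hT'.congr ?_
  refine AnalyticOnNhd.eqOn_of_preconnected_of_eventuallyEq (z₀ := v) hT'.analyticOnNhd hf ?_
    (Metric.mem_eball_self hρ') ?_
  · rw [Metric.eball_coe]
    exact (convex_ball v _).isPreconnected
  · obtain ⟨p, r, hp⟩ := hf v (Metric.mem_eball_self hρ')
    filter_upwards [Metric.eball_mem_nhds v hp.r_pos, Metric.eball_mem_nhds v hρ'] with z hz hz'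
    have h1 := hp.hasSum_iteratedFDeriv (y := z - v)
      (sub_mem_eball_zero hz)
    have h2 := hT'.hasSum (y := z - v)
      (sub_mem_eball_zero hz')
    simp only [add_sub_cancel] at h1 h2
    exact h2.unique (by simpa [taylor] using h1)

lemma enorm_le_gauge {v : W} {ρ : ℝ≥0} {f : W → F}
    (hf : AnalyticOnNhd ℝ f (Metric.eball v ρ)) {p : W} (hp : p ∈ Metric.eball v ρ) :
    ‖f p‖ₑ ≤ gauge v ρ f := by
  by_cases hg : gauge v ρ f = ⊤
  · simp [hg]
  have hρ : 0 < ρ := by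
    have : (0 : ℝ≥0∞) < ρ := (zero_le).trans_lt (Metric.mem_eball.1 hp)
    exact_mod_cast this
  have hp' : edist p v < ρ := Metric.mem_eball.1 hp
  have h := (hasFPowerSeriesOnBall_taylor hρ hf hg).hasSum (y := p - v)
      (sub_mem_eball_zero hp)
  rw [add_sub_cancel] at h
  rw [← h.tsum_eq, gauge_eq_tsum_taylor]
  refine (enorm_tsum_le_tsum_enorm).trans (ENNReal.tsum_le_tsum fun n ↦ ?_)
  have h1 := (taylor f v n).le_opNNNorm (fun _ ↦ p - v)
  rw [enorm_eq_nnnorm]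
  norm_cast
  refine h1.trans ?_
  rw [Finset.prod_const, Finset.card_fin]
  gcongr
  rw [edist_eq_enorm_sub, enorm_eq_nnnorm] at hp'
  exact_mod_cast hp'.le

/-- An analytic germ has finite majorant norm on a small ball. -/
lemma _root_.AnalyticAt.exists_gauge_ne_top {v : W} {f : W → F} (hf : AnalyticAt ℝ f v) :
    ∃ ρ : ℝ≥0, 0 < ρ ∧ AnalyticOnNhd ℝ f (Metric.eball v ρ) ∧ gauge v ρ f ≠ ⊤ := by
  obtain ⟨p, r, hp⟩ := hf
  obtain ⟨ρ, h0, hρ⟩ := ENNReal.lt_iff_exists_nnreal_btwn.1 hp.r_pos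
  refine ⟨ρ, by exact_mod_cast h0, hp.analyticOnNhd.mono (Metric.eball_subset_eball hρ.le), ?_⟩
  have hs := p.summable_nnnorm_mul_pow (hρ.trans_le hp.r_le)
  refine ne_top_of_le_ne_top (ENNReal.tsum_coe_ne_top_iff_summable.2 hs)
    (ENNReal.tsum_le_tsum fun n ↦ ?_)
  have h1 : ‖iteratedFDeriv ℝ n f v‖ ≤ n.factorial * ‖p n‖ := by
    refine ContinuousMultilinearMap.opNorm_le_bound (by positivity) fun m ↦ ?_
    rw [hp.iteratedFDeriv_eq_sum_of_completeSpace]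
    refine (norm_sum_le _ _).trans ?_
    have : ∀ σ ∈ (Finset.univ : Finset (Equiv.Perm (Fin n))),
        ‖p n (fun i ↦ m (σ i))‖ ≤ ‖p n‖ * ∏ i, ‖m i‖ := fun σ _ ↦ by
      refine ((p n).le_opNorm _).trans_eq ?_
      rw [Equiv.prod_comp σ (fun i ↦ ‖m i‖)]
    refine (Finset.sum_le_card_nsmul _ _ _ this).trans_eq ?_
    rw [Finset.card_univ, Fintype.card_perm, Fintype.card_fin, nsmul_eq_mul, mul_assoc]
  have h2 : ‖iteratedFDeriv ℝ n f v‖₊ ≤ n.factorial * ‖p n‖₊ := by exact_mod_cast h1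
  rw [enorm_eq_nnnorm]
  norm_cast
  have h0 : (0 : ℝ≥0) < n.factorial := by exact_mod_cast n.factorial_pos
  rw [mul_div_assoc', div_le_iff₀ h0]
  calc _ ≤ (n.factorial * ‖p n‖₊) * ρ ^ n := by gcongr
    _ = _ := by ring

end Gauge

/-! ### Convergent series of analytic functions -/

section Series

variable {W F : Type*} [NormedAddCommGroup W] [NormedSpace ℝ W] [NormedAddCommGroup F]
  [NormedSpace ℝ F]

/-- The `f k` are analytic on the ball of radius `ρ` around `v`, and their majorant norms there
have a finite sum. -/
structure GaugeSummable (v : W) (ρ : ℝ≥0) (f : ℕ → W → F) : Prop where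
  analyticOnNhd : ∀ k, AnalyticOnNhd ℝ (f k) (Metric.eball v ρ)
  tsum_ne_top : ∑' k, gauge v ρ (f k) ≠ ⊤

namespace GaugeSummable

variable {v : W} {ρ : ℝ≥0} {f : ℕ → W → F}

lemma summable_gauge_toReal (h : GaugeSummable v ρ f) :
    Summable fun k ↦ (gauge v ρ (f k)).toReal :=
  ENNReal.summable_toReal h.tsum_ne_top

variable [CompleteSpace F]

lemma norm_le (h : GaugeSummable v ρ f) (k : ℕ) {p : W} (hp : p ∈ Metric.eball v ρ) :
    ‖f k p‖ ≤ (gauge v ρ (f k)).toReal := by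
  rw [← toReal_enorm]
  exact ENNReal.toReal_mono (ENNReal.ne_top_of_tsum_ne_top h.tsum_ne_top k)
    (enorm_le_gauge (h.analyticOnNhd k) hp)

lemma summable (h : GaugeSummable v ρ f) {p : W} (hp : p ∈ Metric.eball v ρ) :
    Summable fun k ↦ f k p :=
  Summable.of_norm_bounded h.summable_gauge_toReal fun k ↦ h.norm_le k hp

lemma fderiv {d : ℝ≥0} (h : GaugeSummable v (ρ + d) f) (hd : 0 < d) :
    GaugeSummable v ρ (fun k ↦ fderiv ℝ (f k)) where
  analyticOnNhd k := ((h.analyticOnNhd k).fderiv).mono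
    (Metric.eball_subset_eball (by exact_mod_cast le_self_add))
  tsum_ne_top := by
    have h1 : (d : ℝ≥0∞) * ∑' k, gauge v ρ (_root_.fderiv ℝ (f k)) ≤
        ∑' k, gauge v (ρ + d) (f k) := by
      rw [← ENNReal.tsum_mul_left]
      exact ENNReal.tsum_le_tsum fun k ↦ gauge_fderiv_le v ρ d (f k)
    intro h2
    rw [h2, ENNReal.mul_top (by exact_mod_cast hd.ne'), top_le_iff] at h1
    exact h.tsum_ne_top h1

lemma hasFDerivAt {d : ℝ≥0} (h : GaugeSummable v (ρ + d) f) (hd : 0 < d) {p : W}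
    (hp : p ∈ Metric.eball v ρ) :
    HasFDerivAt (fun q ↦ ∑' k, f k q) (∑' k, _root_.fderiv ℝ (f k) p) p := by
  have hsub : Metric.eball v ρ ⊆ Metric.eball v (ρ + d : ℝ≥0) :=
    Metric.eball_subset_eball (by exact_mod_cast le_self_add)
  have h' := h.fderiv hd
  refine hasFDerivAt_tsum_of_isPreconnected h'.summable_gauge_toReal Metric.isOpen_eball ?_
    (fun k q hq ↦ ((h.analyticOnNhd k) q (hsub hq)).differentiableAt.hasFDerivAt)
    (fun k q hq ↦ h'.norm_le k hq) hp (h.summable (hsub hp)) hp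
  rw [Metric.eball_coe]
  exact (convex_ball v _).isPreconnected

lemma analyticOnNhd_tsum (h : GaugeSummable v ρ f) (hρ : 0 < ρ) :
    AnalyticOnNhd ℝ (fun p ↦ ∑' k, f k p) (Metric.eball v ρ) := by
  have hS : Summable fun q : ℕ × ℕ ↦ ‖taylor (f q.1) v q.2‖₊ * ρ ^ q.2 := by
    rw [← ENNReal.tsum_coe_ne_top_iff_summable, ENNReal.tsum_prod
      (f := fun k n ↦ ((‖taylor (f k) v n‖₊ * ρ ^ n : ℝ≥0) : ℝ≥0∞))]
    have h1 := h.tsum_ne_top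
    simp only [gauge_eq_tsum_taylor] at h1
    exact h1
  have hSR : Summable fun q : ℕ × ℕ ↦ ‖taylor (f q.2) v q.1‖ * (ρ : ℝ) ^ q.1 := by
    have := (NNReal.summable_coe.2 hS).prod_symm
    simpa using this
  have hcol (n : ℕ) : Summable fun k ↦ ‖taylor (f k) v n‖ :=
    (summable_mul_right_iff (pow_ne_zero n (NNReal.coe_ne_zero.2 hρ.ne'))).1 (hSR.prod_factor n)
  have hcol' (n : ℕ) : Summable fun k ↦ taylor (f k) v n := (hcol n).of_norm
  have hρ' : (0 : ℝ≥0∞) < ρ := by exact_mod_cast hρ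
  let P : FormalMultilinearSeries ℝ W F := fun n ↦ ∑' k, taylor (f k) v n
  have hP : HasFPowerSeriesOnBall (fun p ↦ ∑' k, f k p) P v ρ := by
    refine ⟨?_, hρ', fun {y} hy ↦ ?_⟩
    · refine FormalMultilinearSeries.le_radius_of_summable _
        (Summable.of_nonneg_of_le (fun n ↦ by positivity) (fun n ↦ ?_) hSR.prod)
      change ‖∑' k, taylor (f k) v n‖ * (ρ : ℝ) ^ n ≤ ∑' k, ‖taylor (f k) v n‖ * (ρ : ℝ) ^ n
      rw [tsum_mul_right]
      gcongr
      exact norm_tsum_le_tsum_norm (hcol n)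
    · have hy' : ‖y‖₊ ≤ ρ := by
        rw [Metric.mem_eball, edist_zero_right, enorm_eq_nnnorm] at hy
        exact_mod_cast hy.le
      have hT : Summable fun q : ℕ × ℕ ↦ taylor (f q.1) v q.2 fun _ ↦ y := by
        refine Summable.of_nnnorm_bounded hS fun q ↦ ?_
        refine ((taylor (f q.1) v q.2).le_opNNNorm _).trans ?_
        rw [Finset.prod_const, Finset.card_fin]
        gcongr
      have h1 := hT.hasSum.prod_fiberwise (g := fun k ↦ f k (v + y)) fun k ↦
        (hasFPowerSeriesOnBall_taylor hρ (h.analyticOnNhd k)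
          (ENNReal.ne_top_of_tsum_ne_top h.tsum_ne_top k)).hasSum hy
      have hy2 (n : ℕ) : HasSum (fun k ↦ taylor (f k) v n fun _ ↦ y) (P n fun _ ↦ y) :=
        ContinuousMultilinearMap.hasSum_eval (hcol' n).hasSum _
      have h2 : HasSum (fun q : ℕ × ℕ ↦ taylor (f q.2) v q.1 fun _ ↦ y)
          (∑' q : ℕ × ℕ, taylor (f q.1) v q.2 fun _ ↦ y) :=
        ((Equiv.prodComm ℕ ℕ).hasSum_iff
          (f := fun q : ℕ × ℕ ↦ taylor (f q.1) v q.2 fun _ ↦ y)).2 hT.hasSum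
      rw [h1.tsum_eq]
      exact h2.prod_fiberwise hy2
  exact hP.analyticOnNhd

end GaugeSummable

end Series

/-! ### Lie series of a first-order operator -/

section LieSeries

variable {W : Type*} [NormedAddCommGroup W] [NormedSpace ℝ W]

lemma _root_.AnalyticAt.clm_apply {F : Type*} [NormedAddCommGroup F] [NormedSpace ℝ F]
    {f : W → W →L[ℝ] F} {g : W → W} {v : W} (hf : AnalyticAt ℝ f v) (hg : AnalyticAt ℝ g v) :
    AnalyticAt ℝ (fun p ↦ f p (g p)) v :=
  ((ContinuousLinearMap.id ℝ (W →L[ℝ] F)).analyticAt_bilinear (f v, g v)).comp₂ hf hg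

/-- The first-order linear differential operator `g ↦ X g + m g`. -/
def firstOrderOp (X : W → W) (m : W → ℝ) (g : W → ℝ) : W → ℝ :=
  fun p ↦ fderiv ℝ g p (X p) + m p * g p

/-- The terms of the Lie series `∑ₖ (-x)ᵏ / k! · Pᵏφ` of `P = X + m`. -/
def lieTerm (X : W → W) (m x φ : W → ℝ) (k : ℕ) : W → ℝ :=
  fun p ↦ (-x p) ^ k / k.factorial * (firstOrderOp X m)^[k] φ p

variable {X : W → W} {m x φ g : W → ℝ} {v : W} {s : Set W}

lemma analyticOnNhd_firstOrderOp (hX : AnalyticOnNhd ℝ X s) (hm : AnalyticOnNhd ℝ m s)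
    (hg : AnalyticOnNhd ℝ g s) : AnalyticOnNhd ℝ (firstOrderOp X m g) s :=
  fun p hp ↦ ((hg p hp).fderiv.clm_apply (hX p hp)).fun_add ((hm p hp).fun_mul (hg p hp))

lemma analyticOnNhd_iterate_firstOrderOp (hX : AnalyticOnNhd ℝ X s) (hm : AnalyticOnNhd ℝ m s)
    (hg : AnalyticOnNhd ℝ g s) (k : ℕ) : AnalyticOnNhd ℝ ((firstOrderOp X m)^[k] g) s := by
  induction k with
  | zero => exact hg
  | succ k ih =>
    rw [Function.iterate_succ_apply']
    exact analyticOnNhd_firstOrderOp hX hm ih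

lemma analyticOnNhd_lieTerm (hX : AnalyticOnNhd ℝ X s) (hm : AnalyticOnNhd ℝ m s)
    (hx : AnalyticOnNhd ℝ x s) (hg : AnalyticOnNhd ℝ g s) (k : ℕ) :
    AnalyticOnNhd ℝ (lieTerm X m x g k) s :=
  (((hx.neg).fun_pow k).div_const).mul (analyticOnNhd_iterate_firstOrderOp hX hm hg k)

variable [CompleteSpace W]

lemma gauge_firstOrderOp_le {R ρ d : ℝ≥0} (hX : AnalyticAt ℝ X v) (hm : AnalyticAt ℝ m v)
    (hg : AnalyticAt ℝ g v) (hd : ρ + d ≤ R) :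
    d * gauge v ρ (firstOrderOp X m g) ≤
      (gauge v R X + R * gauge v R m) * gauge v (ρ + d) g := by
  have h1 : gauge v ρ (firstOrderOp X m g) ≤
      gauge v ρ (fderiv ℝ g) * gauge v ρ X + gauge v ρ m * gauge v ρ g :=
    (gauge_add_le (hg.fderiv.clm_apply hX) (hm.fun_mul hg)).trans
      (add_le_add (gauge_clm_apply_le hg.fderiv hX) (gauge_mul_le hm hg))
  have hρR : ρ ≤ R := le_self_add.trans hd
  have hdR : (d : ℝ≥0∞) ≤ R := by exact_mod_cast le_add_self.trans hd
  calc d * gauge v ρ (firstOrderOp X m g)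
      ≤ d * (gauge v ρ (fderiv ℝ g) * gauge v ρ X + gauge v ρ m * gauge v ρ g) := by gcongr
    _ = (d * gauge v ρ (fderiv ℝ g)) * gauge v ρ X + d * gauge v ρ m * gauge v ρ g := by ring
    _ ≤ gauge v (ρ + d) g * gauge v R X + R * gauge v R m * gauge v (ρ + d) g := by
      gcongr
      · exact gauge_fderiv_le v ρ d g
      · exact gauge_mono v hρR X
      · exact gauge_mono v hρR m
      · exact gauge_mono v le_self_add g
    _ = _ := by ring

lemma gauge_iterate_firstOrderOp_le {R : ℝ≥0} (d : ℝ≥0) (hX : AnalyticOnNhd ℝ X (Metric.eball v R))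
    (hm : AnalyticOnNhd ℝ m (Metric.eball v R)) (hg : AnalyticOnNhd ℝ g (Metric.eball v R))
    (hR : 0 < R) (k : ℕ) (ρ : ℝ≥0) (hd : ρ + k * d ≤ R) :
    d ^ k * gauge v ρ ((firstOrderOp X m)^[k] g) ≤
      (gauge v R X + R * gauge v R m) ^ k * gauge v (ρ + k * d) g := by
  have hv : v ∈ Metric.eball v (R : ℝ≥0∞) := Metric.mem_eball_self (by exact_mod_cast hR)
  induction k generalizing ρ with
  | zero => simp
  | succ k ih =>
    have e : ρ + (k + 1 : ℕ) * d = (ρ + d) + k * d := by push_cast; ring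
    rw [e] at hd ⊢
    rw [Function.iterate_succ_apply']
    calc (d : ℝ≥0∞) ^ (k + 1) * gauge v ρ (firstOrderOp X m ((firstOrderOp X m)^[k] g))
        = d ^ k * (d * gauge v ρ (firstOrderOp X m ((firstOrderOp X m)^[k] g))) := by ring
      _ ≤ d ^ k * ((gauge v R X + R * gauge v R m) *
          gauge v (ρ + d) ((firstOrderOp X m)^[k] g)) := by
        refine mul_le_mul_right ?_ _
        exact gauge_firstOrderOp_le (hX v hv) (hm v hv)
          (analyticOnNhd_iterate_firstOrderOp hX hm hg k v hv) (le_self_add.trans hd)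
      _ = (gauge v R X + R * gauge v R m) *
          (d ^ k * gauge v (ρ + d) ((firstOrderOp X m)^[k] g)) := by ring
      _ ≤ (gauge v R X + R * gauge v R m) *
          ((gauge v R X + R * gauge v R m) ^ k * gauge v (ρ + d + k * d) g) := by
        exact mul_le_mul_right (ih _ hd) _
      _ = _ := by ring

/-- From `kᵏ ≤ eᵏ k!`. -/
lemma pow_self_le_three_pow_mul_factorial (k : ℕ) : (k : ℝ≥0) ^ k ≤ 3 ^ k * k.factorial := by
  have h1 := Real.pow_div_factorial_le_exp (k : ℝ) (Nat.cast_nonneg k) k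
  have h2 : Real.exp k ≤ 3 ^ k := by
    rw [← Real.exp_one_pow]
    exact pow_le_pow_left₀ (Real.exp_pos 1).le Real.exp_one_lt_three.le k
  rw [div_le_iff₀ (by positivity)] at h1
  have h3 : (k : ℝ) ^ k ≤ 3 ^ k * k.factorial := h1.trans (by gcongr)
  exact_mod_cast h3

/-- **Convergence of Lie series.** If `x` vanishes at `v`, the Lie series converges near `v`: going
down from radius `R` to `R / 2` in `k` equal steps bounds `Pᵏφ` by `k! Kᵏ`, and `x` is small on
small balls. -/
theorem exists_gaugeSummable_lieTerm (hX : AnalyticAt ℝ X v) (hm : AnalyticAt ℝ m v)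
    (hx : AnalyticAt ℝ x v) (hφ : AnalyticAt ℝ φ v) (hx0 : x v = 0) :
    ∃ ρ : ℝ≥0, 0 < ρ ∧ GaugeSummable v ρ (lieTerm X m x φ) := by
  obtain ⟨R₁, hR₁, aX, gX⟩ := hX.exists_gauge_ne_top
  obtain ⟨R₂, hR₂, am, gm⟩ := hm.exists_gauge_ne_top
  obtain ⟨R₃, hR₃, ax, gx⟩ := hx.exists_gauge_ne_top
  obtain ⟨R₄, hR₄, aφ, gφ⟩ := hφ.exists_gauge_ne_top
  obtain ⟨R, hR, h1, h2, h3, h4⟩ : ∃ R : ℝ≥0, 0 < R ∧ R ≤ R₁ ∧ R ≤ R₂ ∧ R ≤ R₃ ∧ R ≤ R₄ :=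
    ⟨min (min R₁ R₂) (min R₃ R₄), by simp [*], by simp, by simp, by simp, by simp⟩
  replace aX := aX.mono (Metric.eball_subset_eball (ENNReal.coe_le_coe.2 h1))
  replace am := am.mono (Metric.eball_subset_eball (ENNReal.coe_le_coe.2 h2))
  replace ax := ax.mono (Metric.eball_subset_eball (ENNReal.coe_le_coe.2 h3))
  replace aφ := aφ.mono (Metric.eball_subset_eball (ENNReal.coe_le_coe.2 h4))
  replace gX := ne_top_of_le_ne_top gX (gauge_mono v h1 X)
  replace gm := ne_top_of_le_ne_top gm (gauge_mono v h2 m)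
  replace gx := ne_top_of_le_ne_top gx (gauge_mono v h3 x)
  replace gφ := ne_top_of_le_ne_top gφ (gauge_mono v h4 φ)
  have hv : v ∈ Metric.eball v (R : ℝ≥0∞) := Metric.mem_eball_self (by exact_mod_cast hR)
  lift gauge v R X to ℝ≥0 using gX with a ha
  lift gauge v R m to ℝ≥0 using gm with b hb
  lift gauge v R x to ℝ≥0 using gx with c hc
  lift gauge v R φ to ℝ≥0 using gφ with e he
  -- `A` bounds one application of `P`, in the sense of `gauge_firstOrderOp_le`.
  set A : ℝ≥0 := a + R * b with hA
  have hit (k : ℕ) : gauge v (R / 2) ((firstOrderOp X m)^[k] φ) ≤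
      ((k.factorial * (6 * A / R) ^ k * e : ℝ≥0) : ℝ≥0∞) := by
    rcases Nat.eq_zero_or_pos k with rfl | hk
    · simp only [Function.iterate_zero, id_eq, Nat.factorial_zero, Nat.cast_one, pow_zero, one_mul]
      rw [he]
      exact gauge_mono v (half_le_self zero_le) φ
    have hk' : (0 : ℝ≥0) < k := by exact_mod_cast hk
    have hstep : R / 2 + k * (R / (2 * k)) = R := by
      have : (k : ℝ≥0) * (R / (2 * k)) = R / 2 := by field_simp
      rw [this, add_halves]
    have h := gauge_iterate_firstOrderOp_le (R / (2 * k)) aX am aφ hR k (R / 2) hstep.le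
    rw [hstep, ← ha, ← hb, ← he] at h
    have hd : (R / (2 * k)) ^ k ≠ 0 := by positivity
    have h' : gauge v (R / 2) ((firstOrderOp X m)^[k] φ) ≤
        (((R / (2 * k)) ^ k)⁻¹ * (A ^ k * e) : ℝ≥0) := by
      rw [ENNReal.coe_mul, ENNReal.coe_inv hd, ← ENNReal.div_eq_inv_mul,
        ENNReal.le_div_iff_mul_le (by left; exact_mod_cast hd) (by simp), mul_comm]
      push_cast [hA]
      exact_mod_cast h
    refine h'.trans (ENNReal.coe_le_coe.2 ?_)
    calc ((R / (2 * k)) ^ k)⁻¹ * (A ^ k * e) = (k : ℝ≥0) ^ k * ((2 * A / R) ^ k * e) := by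
          rw [← inv_pow, ← mul_assoc, ← mul_assoc, ← mul_pow, ← mul_pow]
          congr 2
          field_simp
      _ ≤ (3 ^ k * k.factorial) * ((2 * A / R) ^ k * e) := by
          gcongr
          exact pow_self_le_three_pow_mul_factorial k
      _ = _ := by
          have : (6 * A / R) ^ k = 3 ^ k * (2 * A / R) ^ k := by
            rw [← mul_pow]; congr 1; ring
          rw [this]; ring
  -- A contraction factor making the ratio of the majorizing geometric series at most `1 / 2`.
  obtain ⟨q, hq0, hq1, hq⟩ : ∃ q : ℝ≥0, 0 < q ∧ q ≤ 1 / 2 ∧ q * c * (6 * A / R) ≤ 1 / 2 := by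
    refine ⟨1 / (2 * (1 + c * (6 * A / R))), by positivity, ?_, ?_⟩
    · rw [div_le_div_iff₀ (by positivity) (by positivity)]
      simp
    · rw [div_mul_eq_mul_div, div_mul_eq_mul_div, div_le_div_iff₀ (by positivity) (by positivity)]
      calc 1 * c * (6 * A / R) * 2 = 2 * (c * (6 * A / R)) := by ring
        _ ≤ 2 * (1 + c * (6 * A / R)) := by gcongr; exact le_add_self
        _ = _ := by ring
  have hqR : q * R ≤ R / 2 := by
    calc q * R ≤ 1 / 2 * R := by gcongr
      _ = R / 2 := by ring
  have hqR' : q * R ≤ R := hqR.trans (half_le_self zero_le)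
  refine ⟨q * R, by positivity, ⟨fun k ↦ ?_, ?_⟩⟩
  · exact (analyticOnNhd_lieTerm aX am ax aφ k).mono
      (Metric.eball_subset_eball (ENNReal.coe_le_coe.2 hqR'))
  have hx' : gauge v (q * R) x ≤ ((q * c : ℝ≥0) : ℝ≥0∞) := by
    rw [ENNReal.coe_mul, hc]
    exact gauge_mul_radius_le (hq1.trans (by norm_num)) hx0
  have hterm (k : ℕ) : gauge v (q * R) (lieTerm X m x φ k) ≤
      (((1 / 2) ^ k * e : ℝ≥0) : ℝ≥0∞) := by
    have hP := (analyticOnNhd_iterate_firstOrderOp aX am aφ k) v hv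
    have e1 : lieTerm X m x φ k = fun p ↦ ((-1) ^ k / k.factorial : ℝ) *
        (x p ^ k * (firstOrderOp X m)^[k] φ p) := by
      funext p
      simp only [lieTerm]
      rw [neg_pow]; ring
    have e2 : ‖((-1) ^ k / k.factorial : ℝ)‖ₑ = (((k.factorial : ℝ≥0)⁻¹ : ℝ≥0) : ℝ≥0∞) := by
      rw [enorm_eq_nnnorm]
      congr 1
      simp
    rw [e1]
    refine (gauge_mul_le analyticAt_const ((hx.fun_pow k).fun_mul hP)).trans ?_
    rw [gauge_const, e2]
    calc _ ≤ (((k.factorial : ℝ≥0)⁻¹ : ℝ≥0) : ℝ≥0∞) * (((q * c : ℝ≥0) : ℝ≥0∞) ^ k *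
          ((k.factorial * (6 * A / R) ^ k * e : ℝ≥0) : ℝ≥0∞)) := by
          gcongr
          refine (gauge_mul_le (hx.fun_pow k) hP).trans ?_
          gcongr
          · exact (gauge_pow_le hx k).trans (by gcongr)
          · exact (gauge_mono v hqR _).trans (hit k)
      _ = (((q * c * (6 * A / R)) ^ k * e : ℝ≥0) : ℝ≥0∞) := by
          norm_cast
          have : (k.factorial : ℝ≥0) ≠ 0 := by exact_mod_cast k.factorial_ne_zero
          rw [mul_pow (q * c), mul_assoc (k.factorial : ℝ≥0), mul_left_comm ((q * c) ^ k),
            inv_mul_cancel_left₀ this, mul_assoc]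
      _ ≤ _ := by
          gcongr
  refine ne_top_of_le_ne_top ?_ (ENNReal.tsum_le_tsum hterm)
  rw [ENNReal.tsum_coe_ne_top_iff_summable]
  apply Summable.mul_right
  exact NNReal.summable_geometric (by rw [div_lt_one] <;> norm_num)

end LieSeries

/-! ### Jets of functions and derivatives along vector fields -/

section Jets

variable {W : Type*} [NormedAddCommGroup W] [NormedSpace ℝ W] {v : W}

/-- The derivative `X g` of a function `g` on a vector space along the vector field `X`. -/
def along (X : W → W) (g : W → ℝ) : W → ℝ := fun p ↦ fderiv ℝ g p (X p)

/-- `f` and `g` have the same first-order jet at `v`. -/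
structure OneJetEq (f g : W → ℝ) (v : W) : Prop where
  zero : f v = g v
  one : fderiv ℝ f v = fderiv ℝ g v

/-- `f` and `g` have the same second-order jet at `v`. -/
structure TwoJetEq (f g : W → ℝ) (v : W) : Prop extends OneJetEq f g v where
  two : fderiv ℝ (fderiv ℝ f) v = fderiv ℝ (fderiv ℝ g) v

lemma OneJetEq.trans {f g h : W → ℝ} (a : OneJetEq f g v) (b : OneJetEq g h v) :
    OneJetEq f h v := ⟨a.zero.trans b.zero, a.one.trans b.one⟩

lemma TwoJetEq.trans {f g h : W → ℝ} (a : TwoJetEq f g v) (b : TwoJetEq g h v) :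
    TwoJetEq f h v := ⟨a.toOneJetEq.trans b.toOneJetEq, a.two.trans b.two⟩

lemma OneJetEq.mul_zero {f g : W → ℝ} (hf : DifferentiableAt ℝ f v) (hg : DifferentiableAt ℝ g v)
    (h : OneJetEq g 0 v) : OneJetEq (fun p ↦ f p * g p) 0 v := by
  have h1 : fderiv ℝ g v = 0 := by rw [h.one]; simp
  refine ⟨by simp [h.zero], ?_⟩
  rw [fderiv_fun_mul hf hg, h1, h.zero]
  simp

lemma oneJetEq_mul_zero {f g : W → ℝ} (hf : DifferentiableAt ℝ f v) (hg : DifferentiableAt ℝ g v)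
    (hf0 : f v = 0) (hg0 : g v = 0) : OneJetEq (fun p ↦ f p * g p) 0 v := by
  refine ⟨by simp [hf0], ?_⟩
  rw [fderiv_fun_mul hf hg, hf0, hg0]
  simp

lemma twoJetEq_mul_zero {f g : W → ℝ} (hf : AnalyticAt ℝ f v) (hg : AnalyticAt ℝ g v)
    (hf0 : f v = 0) (hg0 : OneJetEq g 0 v) : TwoJetEq (fun p ↦ f p * g p) 0 v := by
  have hg1 : fderiv ℝ g v = 0 := by rw [hg0.one]; simp
  refine ⟨hg0.mul_zero hf.differentiableAt hg.differentiableAt, ?_⟩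
  have e : fderiv ℝ (fun p ↦ f p * g p) =ᶠ[𝓝 v]
      fun p ↦ f p • fderiv ℝ g p + g p • fderiv ℝ f p := by
    filter_upwards [hf.eventually_analyticAt, hg.eventually_analyticAt] with p h1 h2
    rw [fderiv_fun_mul h1.differentiableAt h2.differentiableAt]
  have e0 : fderiv ℝ (0 : W → ℝ) = 0 := by ext; simp
  rw [e.fderiv_eq, fderiv_fun_add (hf.fun_smul hg.fderiv).differentiableAt
    (hg.fun_smul hf.fderiv).differentiableAt,
    fderiv_fun_smul hf.differentiableAt hg.fderiv.differentiableAt,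
    fderiv_fun_smul hg.differentiableAt hf.fderiv.differentiableAt, hf0, hg1, hg0.zero, e0]
  ext
  simp

lemma TwoJetEq.along {f g : W → ℝ} {X : W → W} (h : TwoJetEq f g v)
    (hX : DifferentiableAt ℝ X v) (hf : ContDiffAt ℝ 2 f v) (hg : ContDiffAt ℝ 2 g v) :
    OneJetEq (along X f) (along X g) v := by
  refine ⟨by simp [FinslerMetrizability.along, h.one], ?_⟩
  have hf' := (hf.fderiv_right (m := 1) (by norm_num)).differentiableAt (by simp)
  have hg' := (hg.fderiv_right (m := 1) (by norm_num)).differentiableAt (by simp)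
  unfold FinslerMetrizability.along
  rw [fderiv_clm_apply hf' hX, fderiv_clm_apply hg' hX, h.one, h.two]

lemma _root_.AnalyticAt.along {X : W → W} {g : W → ℝ} (hX : AnalyticAt ℝ X v)
    (hg : AnalyticAt ℝ g v) : AnalyticAt ℝ (along X g) v := hg.fderiv.clm_apply hX

lemma along_congr {X : W → W} {f g : W → ℝ} (h : f =ᶠ[𝓝 v] g) : along X f =ᶠ[𝓝 v] along X g := by
  filter_upwards [h.fderiv (𝕜 := ℝ)] with p hp
  simp [along, hp]

lemma along_eventuallyEq_zero {X : W → W} {f : W → ℝ} (h : f =ᶠ[𝓝 v] 0) :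
    along X f =ᶠ[𝓝 v] 0 := by
  refine (along_congr h).trans (Filter.Eventually.of_forall fun p ↦ ?_)
  simp [along]

lemma along_mul {X : W → W} {f g : W → ℝ} {p : W} (hf : DifferentiableAt ℝ f p)
    (hg : DifferentiableAt ℝ g p) :
    along X (fun q ↦ f q * g q) p = f p * along X g p + g p * along X f p := by
  simp [along, fderiv_fun_mul hf hg]

lemma along_lieBracket {X Y : W → W} {g : W → ℝ} (hX : DifferentiableAt ℝ X v)
    (hY : DifferentiableAt ℝ Y v) (hg : ContDiffAt ℝ 2 g v) :
    along (VectorField.lieBracket ℝ X Y) g v =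
      along X (along Y g) v - along Y (along X g) v :=
  VectorField.fderiv_apply_lieBracket hg (by simp) hY hX

/-- Every second-order jet of a smooth function is the jet of a quadratic polynomial. -/
lemma exists_analytic_twoJetEq {E : W → ℝ} (hE : ContDiffAt ℝ ∞ E v) :
    ∃ φ : W → ℝ, AnalyticAt ℝ φ v ∧ TwoJetEq φ E v := by
  have hsymm : IsSymmSndFDerivAt ℝ E v := hE.isSymmSndFDerivAt (by simpa using ENat.LEInfty.out)
  set B := fderiv ℝ (fderiv ℝ E) v
  let t : W → W := fun p ↦ p - v
  have ht (p : W) : HasFDerivAt t (ContinuousLinearMap.id ℝ W) p := (hasFDerivAt_id p).sub_const v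
  let φ : W → ℝ := fun p ↦ E v + fderiv ℝ E v (t p) + (1 / 2) * B (t p) (t p)
  have hBt (p : W) : HasFDerivAt (fun p ↦ B (t p)) B p := B.hasFDerivAt.comp p (ht p)
  have hD : fderiv ℝ φ = fun p ↦ fderiv ℝ E v + B (t p) := by
    funext p
    have h1 := (((fderiv ℝ E v).hasFDerivAt.comp p (ht p)).const_add (E v)).add
      (((hBt p).clm_apply (ht p)).const_mul (1 / 2))
    refine h1.fderiv.trans ?_
    ext w
    have := hsymm w (t p)
    simp only [ContinuousLinearMap.comp_id, one_div, add_apply, smul_apply, smul_eq_mul,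
      ContinuousLinearMap.flip_apply]
    change fderiv ℝ E v w + 2⁻¹ * (B (t p) w + B w (t p)) = _
    rw [show B w (t p) = B (t p) w from this]
    ring
  have htan : AnalyticAt ℝ t v := analyticAt_id.fun_sub analyticAt_const
  have hφ : AnalyticAt ℝ φ v :=
    (analyticAt_const.fun_add (((fderiv ℝ E v).analyticAt _).comp htan)).fun_add
      (analyticAt_const.fun_mul (((B.analyticAt _).comp htan).clm_apply htan))
  refine ⟨φ, hφ, ⟨⟨by simp [φ, t], ?_⟩, ?_⟩⟩
  · rw [hD]; simp [t]
  · rw [hD, fderiv_const_add, (hBt v).fderiv]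

end Jets

/-! ### Sums of Lie series -/

section LieSeriesGerm

variable {W : Type*} [NormedAddCommGroup W] [NormedSpace ℝ W]
  {X : W → W} {m x φ : W → ℝ} {v : W}

lemma firstOrderOp_eq_along (X : W → W) (m g : W → ℝ) :
    firstOrderOp X m g = fun p ↦ along X g p + m p * g p := rfl

lemma AnalyticAt.firstOrderOp {g : W → ℝ} (hX : AnalyticAt ℝ X v) (hm : AnalyticAt ℝ m v)
    (hg : AnalyticAt ℝ g v) : AnalyticAt ℝ (firstOrderOp X m g) v :=
  (hX.along hg).fun_add (hm.fun_mul hg)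

lemma analyticAt_iterate_firstOrderOp {g : W → ℝ} (hX : AnalyticAt ℝ X v) (hm : AnalyticAt ℝ m v)
    (hg : AnalyticAt ℝ g v) (k : ℕ) : AnalyticAt ℝ ((firstOrderOp X m)^[k] g) v := by
  induction k with
  | zero => exact hg
  | succ k ih =>
    rw [Function.iterate_succ_apply']
    exact AnalyticAt.firstOrderOp hX hm ih

/-- The telescoping identity behind the Lie series: where `X x = 1`, applying `P = X + m` to
the `k`-th term of the series of `φ` gives the difference of two consecutive terms of the series of
`Pφ`. -/
lemma firstOrderOp_lieTerm_succ {p : W} (hX : AnalyticAt ℝ X p) (hm : AnalyticAt ℝ m p)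
    (hx : AnalyticAt ℝ x p) (hφ : AnalyticAt ℝ φ p) (h1 : along X x p = 1) (k : ℕ) :
    firstOrderOp X m (lieTerm X m x φ (k + 1)) p =
      lieTerm X m x (firstOrderOp X m φ) (k + 1) p -
        lieTerm X m x (firstOrderOp X m φ) k p := by
  have hg := analyticAt_iterate_firstOrderOp hX hm hφ (k + 1)
  have hc : HasFDerivAt (fun q ↦ (-x q) ^ (k + 1) / ((k + 1).factorial : ℝ))
      ((-((-x p) ^ k / (k.factorial : ℝ))) • fderiv ℝ x p) p := by
    have h2 := ((hx.differentiableAt.hasFDerivAt.fun_neg.pow (k + 1)).mul_const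
      ((k + 1).factorial : ℝ)⁻¹)
    refine h2.congr_fderiv ?_
    ext w
    have : (k.factorial : ℝ) ≠ 0 := by exact_mod_cast k.factorial_ne_zero
    simp [Nat.factorial_succ]
    field_simp
  have e : along X (lieTerm X m x φ (k + 1)) p =
      (-x p) ^ (k + 1) / ((k + 1).factorial : ℝ) * along X ((firstOrderOp X m)^[k + 1] φ) p +
      (firstOrderOp X m)^[k + 1] φ p * -((-x p) ^ k / (k.factorial : ℝ)) := by
    have := along_mul (X := X) hc.differentiableAt hg.differentiableAt
    refine this.trans ?_
    congr 2
    have h1' : fderiv ℝ x p (X p) = 1 := h1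
    simp [along, hc.fderiv, h1']
  rw [firstOrderOp_eq_along]
  simp only [e, lieTerm]
  rw [← Function.iterate_succ_apply, ← Function.iterate_succ_apply,
    Function.iterate_succ_apply' _ (k + 1), firstOrderOp_eq_along X m ((firstOrderOp X m)^[k + 1] φ)]
  ring

lemma along_lieTerm_eventuallyEq_zero {Y : W → W} (hX : AnalyticAt ℝ X v) (hm : AnalyticAt ℝ m v)
    (hx : AnalyticAt ℝ x v) (hφ : AnalyticAt ℝ φ v)
    (hYP : ∀ g, AnalyticAt ℝ g v → along Y g =ᶠ[𝓝 v] 0 → along Y (firstOrderOp X m g) =ᶠ[𝓝 v] 0)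
    (hYx : along Y x =ᶠ[𝓝 v] 0) (hYφ : along Y φ =ᶠ[𝓝 v] 0) (k : ℕ) :
    along Y (lieTerm X m x φ k) =ᶠ[𝓝 v] 0 := by
  have h (j : ℕ) : along Y ((firstOrderOp X m)^[j] φ) =ᶠ[𝓝 v] 0 := by
    induction j with
    | zero => exact hYφ
    | succ j ih =>
      rw [Function.iterate_succ_apply']
      exact hYP _ (analyticAt_iterate_firstOrderOp hX hm hφ j) ih
  filter_upwards [h k, hYx, hx.eventually_analyticAt,
    (analyticAt_iterate_firstOrderOp hX hm hφ k).eventually_analyticAt] with p h1 h2 h3 h4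
  have hc := (h3.differentiableAt.hasFDerivAt.fun_neg.pow k).mul_const (k.factorial : ℝ)⁻¹
  have := along_mul (X := Y) hc.differentiableAt h4.differentiableAt
  refine this.trans ?_
  have h2' : fderiv ℝ x p (Y p) = 0 := h2
  rw [h1]
  simp [along, hc.fderiv, h2']

lemma lieTerm_zero : lieTerm X m x φ 0 = φ := by
  funext p; simp [lieTerm]

lemma oneJetEq_lieTerm_zero (hX : AnalyticAt ℝ X v) (hm : AnalyticAt ℝ m v)
    (hx : AnalyticAt ℝ x v) (hφ : AnalyticAt ℝ φ v) (hx0 : x v = 0)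
    (hP : firstOrderOp X m φ v = 0) (k : ℕ) : OneJetEq (lieTerm X m x φ (k + 1)) 0 v := by
  have hg := analyticAt_iterate_firstOrderOp hX hm hφ (k + 1)
  have e : lieTerm X m x φ (k + 1) = fun p ↦ x p * (((-1) ^ (k + 1) / (k + 1).factorial) *
      (x p ^ k * (firstOrderOp X m)^[k + 1] φ p)) := by
    funext p; simp only [lieTerm]; rw [neg_pow]; ring
  rw [e]
  refine oneJetEq_mul_zero hx.differentiableAt
    ((analyticAt_const.fun_mul ((hx.fun_pow k).fun_mul hg)).differentiableAt) hx0 ?_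
  rcases k with _ | k
  · simp [hP]
  · simp [hx0]

lemma twoJetEq_lieTerm_zero (hX : AnalyticAt ℝ X v) (hm : AnalyticAt ℝ m v)
    (hx : AnalyticAt ℝ x v) (hφ : AnalyticAt ℝ φ v) (hx0 : x v = 0)
    (hP : OneJetEq (firstOrderOp X m φ) 0 v) (k : ℕ) :
    TwoJetEq (lieTerm X m x φ (k + 1)) 0 v := by
  have hg := analyticAt_iterate_firstOrderOp hX hm hφ (k + 1)
  have e : lieTerm X m x φ (k + 1) = fun p ↦ x p * (((-1) ^ (k + 1) / (k + 1).factorial) *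
      (x p ^ k * (firstOrderOp X m)^[k + 1] φ p)) := by
    funext p; simp only [lieTerm]; rw [neg_pow]; ring
  rw [e]
  refine twoJetEq_mul_zero hx (analyticAt_const.fun_mul ((hx.fun_pow k).fun_mul hg)) hx0 ?_
  refine OneJetEq.mul_zero (by fun_prop) ((hx.fun_pow k).fun_mul hg).differentiableAt ?_
  rcases k with _ | _ | k
  · simpa using hP
  · have h2 : (firstOrderOp X m)^[2] φ v = 0 := by
      have h3 : fderiv ℝ (firstOrderOp X m φ) v = 0 := by rw [hP.one]; simp
      have h4 : firstOrderOp X m φ v = 0 := by rw [hP.zero]; simp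
      change fderiv ℝ (firstOrderOp X m φ) v (X v) + m v * firstOrderOp X m φ v = 0
      rw [h3, h4]; simp
    exact oneJetEq_mul_zero (hx.fun_pow 1).differentiableAt hg.differentiableAt (by simp [hx0]) h2
  · have e2 : (fun p ↦ x p ^ (k + 1 + 1) * (firstOrderOp X m)^[k + 1 + 1 + 1] φ p) = fun p ↦
        x p * (x p ^ (k + 1) * (firstOrderOp X m)^[k + 1 + 1 + 1] φ p) := by
      funext p; ring
    rw [e2]
    exact oneJetEq_mul_zero hx.differentiableAt ((hx.fun_pow _).fun_mul hg).differentiableAt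
      hx0 (by simp [hx0])

lemma eq_apply_zero_of_hasSum {A : Type*} [NormedAddCommGroup A] {a : ℕ → A} {b : A}
    (h : HasSum a b) (h0 : ∀ k, a (k + 1) = 0) : b = a 0 :=
  h.unique (hasSum_single 0 fun k hk ↦ by
    obtain ⟨j, rfl⟩ := Nat.exists_eq_succ_of_ne_zero hk
    exact h0 j)

variable [CompleteSpace W]

/-- **Sums of Lie series.** Let `P = X + m` and `x(v) = 0`. The sum `G = ∑ₖ (-x)ᵏ/k! · Pᵏφ` is
analytic, solves `PG = 0` if `X x = 1`, is killed by every derivation that kills `x` and `φ` and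
whose kernel is stable under `P`, and has the same jet as `φ` as soon as `Pφ` vanishes to the
order below. -/
theorem exists_lieSeries (hX : AnalyticAt ℝ X v) (hm : AnalyticAt ℝ m v)
    (hx : AnalyticAt ℝ x v) (hφ : AnalyticAt ℝ φ v) (hx0 : x v = 0)
    (hx1 : along X x =ᶠ[𝓝 v] 1) :
    ∃ G : W → ℝ, AnalyticAt ℝ G v ∧ firstOrderOp X m G =ᶠ[𝓝 v] 0 ∧
      (∀ Y : W → W, AnalyticAt ℝ Y v → along Y x =ᶠ[𝓝 v] 0 → along Y φ =ᶠ[𝓝 v] 0 →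
        (∀ g, AnalyticAt ℝ g v → along Y g =ᶠ[𝓝 v] 0 →
          along Y (firstOrderOp X m g) =ᶠ[𝓝 v] 0) → along Y G =ᶠ[𝓝 v] 0) ∧
      (firstOrderOp X m φ v = 0 → OneJetEq G φ v) ∧
      (OneJetEq (firstOrderOp X m φ) 0 v → TwoJetEq G φ v) := by
  obtain ⟨ρ, hρ, hS⟩ := exists_gaugeSummable_lieTerm hX hm hx hφ hx0
  obtain ⟨σ, hσ, hS'⟩ := exists_gaugeSummable_lieTerm hX hm hx (AnalyticAt.firstOrderOp hX hm hφ) hx0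
  set f := lieTerm X m x φ with hf
  -- Each of the two derivatives taken term by term costs a third of the radius.
  obtain ⟨d, hd, rfl⟩ : ∃ d : ℝ≥0, 0 < d ∧ ρ = d + d + d :=
    ⟨ρ / 3, by positivity, by rw [← add_div, ← add_div]; field_simp; norm_num⟩
  set G : W → ℝ := fun p ↦ ∑' k, f k p with hG
  have hGan := hS.analyticOnNhd_tsum hρ
  have hmem {r : ℝ≥0} (hr : 0 < r) : Metric.eball v (r : ℝ≥0∞) ∈ 𝓝 v :=
    Metric.eball_mem_nhds v (by exact_mod_cast hr)
  have hv {r : ℝ≥0} (hr : 0 < r) : v ∈ Metric.eball v (r : ℝ≥0∞) := mem_of_mem_nhds (hmem hr)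
  have hS1 := hS.fderiv hd
  have hd2 : 0 < d + d := by positivity
  have hsub : Metric.eball v ((d + d : ℝ≥0) : ℝ≥0∞) ⊆ Metric.eball v ((d + d + d : ℝ≥0) : ℝ≥0∞) :=
    Metric.eball_subset_eball (by exact_mod_cast le_self_add)
  have hD1 {p : W} (hp : p ∈ Metric.eball v ((d + d : ℝ≥0) : ℝ≥0∞)) :
      HasSum (fun k ↦ fderiv ℝ (f k) p) (fderiv ℝ G p) := by
    rw [(hS.hasFDerivAt hd hp).fderiv]
    exact (hS1.summable hp).hasSum
  have hD2 : HasSum (fun k ↦ fderiv ℝ (fderiv ℝ (f k)) v) (fderiv ℝ (fderiv ℝ G) v) := by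
    have e : fderiv ℝ G =ᶠ[𝓝 v] fun p ↦ ∑' k, fderiv ℝ (f k) p := by
      filter_upwards [hmem hd2] with p hp using (hD1 hp).tsum_eq.symm
    rw [e.fderiv_eq, (hS1.hasFDerivAt hd (hv hd)).fderiv]
    exact ((hS1.fderiv hd).summable (hv hd)).hasSum
  have hD0 {p : W} (hp : p ∈ Metric.eball v ((d + d : ℝ≥0) : ℝ≥0∞)) :
      HasSum (fun k ↦ f k p) (G p) := (hS.summable (hsub hp)).hasSum
  have hop {p : W} (Y : W → W) (l : W → ℝ) (hp : p ∈ Metric.eball v ((d + d : ℝ≥0) : ℝ≥0∞)) :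
      HasSum (fun k ↦ firstOrderOp Y l (f k) p) (firstOrderOp Y l G p) :=
    ((ContinuousLinearMap.apply ℝ ℝ (Y p)).hasSum (hD1 hp)).add ((hD0 hp).mul_left (l p))
  have hf0 : f 0 = φ := lieTerm_zero
  have hj1 (h : firstOrderOp X m φ v = 0) : OneJetEq G φ v := by
    have hk (k : ℕ) := oneJetEq_lieTerm_zero hX hm hx hφ hx0 h k
    refine ⟨?_, ?_⟩
    · rw [eq_apply_zero_of_hasSum (hD0 (hv hd2)) fun k ↦ by simpa using (hk k).zero, hf0]
    · rw [eq_apply_zero_of_hasSum (hD1 (hv hd2)) fun k ↦ by rw [(hk k).one]; simp, hf0]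
  refine ⟨G, hGan v (hv hρ), ?_, fun Y hY hYx hYφ hYP ↦ ?_, hj1, fun h ↦ ?_⟩
  · filter_upwards [hmem hd2, hmem hσ, hx1, hX.eventually_analyticAt, hm.eventually_analyticAt,
      hx.eventually_analyticAt, hφ.eventually_analyticAt] with p h1 h2 h3 h4 h5 h6 h7
    set a : ℕ → ℝ := fun k ↦ lieTerm X m x (firstOrderOp X m φ) k p with ha
    have hpart (N : ℕ) : ∑ k ∈ Finset.range (N + 1), firstOrderOp X m (f k) p = a N := by
      induction N with
      | zero => simp [hf0, ha, lieTerm_zero]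
      | succ N ih =>
        rw [Finset.sum_range_succ, ih, hf, firstOrderOp_lieTerm_succ h4 h5 h6 h7 (by simpa using h3)]
        simp [ha]
    have ht := (Filter.tendsto_add_atTop_iff_nat 1).2 (hop X m h1).tendsto_sum_nat
    simp only [hpart] at ht
    exact tendsto_nhds_unique ht (hS'.summable h2).tendsto_atTop_zero
  · have hk (k : ℕ) := along_lieTerm_eventuallyEq_zero hX hm hx hφ hYP hYx hYφ k
    -- The neighbourhood on which the `k`-th term is killed depends on `k`; by the identity theorem
    -- it contains a fixed ball.
    obtain ⟨τ, hτ, hYτ⟩ : ∃ τ : ℝ≥0, 0 < τ ∧ AnalyticOnNhd ℝ Y (Metric.eball v τ) := by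
      obtain ⟨τ, h1, h2, -⟩ := hY.exists_gauge_ne_top
      exact ⟨τ, h1, h2⟩
    have hmin : 0 < min τ (d + d) := lt_min hτ hd2
    have hs1 : Metric.eball v ((min τ (d + d) : ℝ≥0) : ℝ≥0∞) ⊆ Metric.eball v τ :=
      Metric.eball_subset_eball (by exact_mod_cast min_le_left _ _)
    have hs2 : Metric.eball v ((min τ (d + d) : ℝ≥0) : ℝ≥0∞) ⊆
        Metric.eball v ((d + d : ℝ≥0) : ℝ≥0∞) :=
      Metric.eball_subset_eball (by exact_mod_cast min_le_right _ _)
    filter_upwards [hmem hmin] with p hp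
    have hterm (k : ℕ) : along Y (f k) p = 0 := by
      have han : AnalyticOnNhd ℝ (along Y (f k)) (Metric.eball v (min τ (d + d) : ℝ≥0)) :=
        fun q hq ↦ (hYτ q (hs1 hq)).along (hS.analyticOnNhd k q (hsub (hs2 hq)))
      refine han.eqOn_zero_of_preconnected_of_eventuallyEq_zero ?_ (hv hmin) (hk k) hp
      rw [Metric.eball_coe]
      exact (convex_ball v _).isPreconnected
    have h1 := hop Y 0 (hs2 hp)
    have e (g : W → ℝ) : firstOrderOp Y 0 g p = along Y g p := by simp [firstOrderOp, along]
    simp only [e, hterm] at h1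
    exact h1.unique hasSum_zero
  · have hk (k : ℕ) := twoJetEq_lieTerm_zero hX hm hx hφ hx0 h k
    refine ⟨hj1 (by simpa using h.zero), ?_⟩
    have h0 : fderiv ℝ (0 : W → ℝ) = 0 := by ext; simp
    have h2 (k : ℕ) : fderiv ℝ (fderiv ℝ (f (k + 1))) v = 0 := by
      rw [(hk k).two, h0]; simp
    rw [← hf0]
    exact eq_apply_zero_of_hasSum (a := fun k ↦ fderiv ℝ (fderiv ℝ (f k)) v) hD2 h2

end LieSeriesGerm

/-! ### Commuting frames of involutive analytic distributions -/

section Frame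

variable {W : Type*} [NormedAddCommGroup W] [NormedSpace ℝ W] {ι : Type*} [Fintype ι] {v : W}

/-- Brackets of combinations, with function coefficients, of fields `Z i` whose brackets lie in
the span of the `Z i` again lie in that span. -/
lemma lieBracket_sum_smul_mem {Z : ι → W → W} {c d : ι → W → ℝ} {p : W}
    (hZ : ∀ i, DifferentiableAt ℝ (Z i) p) (hc : ∀ i, DifferentiableAt ℝ (c i) p)
    (hd : ∀ i, DifferentiableAt ℝ (d i) p)
    (hbr : ∀ i j, VectorField.lieBracket ℝ (Z i) (Z j) p ∈
      Submodule.span ℝ (Set.range fun k ↦ Z k p)) :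
    VectorField.lieBracket ℝ (fun q ↦ ∑ i, c i q • Z i q) (fun q ↦ ∑ i, d i q • Z i q) p ∈
      Submodule.span ℝ (Set.range fun k ↦ Z k p) := by
  have hD {c : ι → W → ℝ} (hc : ∀ i, DifferentiableAt ℝ (c i) p) (h : W) :
      fderiv ℝ (fun q ↦ ∑ i, c i q • Z i q) p h =
        ∑ i, c i p • fderiv ℝ (Z i) p h + ∑ i, fderiv ℝ (c i) p h • Z i p := by
    rw [fderiv_fun_sum fun i _ ↦ (hc i).fun_smul (hZ i), ← Finset.sum_add_distrib]
    simp only [sum_apply]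
    refine Finset.sum_congr rfl fun i _ ↦ ?_
    rw [fderiv_fun_smul (hc i) (hZ i)]
    simp
  have hmem (a : ι → ℝ) : ∑ i, a i • Z i p ∈ Submodule.span ℝ (Set.range fun k ↦ Z k p) :=
    Submodule.sum_mem _ fun i _ ↦ Submodule.smul_mem _ _ (Submodule.subset_span ⟨i, rfl⟩)
  have hmid : ∑ j, d j p • fderiv ℝ (Z j) p (∑ i, c i p • Z i p) -
      ∑ i, c i p • fderiv ℝ (Z i) p (∑ j, d j p • Z j p) =
      ∑ j, ∑ i, (d j p * c i p) • VectorField.lieBracket ℝ (Z i) (Z j) p := by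
    simp only [map_sum, map_smul, Finset.smul_sum, VectorField.lieBracket, smul_sub,
      Finset.sum_sub_distrib, smul_smul]
    congr 1
    rw [Finset.sum_comm]
    simp only [mul_comm]
  simp only [VectorField.lieBracket]
  rw [hD hd, hD hc]
  have e (a b c d : W) : a + b - (c + d) = (a - c) + b - d := by abel
  rw [e, hmid]
  refine Submodule.sub_mem _ (Submodule.add_mem _ ?_ (hmem _)) (hmem _)
  exact Submodule.sum_mem _ fun j _ ↦ Submodule.sum_mem _ fun i _ ↦ Submodule.smul_mem _ _ (hbr i j)

variable [FiniteDimensional ℝ W] [DecidableEq ι]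

/-- A pointwise independent involutive family of analytic fields near `v` spans the same
distribution as a commuting one, normalized by `ξ b (X a) = δ_{ab}` for fixed linear functionals
`ξ b`: a bracket `[X a, X b]` is a combination of the `X c` killed by all the `ξ c`. -/
lemma exists_commuting_frame {Z : ι → W → W} (hZ : ∀ i, AnalyticAt ℝ (Z i) v)
    (hlin : LinearIndependent ℝ fun i ↦ Z i v)
    (hbr : ∀ i j, ∀ᶠ p in 𝓝 v, VectorField.lieBracket ℝ (Z i) (Z j) p ∈
      Submodule.span ℝ (Set.range fun k ↦ Z k p)) :
    ∃ (X : ι → W → W) (ξ : ι → W →L[ℝ] ℝ) (c : ι → ι → W → ℝ),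
      (∀ a, AnalyticAt ℝ (X a) v) ∧ (∀ a i, AnalyticAt ℝ (c a i) v) ∧
      (∀ a p, X a p = ∑ i, c a i p • Z i p) ∧
      (∀ a b, ∀ᶠ p in 𝓝 v, ξ b (X a p) = if a = b then 1 else 0) ∧
      (∀ i, ∀ᶠ p in 𝓝 v, Z i p = ∑ a, ξ a (Z i p) • X a p) ∧
      (∀ a b, VectorField.lieBracket ℝ (X a) (X b) =ᶠ[𝓝 v] 0) := by
  classical
  -- `L p` maps coordinates to combinations of the `Z i p`.
  let L : W → (ι → ℝ) →L[ℝ] W := fun p ↦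
    ∑ i, ContinuousLinearMap.smulRightL ℝ (ι → ℝ) W (ContinuousLinearMap.proj i) (Z i p)
  have hLan : AnalyticAt ℝ L v := by
    refine Finset.analyticAt_fun_sum _ fun i _ ↦ ?_
    exact (ContinuousLinearMap.analyticAt _ _).comp (hZ i)
  have hL (p : W) (y : ι → ℝ) : L p y = ∑ i, y i • Z i p := by
    simp [L]
  have hLs (p : W) (i : ι) : L p (Pi.single i 1) = Z i p := by
    rw [hL, Finset.sum_eq_single i] <;> simp +contextual
  obtain ⟨Ξ₀, hΞ₀⟩ := (L v).toLinearMap.exists_leftInverse_of_injective (by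
    rw [LinearMap.ker_eq_bot']
    intro y hy
    have hy' : ∑ i, y i • Z i v = 0 := by rw [← hL]; exact hy
    exact funext (Fintype.linearIndependent_iff.1 hlin y hy'))
  let Ξ : W →L[ℝ] (ι → ℝ) := LinearMap.toContinuousLinearMap Ξ₀
  let T : W → (ι → ℝ) →L[ℝ] (ι → ℝ) := fun p ↦ ContinuousLinearMap.compL ℝ _ _ _ Ξ (L p)
  have hTan : AnalyticAt ℝ T v := (ContinuousLinearMap.analyticAt _ _).comp hLan
  have hT (p : W) (y : ι → ℝ) : T p y = Ξ (L p y) := rfl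
  have hTv : T v = 1 := by
    ext1 y
    exact LinearMap.congr_fun hΞ₀ y
  let N : W → (ι → ℝ) →L[ℝ] (ι → ℝ) := fun p ↦ Ring.inverse (T p)
  have hNan : AnalyticAt ℝ N v := by
    have h := analyticAt_inverse (𝕜 := ℝ) (1 : ((ι → ℝ) →L[ℝ] (ι → ℝ))ˣ)
    rw [Units.val_one, ← hTv] at h
    exact h.comp hTan
  have hunit : ∀ᶠ p in 𝓝 v, IsUnit (T p) := by
    have : ∀ᶠ t in 𝓝 (T v), IsUnit t := by
      rw [hTv]; exact Units.isOpen.mem_nhds isUnit_one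
    exact hTan.continuousAt.eventually this
  have hTN : ∀ᶠ p in 𝓝 v, ∀ y, T p (N p y) = y := by
    filter_upwards [hunit] with p hp y
    have := Ring.mul_inverse_cancel _ hp
    exact congrArg (fun f : (ι → ℝ) →L[ℝ] (ι → ℝ) ↦ f y) this
  have hNT : ∀ᶠ p in 𝓝 v, ∀ y, N p (T p y) = y := by
    filter_upwards [hunit] with p hp y
    have := Ring.inverse_mul_cancel _ hp
    exact congrArg (fun f : (ι → ℝ) →L[ℝ] (ι → ℝ) ↦ f y) this
  let c : ι → ι → W → ℝ := fun a i p ↦ N p (Pi.single a 1) i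
  let X : ι → W → W := fun a p ↦ ∑ i, c a i p • Z i p
  have hcan (a i : ι) : AnalyticAt ℝ (c a i) v := by
    let P : ((ι → ℝ) →L[ℝ] (ι → ℝ)) →L[ℝ] ℝ := ContinuousLinearMap.proj i ∘L
      ContinuousLinearMap.apply ℝ (ι → ℝ) (Pi.single a (1 : ℝ))
    exact (P.analyticAt (N v)).comp hNan
  have hXan (a : ι) : AnalyticAt ℝ (X a) v :=
    Finset.analyticAt_fun_sum _ fun i _ ↦ (hcan a i).fun_smul (hZ i)
  have hXL (a : ι) (p : W) : X a p = L p (N p (Pi.single a 1)) := (hL _ _).symm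
  have hΞX (a : ι) : ∀ᶠ p in 𝓝 v, Ξ (X a p) = Pi.single a 1 := by
    filter_upwards [hTN] with p hp
    rw [hXL, ← hT, hp]
  refine ⟨X, fun b ↦ ContinuousLinearMap.proj b ∘L Ξ, c, hXan, hcan, fun _ _ ↦ rfl,
    fun a b ↦ ?_, fun i ↦ ?_, fun a b ↦ ?_⟩
  · filter_upwards [hΞX a] with p hp
    simp [hp, Pi.single_apply, eq_comm]
  · filter_upwards [hNT] with p hp
    have h1 : Z i p = L p (N p (Ξ (Z i p))) := by
      conv_lhs => rw [← hLs p i, ← hp (Pi.single i 1), hT, hLs]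
    have h2 : Ξ (Z i p) = ∑ a, (Ξ (Z i p)) a • (Pi.single a (1 : ℝ) : ι → ℝ) := by
      ext j
      simp [Finset.sum_apply, Pi.single_apply]
    conv_lhs => rw [h1, h2, map_sum, map_sum]
    refine Finset.sum_congr rfl fun a _ ↦ ?_
    rw [map_smul, map_smul, ← hXL]
    rfl
  · have hev : ∀ᶠ p in 𝓝 v, (∀ i, AnalyticAt ℝ (Z i) p) ∧ (∀ i, AnalyticAt ℝ (c a i) p) ∧
        (∀ i, AnalyticAt ℝ (c b i) p) ∧ ∀ i j, VectorField.lieBracket ℝ (Z i) (Z j) p ∈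
      Submodule.span ℝ (Set.range fun k ↦ Z k p) := by
      refine (Filter.eventually_all.2 fun i ↦ (hZ i).eventually_analyticAt).and
        ((Filter.eventually_all.2 fun i ↦ (hcan a i).eventually_analyticAt).and
        ((Filter.eventually_all.2 fun i ↦ (hcan b i).eventually_analyticAt).and
        (Filter.eventually_all.2 fun i ↦ Filter.eventually_all.2 fun j ↦ hbr i j)))
    have hD (a : ι) : ∀ᶠ p in 𝓝 v, ∀ w, Ξ (fderiv ℝ (X a) p w) = 0 := by
      filter_upwards [(hΞX a).eventually_nhds, (hXan a).eventually_analyticAt] with p hp hp' w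
      have h1 : (fun q ↦ Ξ (X a q)) =ᶠ[𝓝 p] fun _ ↦ Pi.single a 1 := hp
      have h2 := (Ξ.hasFDerivAt.comp p hp'.differentiableAt.hasFDerivAt).fderiv
      have h3 : fderiv ℝ (fun q ↦ Ξ (X a q)) p = 0 := by rw [h1.fderiv_eq]; simp
      have h4 := h2.symm.trans h3
      exact congrArg (fun f : W →L[ℝ] (ι → ℝ) ↦ f w) h4
    filter_upwards [hev, hNT, hD a, hD b] with p hp hp' ha hb
    have hmem := lieBracket_sum_smul_mem (fun i ↦ (hp.1 i).differentiableAt)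
      (fun i ↦ (hp.2.1 i).differentiableAt) (fun i ↦ (hp.2.2.1 i).differentiableAt) hp.2.2.2
    change VectorField.lieBracket ℝ (X a) (X b) p ∈ _ at hmem
    obtain ⟨y, hy⟩ := (Submodule.mem_span_range_iff_exists_fun ℝ).1 hmem
    rw [← hL] at hy
    have h0 : Ξ (VectorField.lieBracket ℝ (X a) (X b) p) = 0 := by
      simp only [VectorField.lieBracket, map_sub, ha, hb, sub_self]
    rw [← hy, ← hT] at h0
    rw [← hy, ← hp' y, h0]
    simp

end Frame

/-! ### Analytic solutions with prescribed second-order jet -/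

section Solution

variable {W : Type*} [NormedAddCommGroup W] [NormedSpace ℝ W] [FiniteDimensional ℝ W]
  {ι : Type*} [Fintype ι] [DecidableEq ι] {v : W}

lemma along_comm_of_lieBracket_eq_zero {X Y : W → W} (hX : AnalyticAt ℝ X v)
    (hY : AnalyticAt ℝ Y v) (h : VectorField.lieBracket ℝ X Y =ᶠ[𝓝 v] 0) {g : W → ℝ}
    (hg : AnalyticAt ℝ g v) : along X (along Y g) =ᶠ[𝓝 v] along Y (along X g) := by
  filter_upwards [hX.eventually_analyticAt, hY.eventually_analyticAt, hg.eventually_analyticAt, h]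
    with p h1 h2 h3 h4
  have h5 := along_lieBracket h1.differentiableAt h2.differentiableAt h3.contDiffAt
  have h6 : along (VectorField.lieBracket ℝ X Y) g p = 0 := by
    simp [along, h4]
  linarith

/-- First integrals of a commuting frame: applying the Lie series of the `X a` one after the other
modifies `φ` into a function killed by all of them. -/
lemma exists_first_integral {X : ι → W → W} {ξ : ι → W →L[ℝ] ℝ}
    (hX : ∀ a, AnalyticAt ℝ (X a) v)
    (hξ : ∀ a b, ∀ᶠ p in 𝓝 v, ξ b (X a p) = if a = b then 1 else 0)
    (hcomm : ∀ a b, VectorField.lieBracket ℝ (X a) (X b) =ᶠ[𝓝 v] 0)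
    {φ : W → ℝ} (hφ : AnalyticAt ℝ φ v) (h0 : ∀ a, along (X a) φ v = 0) :
    ∃ G : W → ℝ, AnalyticAt ℝ G v ∧ (∀ a, along (X a) G =ᶠ[𝓝 v] 0) ∧ OneJetEq G φ v ∧
      ((∀ a, OneJetEq (along (X a) φ) 0 v) → TwoJetEq G φ v) := by
  suffices H : ∀ s : Finset ι, ∃ G : W → ℝ, AnalyticAt ℝ G v ∧
      (∀ a ∈ s, along (X a) G =ᶠ[𝓝 v] 0) ∧ OneJetEq G φ v ∧
      ((∀ a, OneJetEq (along (X a) φ) 0 v) → TwoJetEq G φ v) by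
    obtain ⟨G, h1, h2, h3, h4⟩ := H Finset.univ
    exact ⟨G, h1, fun a ↦ h2 a (Finset.mem_univ a), h3, h4⟩
  intro s
  induction s using Finset.induction_on with
  | empty => exact ⟨φ, hφ, by simp, ⟨rfl, rfl⟩, fun _ ↦ ⟨⟨rfl, rfl⟩, rfl⟩⟩
  | insert a s has ih =>
    obtain ⟨G, hG, hGs, hG1, hG2⟩ := ih
    have hop (g : W → ℝ) : firstOrderOp (X a) 0 g = along (X a) g := by
      funext p; simp [firstOrderOp, along]
    let x : W → ℝ := fun p ↦ ξ a p - ξ a v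
    have hx : AnalyticAt ℝ x v := ((ξ a).analyticAt v).fun_sub analyticAt_const
    have hDx (b : ι) (p : W) : along (X b) x p = ξ a (X b p) := by
      simp [along, x, fderiv_sub_const]
    obtain ⟨G', hG', h1, h2, h3, h4⟩ := exists_lieSeries (hX a) (m := 0) analyticAt_const hx hG
      (by simp [x]) (by
        filter_upwards [hξ a a] with p hp
        rw [hDx, hp]; simp)
    rw [hop] at h1
    simp only [hop] at h2 h3 h4
    have hj : along (X a) G v = 0 := by
      rw [← h0 a]; simp [along, hG1.one]
    have hG'1 := (h3 hj).trans hG1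
    refine ⟨G', hG', fun b hb ↦ ?_, hG'1, fun hall ↦ ?_⟩
    · rcases Finset.mem_insert.1 hb with rfl | hb
      · exact h1
      · have hab : b ≠ a := fun h ↦ has (h ▸ hb)
        refine h2 (X b) (hX b) ?_ (hGs b hb) fun g hg hg0 ↦ ?_
        · filter_upwards [hξ b a] with p hp
          rw [hDx, hp]; simp [hab]
        · exact (along_comm_of_lieBracket_eq_zero (hX b) (hX a) (hcomm b a) hg).trans
            (along_eventuallyEq_zero hg0)
    · have hG2' := hG2 hall
      refine (h4 ?_).trans hG2'
      exact (hG2'.along (hX a).differentiableAt hG.contDiffAt hφ.contDiffAt).trans (hall a)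

/-- **Analytic Frobenius theorem with a homogeneity condition, in jet form.** Let the `Z i` be
independent, involutive and analytic near `v`, and let `C` commute with them and be transversal to
their span. Then every second-order jet satisfying the equations `Z i E = 0`, `C E = 2 E` to first
order at `v` is the jet of an analytic solution. -/
theorem exists_analytic_solution {Z : ι → W → W} {C : W → W} (hZ : ∀ i, AnalyticAt ℝ (Z i) v)
    (hlin : LinearIndependent ℝ fun i ↦ Z i v)
    (hbr : ∀ i j, ∀ᶠ p in 𝓝 v, VectorField.lieBracket ℝ (Z i) (Z j) p ∈
      Submodule.span ℝ (Set.range fun k ↦ Z k p))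
    (hC : AnalyticAt ℝ C v) (hCZ : ∀ i, VectorField.lieBracket ℝ C (Z i) =ᶠ[𝓝 v] 0)
    (hCv : C v ∉ Submodule.span ℝ (Set.range fun k ↦ Z k v))
    {E : W → ℝ} (hE : ContDiffAt ℝ ∞ E v) (hZE : ∀ i, OneJetEq (along (Z i) E) 0 v)
    (hCE : OneJetEq (fun p ↦ along C E p - 2 * E p) 0 v) :
    ∃ G : W → ℝ, AnalyticAt ℝ G v ∧ (∀ i, along (Z i) G =ᶠ[𝓝 v] 0) ∧
      along C G =ᶠ[𝓝 v] (fun p ↦ 2 * G p) ∧ TwoJetEq G E v := by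
  obtain ⟨X, ξ, c, hX, hc, hXZ, hξ, hZX, hcomm⟩ := exists_commuting_frame hZ hlin hbr
  have hXalong (a : ι) (g : W → ℝ) : along (X a) g = fun p ↦ ∑ i, c a i p * along (Z i) g p := by
    funext p; simp [along, hXZ]
  have hker {g : W → ℝ} (hg : ∀ a, along (X a) g =ᶠ[𝓝 v] 0) (i : ι) :
      along (Z i) g =ᶠ[𝓝 v] 0 := by
    filter_upwards [hZX i, Filter.eventually_all.2 hg] with p h1 h2
    have h2' (a : ι) : fderiv ℝ g p (X a p) = 0 := h2 a
    simp only [along]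
    rw [h1, map_sum]
    simp [h2']
  -- A first integral `x` of the `Z i` with `C x ≠ 0` at `v`.
  obtain ⟨l, hlC, hlZ⟩ := Submodule.exists_le_ker_of_notMem hCv
  let ℓ : W →L[ℝ] ℝ := LinearMap.toContinuousLinearMap l
  have hℓ0 (a : ι) : along (X a) ℓ v = 0 := by
    have : X a v ∈ Submodule.span ℝ (Set.range fun k ↦ Z k v) := by
      rw [hXZ]
      exact Submodule.sum_mem _ fun i _ ↦ Submodule.smul_mem _ _ (Submodule.subset_span ⟨i, rfl⟩)
    have h : l (X a v) = 0 := hlZ this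
    rw [along, ContinuousLinearMap.fderiv]
    exact h
  obtain ⟨x₀, hx₀, hXx₀, hx₀1, -⟩ := exists_first_integral hX hξ hcomm (ℓ.analyticAt v) hℓ0
  let x : W → ℝ := fun p ↦ x₀ p - x₀ v
  have hx : AnalyticAt ℝ x v := hx₀.fun_sub analyticAt_const
  have hxalong (Y : W → W) : along Y x = along Y x₀ := by
    funext p; simp [along, x, fderiv_sub_const]
  have hZx (i : ι) : along (Z i) x =ᶠ[𝓝 v] 0 := by rw [hxalong]; exact hker hXx₀ i
  let u : W → ℝ := along C x
  have hu : AnalyticAt ℝ u v := hC.along hx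
  have huv : u v ≠ 0 := by
    have : u v = l (C v) := by
      simp only [u, hxalong, along, hx₀1.one, ContinuousLinearMap.fderiv]
      rfl
    rw [this]; exact hlC
  have hune : ∀ᶠ p in 𝓝 v, u p ≠ 0 := hu.continuousAt.eventually_ne huv
  have huinv : AnalyticAt ℝ (fun p ↦ (u p)⁻¹) v := hu.fun_inv huv
  -- `C` preserves the functions killed by the `Z i`.
  have hZC (i : ι) {g : W → ℝ} (hg : AnalyticAt ℝ g v) (h : along (Z i) g =ᶠ[𝓝 v] 0) :
      along (Z i) (along C g) =ᶠ[𝓝 v] 0 :=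
    ((along_comm_of_lieBracket_eq_zero hC (hZ i) (hCZ i) hg).symm).trans (along_eventuallyEq_zero h)
  -- First make the jet invariant under the `Z i`.
  obtain ⟨φ, hφ, hφE⟩ := exists_analytic_twoJetEq hE
  have hE2 : ContDiffAt ℝ 2 E v := hE.of_le ENat.LEInfty.out
  have hXφ (a : ι) : OneJetEq (along (X a) φ) 0 v := by
    rw [hXalong]
    have h1 (i : ι) : OneJetEq (fun p ↦ c a i p * along (Z i) φ p) 0 v :=
      OneJetEq.mul_zero (hc a i).differentiableAt ((hZ i).along hφ).differentiableAt
        ((hφE.along (hZ i).differentiableAt hφ.contDiffAt hE2).trans (hZE i))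
    refine ⟨by simpa using Finset.sum_eq_zero fun i _ ↦ (h1 i).zero, ?_⟩
    rw [fderiv_fun_sum fun i _ ↦ ((hc a i).fun_mul ((hZ i).along hφ)).differentiableAt]
    simp [(h1 _).one]
  obtain ⟨G₁, hG₁, hXG₁, -, hG₁2⟩ := exists_first_integral hX hξ hcomm hφ
    (fun a ↦ by simpa using (hXφ a).zero)
  have hG₁E := (hG₁2 hXφ).trans hφE
  have hZG₁ := hker hXG₁
  -- Then make it homogeneous, with the Lie series of `(C - 2) / C x`.
  have hop (g : W → ℝ) : firstOrderOp (fun p ↦ (u p)⁻¹ • C p) (fun p ↦ -2 * (u p)⁻¹) g =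
      fun p ↦ (u p)⁻¹ * (along C g p - 2 * g p) := by
    funext p; simp [firstOrderOp, along]; ring
  obtain ⟨G, hG, h1, h2, -, h4⟩ := exists_lieSeries (X := fun p ↦ (u p)⁻¹ • C p)
    (m := fun p ↦ -2 * (u p)⁻¹) (huinv.fun_smul hC) (analyticAt_const.fun_mul huinv) hx hG₁
    (by simp [x]) (by
      filter_upwards [hune] with p hp
      simp only [along, map_smul, smul_eq_mul]
      exact inv_mul_cancel₀ hp)
  rw [hop] at h1
  simp only [hop] at h2 h4
  refine ⟨G, hG, fun i ↦ h2 (Z i) (hZ i) (hZx i) (hZG₁ i) fun g hg hg0 ↦ ?_, ?_, ?_⟩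
  · filter_upwards [hZC i hg hg0, hZC i hx (hZx i), hg0, hu.eventually_analyticAt,
      huinv.eventually_analyticAt, hg.eventually_analyticAt, (hC.along hg).eventually_analyticAt,
      hune] with p e1 e2 e3 e4 e5 e6 e7 e8
    have d1 := (e7.fun_sub (analyticAt_const (v := (2 : ℝ)).fun_mul e6)).differentiableAt
    rw [along_mul e5.differentiableAt d1]
    have s1 : along (Z i) (fun q ↦ along C g q - 2 * g q) p = 0 := by
      have h7 : fderiv ℝ (along C g) p (Z i p) = 0 := e1
      have h8 : fderiv ℝ g p (Z i p) = 0 := e3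
      simp only [along]
      have h9 : fderiv ℝ (fun q ↦ along C g q - 2 * g q) p =
          fderiv ℝ (along C g) p - (2 : ℝ) • fderiv ℝ g p := by
        rw [fderiv_fun_sub e7.differentiableAt (e6.differentiableAt.const_mul 2),
          fderiv_const_mul e6.differentiableAt]
      change fderiv ℝ (fun q ↦ along C g q - 2 * g q) p (Z i p) = 0
      rw [h9]
      simp [h7, h8]
    have s2 : along (Z i) (fun q ↦ (u q)⁻¹) p = 0 := by
      have h7 : fderiv ℝ u p (Z i p) = 0 := e2
      have h8 := ((hasDerivAt_inv e8).comp_hasFDerivAt p e4.differentiableAt.hasFDerivAt).fderiv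
      change fderiv ℝ (Inv.inv ∘ u) p (Z i p) = 0
      rw [h8]
      simp [h7]
    rw [s1, s2]
    simp
  · filter_upwards [h1, hune] with p hp hp'
    have h5 : (u p)⁻¹ * (along C G p - 2 * G p) = 0 := hp
    have h6 := (mul_eq_zero.1 h5).resolve_left (inv_ne_zero hp')
    linarith
  · refine (h4 ?_).trans hG₁E
    refine OneJetEq.mul_zero huinv.differentiableAt
      ((hC.along hG₁).fun_sub (analyticAt_const.fun_mul hG₁)).differentiableAt (OneJetEq.trans ?_ hCE)
    have h5 := hG₁E.along hC.differentiableAt hG₁.contDiffAt hE2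
    have hE1 : DifferentiableAt ℝ E v := hE2.differentiableAt (by simp)
    have hCE1 : DifferentiableAt ℝ (along C E) v :=
      ((hE2.fderiv_right (m := 1) (by norm_num)).differentiableAt (by simp)).clm_apply
        hC.differentiableAt
    refine ⟨by simp only [h5.zero, hG₁E.zero], ?_⟩
    rw [fderiv_fun_sub (hC.along hG₁).differentiableAt (hG₁.differentiableAt.const_mul 2),
      fderiv_fun_sub hCE1 (hE1.const_mul 2), fderiv_const_mul hG₁.differentiableAt,
      fderiv_const_mul hE1, h5.one, hG₁E.one]

end Solution

/-! ### Vector fields and functions in an induced chart -/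

section Chart

/-- The model space `ℝⁿ × ℝⁿ` of the induced charts of the tangent bundle. -/
abbrev Coord (n : ℕ) : Type := EuclideanSpace ℝ (Fin n) × EuclideanSpace ℝ (Fin n)

variable {n : ℕ} {M : Type*} [TopologicalSpace M] [ChartedSpace (EuclideanSpace ℝ (Fin n)) M]
  [IsManifold (𝓡 n) ω M] {v p : TangentBundle (𝓡 n) M} {z : Coord n}

/-- The chart of `TM` at `v`, i.e. the induced coordinates `(xⁱ, yⁱ)` of the chart of `M` at the
base point of `v`. -/
abbrev chart (v : TangentBundle (𝓡 n) M) : PartialEquiv (TangentBundle (𝓡 n) M) (Coord n) :=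
  extChartAt (𝓡 n).tangent v

/-- The coordinate expression of a vector field in the chart at `v`. -/
def toChart (v : TangentBundle (𝓡 n) M) (X : Field n M) : Coord n → Coord n :=
  VectorField.mpullback 𝓘(ℝ, Coord n) (𝓡 n).tangent (chart v).symm X

/-- The vector field with a given coordinate expression in the chart at `v`. -/
def ofChart (v : TangentBundle (𝓡 n) M) (Y : Coord n → Coord n) : Field n M :=
  VectorField.mpullback (𝓡 n).tangent 𝓘(ℝ, Coord n) (chart v) Y

lemma isOpen_chart_target (v : TangentBundle (𝓡 n) M) : IsOpen (chart v).target :=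
  isOpen_extChartAt_target v

lemma isOpen_chart_source (v : TangentBundle (𝓡 n) M) : IsOpen (chart v).source :=
  isOpen_extChartAt_source v

lemma contMDiffAt_chart (hp : p ∈ (chart v).source) :
    ContMDiffAt (𝓡 n).tangent 𝓘(ℝ, Coord n) ω (chart v) p :=
  contMDiffAt_extChartAt' (by rwa [extChartAt_source] at hp)

lemma contMDiffAt_chart_symm (hz : z ∈ (chart v).target) :
    ContMDiffAt 𝓘(ℝ, Coord n) (𝓡 n).tangent ω (chart v).symm z :=
  (contMDiffOn_extChartAt_symm v).contMDiffAt ((isOpen_chart_target v).mem_nhds hz)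

lemma isInvertible_mfderiv_chart (hp : p ∈ (chart v).source) :
    (mfderiv (𝓡 n).tangent 𝓘(ℝ, Coord n) (chart v) p).IsInvertible :=
  isInvertible_mfderiv_extChartAt hp

lemma isInvertible_mfderiv_chart_symm (hz : z ∈ (chart v).target) :
    (mfderiv 𝓘(ℝ, Coord n) (𝓡 n).tangent (chart v).symm z).IsInvertible := by
  have := isInvertible_mfderivWithin_extChartAt_symm hz
  rwa [ModelWithCorners.range_eq_univ, mfderivWithin_univ] at this

lemma mfderiv_chart_symm_apply_mfderiv_chart (hp : p ∈ (chart v).source)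
    (w : TangentSpace (𝓡 n).tangent p) :
    mfderiv 𝓘(ℝ, Coord n) (𝓡 n).tangent (chart v).symm (chart v p)
      (mfderiv (𝓡 n).tangent 𝓘(ℝ, Coord n) (chart v) p w) = w := by
  have := mfderivWithin_extChartAt_symm_comp_mfderiv_extChartAt' hp
  rw [ModelWithCorners.range_eq_univ, mfderivWithin_univ] at this
  exact congrArg (fun f : TangentSpace (𝓡 n).tangent p →L[ℝ] TangentSpace (𝓡 n).tangent p ↦ f w) this

lemma toChart_chart (hp : p ∈ (chart v).source) (X : Field n M) :
    toChart v X (chart v p) = mfderiv (𝓡 n).tangent 𝓘(ℝ, Coord n) (chart v) p (X p) := by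
  have hz := (chart v).map_source hp
  rw [toChart, VectorField.mpullback_apply, (chart v).left_inv hp]
  conv_lhs => rw [← mfderiv_chart_symm_apply_mfderiv_chart hp (X p)]
  exact (isInvertible_mfderiv_chart_symm hz).inverse_apply_eq.2 rfl

lemma toChart_ofChart (hz : z ∈ (chart v).target) (Y : Coord n → Coord n) :
    toChart v (ofChart v Y) z = Y z := by
  have key {p : TangentBundle (𝓡 n) M} (hp : p ∈ (chart v).source) :
      toChart v (ofChart v Y) (chart v p) = Y (chart v p) := by
    rw [toChart_chart hp]
    exact ((isInvertible_mfderiv_chart hp).inverse_apply_eq.1 rfl).symm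
  rw [← (chart v).right_inv hz]
  exact key ((chart v).map_target hz)

lemma contDiffAt_toChart {k : WithTop ℕ∞} {X : Field n M} (hp : p ∈ (chart v).source)
    (hX : ContMDiffAt (𝓡 n).tangent (𝓡 n).tangent.tangent k
      (fun q ↦ (⟨q, X q⟩ : TangentBundle (𝓡 n).tangent (TangentBundle (𝓡 n) M))) p) :
    ContDiffAt ℝ k (toChart v X) (chart v p) := by
  have hz := (chart v).map_source hp
  refine contMDiffAt_vectorSpace_iff_contDiffAt.1 ?_
  refine ContMDiffAt.mpullback_vectorField_preimage (n := ω) ?_ (contMDiffAt_chart_symm hz)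
    (isInvertible_mfderiv_chart_symm hz) le_top
  rwa [(chart v).left_inv hp]

lemma contMDiffAt_ofChart {k : WithTop ℕ∞} {Y : Coord n → Coord n} (hp : p ∈ (chart v).source)
    (hY : ContDiffAt ℝ k Y (chart v p)) :
    ContMDiffAt (𝓡 n).tangent (𝓡 n).tangent.tangent k
      (fun q ↦ (⟨q, ofChart v Y q⟩ : TangentBundle (𝓡 n).tangent (TangentBundle (𝓡 n) M))) p :=
  ContMDiffAt.mpullback_vectorField_preimage (n := ω)
    (contMDiffAt_vectorSpace_iff_contDiffAt.2 hY) (contMDiffAt_chart hp)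
    (isInvertible_mfderiv_chart hp) le_top

lemma contDiffAt_comp_chart_symm {k : WithTop ℕ∞} {g : TangentBundle (𝓡 n) M → ℝ}
    (hp : p ∈ (chart v).source) (hg : ContMDiffAt (𝓡 n).tangent 𝓘(ℝ, ℝ) k g p) :
    ContDiffAt ℝ k (g ∘ (chart v).symm) (chart v p) := by
  rw [← contMDiffAt_iff_contDiffAt]
  refine ContMDiffAt.comp (I' := (𝓡 n).tangent) _ ?_
    ((contMDiffAt_chart_symm ((chart v).map_source hp)).of_le le_top)
  rwa [(chart v).left_inv hp]

lemma toChart_bracket {X Y : Field n M} (hp : p ∈ (chart v).source)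
    (hX : ContMDiffAt (𝓡 n).tangent (𝓡 n).tangent.tangent 1
      (fun q ↦ (⟨q, X q⟩ : TangentBundle (𝓡 n).tangent (TangentBundle (𝓡 n) M))) p)
    (hY : ContMDiffAt (𝓡 n).tangent (𝓡 n).tangent.tangent 1
      (fun q ↦ (⟨q, Y q⟩ : TangentBundle (𝓡 n).tangent (TangentBundle (𝓡 n) M))) p) :
    toChart v (bracket X Y) (chart v p) =
      VectorField.lieBracket ℝ (toChart v X) (toChart v Y) (chart v p) := by
  have h := VectorField.mpullback_mlieBracket (n := ω) (I := 𝓘(ℝ, Coord n)) (I' := (𝓡 n).tangent)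
    (f := (chart v).symm) (V := X) (W := Y) (x₀ := chart v p)
    (by rw [(chart v).left_inv hp]; exact hX.mdifferentiableAt (by simp))
    (by rw [(chart v).left_inv hp]; exact hY.mdifferentiableAt (by simp))
    (contMDiffAt_chart_symm ((chart v).map_source hp)) le_top
  have key (A B : (x : Coord n) → TangentSpace 𝓘(ℝ, Coord n) x) :
      VectorField.mlieBracket 𝓘(ℝ, Coord n) A B = VectorField.lieBracket ℝ A B := by
    rw [← VectorField.mlieBracketWithin_univ, VectorField.mlieBracketWithin_eq_lieBracketWithin]
    exact VectorField.lieBracketWithin_univ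
  exact h.trans (congrFun (key _ _) _)

lemma derive_eq_along {g : TangentBundle (𝓡 n) M → ℝ} (X : Field n M) (hp : p ∈ (chart v).source)
    (hg : MDifferentiableAt (𝓡 n).tangent 𝓘(ℝ, ℝ) g p) :
    derive X g p = along (toChart v X) (g ∘ (chart v).symm) (chart v p) := by
  have hz := (chart v).map_source hp
  have h1 : MDifferentiableAt 𝓘(ℝ, Coord n) 𝓘(ℝ, ℝ) (g ∘ (chart v).symm) (chart v p) :=
    MDifferentiableAt.comp (I' := (𝓡 n).tangent) _ (by rwa [(chart v).left_inv hp])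
      ((contMDiffAt_chart_symm hz).mdifferentiableAt (by simp))
  have h2 := h1.differentiableAt.hasFDerivAt.hasMFDerivAt.comp p
    ((contMDiffAt_chart hp).mdifferentiableAt (by simp)).hasMFDerivAt
  have h3 : g =ᶠ[𝓝 p] (g ∘ (chart v).symm) ∘ chart v := by
    filter_upwards [(isOpen_chart_source v).mem_nhds hp] with q hq
    exact congrArg g ((chart v).left_inv hq).symm
  have h4 := (h2.congr_of_eventuallyEq h3).mfderiv
  unfold along
  rw [toChart_chart hp]
  exact congrArg (fun f : TangentSpace (𝓡 n).tangent p →L[ℝ] ℝ ↦ f (X p)) h4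

lemma ofChart_toChart (hp : p ∈ (chart v).source) (X : Field n M) :
    ofChart v (toChart v X) p = X p := by
  have h1 : ofChart v (toChart v X) p =
      (mfderiv (𝓡 n).tangent 𝓘(ℝ, Coord n) (chart v) p).inverse (toChart v X (chart v p)) := rfl
  rw [h1]
  exact (isInvertible_mfderiv_chart hp).inverse_apply_eq.2 (toChart_chart hp X)

lemma contMDiffAt_of_toChart {k : WithTop ℕ∞} {X : Field n M} (hp : p ∈ (chart v).source)
    (hX : ContDiffAt ℝ k (toChart v X) (chart v p)) :
    ContMDiffAt (𝓡 n).tangent (𝓡 n).tangent.tangent k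
      (fun q ↦ (⟨q, X q⟩ : TangentBundle (𝓡 n).tangent (TangentBundle (𝓡 n) M))) p := by
  refine (contMDiffAt_ofChart hp hX).congr_of_eventuallyEq ?_
  filter_upwards [(isOpen_chart_source v).mem_nhds hp] with q hq
  rw [ofChart_toChart hq]

/-- The derivative at `x` of the chart of `M` at the base point of `v`: the linear part of the
chart of `TM` at `v`, restricted to the fibre over `x`. -/
def fibreChart (v : TangentBundle (𝓡 n) M) (x : M) :
    EuclideanSpace ℝ (Fin n) →L[ℝ] EuclideanSpace ℝ (Fin n) :=
  mfderiv (𝓡 n) 𝓘(ℝ, EuclideanSpace ℝ (Fin n)) (extChartAt (𝓡 n) v.1) x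

lemma mem_chart_source_iff :
    p ∈ (chart v).source ↔ p.1 ∈ (chartAt (EuclideanSpace ℝ (Fin n)) v.1).source := by
  rw [extChartAt_source, TangentBundle.mem_chart_source_iff]

lemma fibreChart_injective {x : M} (hx : x ∈ (chartAt (EuclideanSpace ℝ (Fin n)) v.1).source) :
    Function.Injective (fibreChart v x) :=
  (isInvertible_mfderiv_extChartAt (by rwa [extChartAt_source])).injective

lemma fibreChart_surjective {x : M}
    (hx : x ∈ (chartAt (EuclideanSpace ℝ (Fin n)) v.1).source) :
    Function.Surjective (fibreChart v x) :=
  (isInvertible_mfderiv_extChartAt (by rwa [extChartAt_source])).surjective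

lemma chart_mk {x : M} (hx : x ∈ (chartAt (EuclideanSpace ℝ (Fin n)) v.1).source)
    (y : EuclideanSpace ℝ (Fin n)) :
    chart v (⟨x, y⟩ : TangentBundle (𝓡 n) M) = (extChartAt (𝓡 n) v.1 x, fibreChart v x y) := by
  have h1 : (chart v (⟨x, y⟩ : TangentBundle (𝓡 n) M)).2 =
      (trivializationAt (EuclideanSpace ℝ (Fin n)) (TangentSpace (𝓡 n)) v.1
        (⟨x, y⟩ : TangentBundle (𝓡 n) M)).2 := rfl
  refine Prod.ext rfl ?_
  rw [h1]
  have h2 := TangentBundle.continuousLinearMapAt_trivializationAt (I := 𝓡 n) (x₀ := v.1) hx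
  have h3 := congrArg (fun f : EuclideanSpace ℝ (Fin n) →L[ℝ] EuclideanSpace ℝ (Fin n) ↦ f y) h2
  refine Eq.trans ?_ h3
  have h4 := (trivializationAt (EuclideanSpace ℝ (Fin n)) (TangentSpace (𝓡 n) (M := M))
    v.1).coe_linearMapAt_of_mem (R := ℝ) (b := x) hx
  exact (congrFun h4 y).symm

lemma chart_snd (hp : p ∈ (chart v).source) : (chart v p).2 = fibreChart v p.1 p.2 := by
  have := chart_mk (v := v) (mem_chart_source_iff.1 hp) p.2
  exact congrArg Prod.snd this

lemma chart_smul (hp : p ∈ (chart v).source) (c : ℝ) :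
    chart v (⟨p.1, c • p.2⟩ : TangentBundle (𝓡 n) M) = ((chart v p).1, c • (chart v p).2) := by
  rw [chart_snd hp]
  exact (chart_mk (v := v) (mem_chart_source_iff.1 hp) (c • p.2)).trans
    (Prod.ext rfl ((fibreChart v p.1).map_smul c p.2))

lemma mem_slit_iff (hp : p ∈ (chart v).source) : p ∈ slit n M ↔ (chart v p).2 ≠ 0 := by
  rw [chart_snd hp]
  have := map_eq_zero_iff (fibreChart v p.1) (fibreChart_injective (mem_chart_source_iff.1 hp))
    (x := p.2)
  exact (not_congr this).symm

lemma mfderiv_chart_verticalLift (hp : p ∈ (chart v).source) (w : TangentSpace (𝓡 n) p.1) :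
    mfderiv (𝓡 n).tangent 𝓘(ℝ, Coord n) (chart v) p (verticalLift p w) =
      ((0, fibreChart v p.1 w) : Coord n) := by
  have hx := mem_chart_source_iff.1 hp
  let y₀ : EuclideanSpace ℝ (Fin n) := p.2
  set j : EuclideanSpace ℝ (Fin n) → TangentBundle (𝓡 n) M := fun y ↦ ⟨p.1, y⟩ with hj
  set a : EuclideanSpace ℝ (Fin n) → Coord n :=
    fun y ↦ (extChartAt (𝓡 n) v.1 p.1, fibreChart v p.1 y) with ha
  have hja : j = (chart v).symm ∘ a := by
    funext y
    have h1 : j y ∈ (chart v).source := mem_chart_source_iff.2 hx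
    have h2 : chart v (j y) = a y := chart_mk hx y
    rw [Function.comp_apply, ← h2, (chart v).left_inv h1]
  have haj : chart v ∘ j = a := funext fun y ↦ chart_mk hx y
  have hap : a y₀ = chart v p := (chart_mk hx y₀).symm
  have hda : HasFDerivAt a ((0 : EuclideanSpace ℝ (Fin n) →L[ℝ] EuclideanSpace ℝ (Fin n)).prod
      (fibreChart v p.1)) y₀ :=
    (hasFDerivAt_const _ _).prodMk (fibreChart v p.1).hasFDerivAt
  have hdj : MDifferentiableAt 𝓘(ℝ, EuclideanSpace ℝ (Fin n)) (𝓡 n).tangent j y₀ := by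
    rw [hja]
    refine MDifferentiableAt.comp (I' := 𝓘(ℝ, Coord n)) _ ?_ hda.differentiableAt.mdifferentiableAt
    rw [hap]
    exact (contMDiffAt_chart_symm ((chart v).map_source hp)).mdifferentiableAt (by simp)
  have h1 := mfderiv_comp (I' := (𝓡 n).tangent) (I'' := 𝓘(ℝ, Coord n)) y₀ (g := chart v) (f := j)
    ((contMDiffAt_chart hp).mdifferentiableAt (by simp)) hdj
  rw [haj, hda.hasMFDerivAt.mfderiv] at h1
  exact (congrArg (fun f : EuclideanSpace ℝ (Fin n) →L[ℝ] Coord n ↦ f w) h1).symm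

lemma mfderiv_chart_fst (hp : p ∈ (chart v).source) (w : TangentSpace (𝓡 n).tangent p) :
    (mfderiv (𝓡 n).tangent 𝓘(ℝ, Coord n) (chart v) p w : Coord n).1 =
      fibreChart v p.1 (mfderiv (𝓡 n).tangent (𝓡 n)
        (fun q : TangentBundle (𝓡 n) M ↦ q.1) p w) := by
  have hx := mem_chart_source_iff.1 hp
  have hπ : MDifferentiableAt (𝓡 n).tangent (𝓡 n) (fun q : TangentBundle (𝓡 n) M ↦ q.1) p :=
    (Bundle.contMDiffAt_proj (n := ω) (TangentSpace (𝓡 n) (M := M))).mdifferentiableAt (by simp)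
  have h1 := (mdifferentiableAt_extChartAt (I := 𝓡 n) hx).hasMFDerivAt.comp p hπ.hasMFDerivAt
  have h2 := (hasFDerivAt_fst (𝕜 := ℝ) (p := chart v p)).hasMFDerivAt.comp p
    ((contMDiffAt_chart hp).mdifferentiableAt (by simp)).hasMFDerivAt
  have h3 := hasMFDerivAt_unique h2 h1
  exact congrArg (fun f : TangentSpace (𝓡 n).tangent p →L[ℝ] EuclideanSpace ℝ (Fin n) ↦ f w) h3

lemma toChart_vertEndo (hp : p ∈ (chart v).source) (X : Field n M) :
    toChart v (vertEndo X) (chart v p) = (0, (toChart v X (chart v p)).1) := by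
  rw [toChart_chart hp, toChart_chart hp]
  exact (mfderiv_chart_verticalLift hp _).trans
    (congrArg (Prod.mk 0) (mfderiv_chart_fst hp (X p)).symm)

lemma toChart_liouville (hp : p ∈ (chart v).source) :
    toChart v (liouville n M) (chart v p) = (0, (chart v p).2) := by
  rw [toChart_chart hp, chart_snd hp]
  exact mfderiv_chart_verticalLift hp p.2

/-- The fundamental tensor in coordinates. -/
lemma fundamentalTensor_eq {E : TangentBundle (𝓡 n) M → ℝ} (hp : p ∈ (chart v).source)
    (hE : ContDiffAt ℝ 2 (E ∘ (chart v).symm) (chart v p)) (u w : TangentSpace (𝓡 n) p.1) :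
    fundamentalTensor E p u w = fderiv ℝ (fderiv ℝ (E ∘ (chart v).symm)) (chart v p)
      (0, fibreChart v p.1 u) (0, fibreChart v p.1 w) := by
  have hx := mem_chart_source_iff.1 hp
  let y₀ : EuclideanSpace ℝ (Fin n) := p.2
  set g := E ∘ (chart v).symm
  set a : EuclideanSpace ℝ (Fin n) → Coord n :=
    fun y ↦ (extChartAt (𝓡 n) v.1 p.1, fibreChart v p.1 y) with ha
  set A : EuclideanSpace ℝ (Fin n) →L[ℝ] Coord n :=
    (0 : EuclideanSpace ℝ (Fin n) →L[ℝ] EuclideanSpace ℝ (Fin n)).prod (fibreChart v p.1)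
  have hap : a y₀ = chart v p := (chart_mk hx y₀).symm
  have hda (y : EuclideanSpace ℝ (Fin n)) : HasFDerivAt a A y :=
    (hasFDerivAt_const _ _).prodMk (fibreChart v p.1).hasFDerivAt
  have hEg : (fun y : EuclideanSpace ℝ (Fin n) ↦ E (⟨p.1, y⟩ : TangentBundle (𝓡 n) M)) = g ∘ a := by
    funext y
    have h1 : (⟨p.1, y⟩ : TangentBundle (𝓡 n) M) ∈ (chart v).source := mem_chart_source_iff.2 hx
    have h2 : chart v (⟨p.1, y⟩ : TangentBundle (𝓡 n) M) = a y := chart_mk hx y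
    simp only [g, Function.comp_apply]
    rw [← h2, (chart v).left_inv h1]
  have hE' : ContDiffAt ℝ 2 g (a y₀) := by rw [hap]; exact hE
  have h1 : fderiv ℝ (g ∘ a) =ᶠ[𝓝 y₀] fun y ↦ (fderiv ℝ g (a y)).comp A := by
    have h2 : ∀ᶠ q in 𝓝 (a y₀), DifferentiableAt ℝ g q :=
      (hE'.eventually (by simp)).mono fun q hq ↦ hq.differentiableAt (by simp)
    filter_upwards [(hda y₀).continuousAt.eventually h2] with y hy
    exact (hy.hasFDerivAt.comp y (hda y)).fderiv
  have h2 : HasFDerivAt (fun y ↦ fderiv ℝ g (a y)) ((fderiv ℝ (fderiv ℝ g) (a y₀)).comp A) y₀ :=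
    ((hE'.fderiv_right (m := 1) (by norm_num)).differentiableAt (by simp)).hasFDerivAt.comp y₀
      (hda y₀)
  have h3 := h2.clm_comp (hasFDerivAt_const A y₀)
  have h4 (u' w' : EuclideanSpace ℝ (Fin n)) :
      iteratedFDeriv ℝ 2 (g ∘ a) y₀ ![u', w'] =
        fderiv ℝ (fderiv ℝ g) (a y₀) (A u') (A w') := by
    rw [iteratedFDeriv_two_apply, h1.fderiv_eq, h3.fderiv]
    simp
  rw [hap] at h4
  exact (congrArg (fun f : EuclideanSpace ℝ (Fin n) → ℝ ↦ iteratedFDeriv ℝ 2 f y₀ ![u, w]) hEg).trans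
    (h4 u w)

end Chart

/-! ### Derivatives and brackets on the tangent bundle, and the Euler–Lagrange operator -/

section Calculus

variable {n : ℕ} {M : Type*} [TopologicalSpace M] [ChartedSpace (EuclideanSpace ℝ (Fin n)) M]
  [IsManifold (𝓡 n) ω M] {v p : TangentBundle (𝓡 n) M} {z : Coord n} {X Y S : Field n M}
  {E : TangentBundle (𝓡 n) M → ℝ}

/-- The vector field `X` is of class `C^k` near `p`. -/
abbrev SmoothAt (k : WithTop ℕ∞) (X : Field n M) (p : TangentBundle (𝓡 n) M) : Prop :=
  ContMDiffAt (𝓡 n).tangent (𝓡 n).tangent.tangent k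
    (fun q ↦ (⟨q, X q⟩ : TangentBundle (𝓡 n).tangent (TangentBundle (𝓡 n) M))) p

lemma SmoothOn.smoothAt {k : WithTop ℕ∞} {U : Set (TangentBundle (𝓡 n) M)} (h : SmoothOn k X U)
    (hU : IsOpen U) (hp : p ∈ U) : SmoothAt k X p :=
  h.contMDiffAt (hU.mem_nhds hp)

lemma tendsto_chart_symm (hp : p ∈ (chart v).source) :
    Filter.Tendsto (chart v).symm (𝓝 (chart v p)) (𝓝 p) := by
  have := (contMDiffAt_chart_symm ((chart v).map_source hp)).continuousAt.tendsto
  rwa [(chart v).left_inv hp] at this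

lemma contMDiffAt_comp_chart {k : WithTop ℕ∞} {G : Coord n → ℝ} (hp : p ∈ (chart v).source)
    (hG : ContDiffAt ℝ k G (chart v p)) :
    ContMDiffAt (𝓡 n).tangent 𝓘(ℝ, ℝ) k (G ∘ chart v) p :=
  ContMDiffAt.comp (I' := 𝓘(ℝ, Coord n)) p (contMDiffAt_iff_contDiffAt.2 hG)
    ((contMDiffAt_chart hp).of_le le_top)

lemma contMDiffAt_of_comp_chart_symm {k : WithTop ℕ∞} (hp : p ∈ (chart v).source)
    (hE : ContDiffAt ℝ k (E ∘ (chart v).symm) (chart v p)) :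
    ContMDiffAt (𝓡 n).tangent 𝓘(ℝ, ℝ) k E p := by
  refine (contMDiffAt_comp_chart hp hE).congr_of_eventuallyEq ?_
  filter_upwards [(isOpen_chart_source v).mem_nhds hp] with q hq
  exact congrArg E ((chart v).left_inv hq).symm

lemma derive_comp_chart_symm (hp : p ∈ (chart v).source) (X : Field n M)
    (hE : ContMDiffAt (𝓡 n).tangent 𝓘(ℝ, ℝ) 1 E p) :
    derive X E ∘ (chart v).symm =ᶠ[𝓝 (chart v p)]
      along (toChart v X) (E ∘ (chart v).symm) := by
  have h1 : ∀ᶠ q in 𝓝 p, ContMDiffAt (𝓡 n).tangent 𝓘(ℝ, ℝ) 1 E q := (contMDiffAt_iff_contMDiffAt_nhds (by simp)).1 hE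
  filter_upwards [(tendsto_chart_symm hp).eventually h1,
    (isOpen_chart_target v).mem_nhds ((chart v).map_source hp)] with z hz hz'
  have h2 := derive_eq_along X ((chart v).map_target hz') (hz.mdifferentiableAt (by simp))
  rwa [(chart v).right_inv hz'] at h2

lemma toChart_bracket_eventuallyEq (hp : p ∈ (chart v).source) (hX : SmoothAt 1 X p)
    (hY : SmoothAt 1 Y p) : toChart v (bracket X Y) =ᶠ[𝓝 (chart v p)]
      VectorField.lieBracket ℝ (toChart v X) (toChart v Y) := by
  have h1 : ∀ᶠ q in 𝓝 p, SmoothAt 1 X q := (contMDiffAt_iff_contMDiffAt_nhds (by simp)).1 hX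
  have h2 : ∀ᶠ q in 𝓝 p, SmoothAt 1 Y q := (contMDiffAt_iff_contMDiffAt_nhds (by simp)).1 hY
  filter_upwards [(tendsto_chart_symm hp).eventually h1, (tendsto_chart_symm hp).eventually h2,
    (isOpen_chart_target v).mem_nhds ((chart v).map_source hp)] with z h1 h2 hz'
  have h3 := toChart_bracket ((chart v).map_target hz') h1 h2
  rwa [(chart v).right_inv hz'] at h3

lemma toChart_vertEndo_eventuallyEq (hp : p ∈ (chart v).source) (X : Field n M) :
    toChart v (vertEndo X) =ᶠ[𝓝 (chart v p)] fun z ↦ (0, (toChart v X z).1) := by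
  filter_upwards [(isOpen_chart_target v).mem_nhds ((chart v).map_source hp)] with z hz
  have h := toChart_vertEndo ((chart v).map_target hz) X
  rwa [(chart v).right_inv hz] at h

lemma toChart_liouville_eventuallyEq (hp : p ∈ (chart v).source) :
    toChart v (liouville n M) =ᶠ[𝓝 (chart v p)] fun z ↦ (0, z.2) := by
  filter_upwards [(isOpen_chart_target v).mem_nhds ((chart v).map_source hp)] with z hz
  have h := toChart_liouville (M := M) ((chart v).map_target hz)
  rwa [(chart v).right_inv hz] at h

lemma contDiffAt_along {W : Type*} [NormedAddCommGroup W] [NormedSpace ℝ W] {k : WithTop ℕ∞}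
    {X : W → W} {g : W → ℝ} {x : W} (hX : ContDiffAt ℝ k X x) (hg : ContDiffAt ℝ (k + 1) g x) :
    ContDiffAt ℝ k (along X g) x :=
  (hg.fderiv_right le_rfl).clm_apply hX

lemma contMDiffAt_derive {k : WithTop ℕ∞} (hX : SmoothAt k X p)
    (hE : ContMDiffAt (𝓡 n).tangent 𝓘(ℝ, ℝ) (k + 1) E p) :
    ContMDiffAt (𝓡 n).tangent 𝓘(ℝ, ℝ) k (derive X E) p := by
  have hp : p ∈ (chart p).source := mem_extChartAt_source p
  refine contMDiffAt_of_comp_chart_symm hp ?_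
  exact (contDiffAt_along (contDiffAt_toChart hp hX)
    (contDiffAt_comp_chart_symm hp hE)).congr_of_eventuallyEq
      (derive_comp_chart_symm hp X (hE.of_le le_add_self))

lemma SmoothAt.vertEndo {k : WithTop ℕ∞} (hX : SmoothAt k X p) : SmoothAt k (vertEndo X) p := by
  have hp : p ∈ (chart p).source := mem_extChartAt_source p
  refine contMDiffAt_of_toChart hp ?_
  exact (contDiffAt_const.prodMk (contDiffAt_toChart hp hX).fst).congr_of_eventuallyEq
    (toChart_vertEndo_eventuallyEq hp X)

lemma smoothAt_liouville (p : TangentBundle (𝓡 n) M) : SmoothAt ω (liouville n M) p := by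
  have hp : p ∈ (chart p).source := mem_extChartAt_source p
  refine contMDiffAt_of_toChart hp ?_
  exact (contDiffAt_const.prodMk contDiffAt_snd).congr_of_eventuallyEq
    (toChart_liouville_eventuallyEq hp)

lemma SmoothAt.bracket {k m : WithTop ℕ∞} (hX : SmoothAt k X p) (hY : SmoothAt k Y p)
    (hm : m + 1 ≤ k) : SmoothAt m (bracket X Y) p := by
  have hp : p ∈ (chart p).source := mem_extChartAt_source p
  have h1 : 1 ≤ k := le_add_self.trans hm
  refine contMDiffAt_of_toChart hp ?_
  exact ((contDiffAt_toChart hp hX).lieBracket_vectorField (contDiffAt_toChart hp hY)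
    hm).congr_of_eventuallyEq (toChart_bracket_eventuallyEq hp (hX.of_le h1) (hY.of_le h1))

lemma derive_bracket (hX : SmoothAt 1 X p) (hY : SmoothAt 1 Y p)
    (hE : ContMDiffAt (𝓡 n).tangent 𝓘(ℝ, ℝ) 2 E p) :
    derive (bracket X Y) E p = derive X (derive Y E) p - derive Y (derive X E) p := by
  have hp : p ∈ (chart p).source := mem_extChartAt_source p
  have hE1 : ContMDiffAt (𝓡 n).tangent 𝓘(ℝ, ℝ) 1 E p := hE.of_le (by norm_num)
  have h2 {X Y : Field n M} (hY : SmoothAt 1 Y p) : derive X (derive Y E) p =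
      along (toChart p X) (along (toChart p Y) (E ∘ (chart p).symm)) (chart p p) := by
    rw [derive_eq_along X hp ((contMDiffAt_derive (k := 1) hY
      (by norm_num; exact hE)).mdifferentiableAt (by simp))]
    exact (along_congr (derive_comp_chart_symm hp Y hE1)).self_of_nhds
  rw [h2 hX, h2 hY, derive_eq_along _ hp (hE1.mdifferentiableAt (by simp)),
    ← along_lieBracket ((contDiffAt_toChart hp hX).differentiableAt (by simp))
      ((contDiffAt_toChart hp hY).differentiableAt (by simp)) (contDiffAt_comp_chart_symm hp hE)]
  exact congrArg (fderiv ℝ (E ∘ (chart p).symm) (chart p p)) (toChart_bracket hp hX hY)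

lemma derive_congr {f g : TangentBundle (𝓡 n) M → ℝ} (h : f =ᶠ[𝓝 p] g) (X : Field n M) :
    derive X f p = derive X g p := by
  unfold derive
  have := h.mfderiv_eq (I := (𝓡 n).tangent) (I' := 𝓘(ℝ, ℝ))
  exact congrArg (fun f : TangentSpace (𝓡 n).tangent p →L[ℝ] ℝ ↦ f (X p)) this

lemma derive_neg_field (X : Field n M) (f : TangentBundle (𝓡 n) M → ℝ) :
    derive (-X) f p = -derive X f p :=
  (mfderiv (𝓡 n).tangent 𝓘(ℝ, ℝ) f p).map_neg (X p)

lemma derive_eq_zero_of_eventuallyEq {f : TangentBundle (𝓡 n) M → ℝ} (h : f =ᶠ[𝓝 p] 0)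
    (X : Field n M) : derive X f p = 0 := by
  rw [derive_congr h]
  exact congrArg (fun f : TangentSpace (𝓡 n).tangent p →L[ℝ] ℝ ↦ f (X p))
    (mfderiv_const (c := (0 : ℝ)))

lemma bracket_swap (X Y : Field n M) : bracket X Y = -bracket Y X :=
  VectorField.mlieBracket_swap

lemma vertEndo_neg (X : Field n M) : vertEndo (-X) = -vertEndo X := by
  funext p
  have h1 := (mfderiv (𝓡 n).tangent (𝓡 n)
    (fun q : TangentBundle (𝓡 n) M ↦ q.1) p).map_neg (X p)
  let L : EuclideanSpace ℝ (Fin n) →L[ℝ] TangentSpace (𝓡 n).tangent p :=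
    mfderiv 𝓘(ℝ, EuclideanSpace ℝ (Fin n)) (𝓡 n).tangent
      (fun y : EuclideanSpace ℝ (Fin n) ↦ (⟨p.1, y⟩ : TangentBundle (𝓡 n) M)) p.2
  exact (congrArg (verticalLift p) h1).trans (L.map_neg _)

lemma vertEndo_zero : vertEndo (0 : Field n M) = 0 := by
  funext p
  have h1 := (mfderiv (𝓡 n).tangent (𝓡 n)
    (fun q : TangentBundle (𝓡 n) M ↦ q.1) p).map_zero
  let L : EuclideanSpace ℝ (Fin n) →L[ℝ] TangentSpace (𝓡 n).tangent p :=
    mfderiv 𝓘(ℝ, EuclideanSpace ℝ (Fin n)) (𝓡 n).tangent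
      (fun y : EuclideanSpace ℝ (Fin n) ↦ (⟨p.1, y⟩ : TangentBundle (𝓡 n) M)) p.2
  exact (congrArg (verticalLift p) h1).trans L.map_zero

/-- For a spray, the Euler–Lagrange operator is `Y ↦ S (JY E) - (J[S, Y]) E - Y E`. -/
lemma IsAnalyticSpray.eulerLagrange_eq (hS : IsAnalyticSpray S) (hp : ∀ᶠ q in 𝓝 p, q ∈ slit n M)
    (Y : Field n M) : eulerLagrange S E Y p =
      derive S (derive (vertEndo Y) E) p - derive (vertEndo (bracket S Y)) E p - derive Y E p := by
  have h1 : derive (vertEndo S) E =ᶠ[𝓝 p] derive (liouville n M) E := by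
    filter_upwards [hp] with q hq
    exact congrArg (mfderiv (𝓡 n).tangent 𝓘(ℝ, ℝ) E q) (hS.vertEndo_eq q hq)
  rw [eulerLagrange, Omega, derive_congr h1]
  ring

/-- If `S E = 0`, then the Euler–Lagrange operator is `Y ↦ -(Γ Y + Y) E`. -/
lemma IsAnalyticSpray.eulerLagrange_eq_neg (hS : IsAnalyticSpray S)
    (hp : ∀ᶠ q in 𝓝 p, q ∈ slit n M) (hE : ContMDiffAt (𝓡 n).tangent 𝓘(ℝ, ℝ) 2 E p)
    (hSE : derive S E =ᶠ[𝓝 p] 0) (hSp : SmoothAt 1 S p) (hY : SmoothAt 1 Y p) :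
    eulerLagrange S E Y p = -derive (connection S Y) E p - derive Y E p := by
  have h1 := derive_bracket hY.vertEndo hSp hE
  have h2 := derive_eq_zero_of_eventuallyEq hSE (vertEndo Y)
  have h3 : derive (connection S Y) E p =
      derive (bracket (vertEndo Y) S) E p - derive (vertEndo (bracket Y S)) E p :=
    (mfderiv (𝓡 n).tangent 𝓘(ℝ, ℝ) E p).map_sub _ _
  have h4 : derive (vertEndo (bracket S Y)) E p = -derive (vertEndo (bracket Y S)) E p := by
    rw [bracket_swap S Y, vertEndo_neg, derive_neg_field]
  rw [hS.eulerLagrange_eq hp, h3, h1, h2, h4]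
  ring

end Calculus

/-! ### The energy of a Finsler metric is constant along the holonomy distribution -/

section Necessity

variable {n : ℕ} {M : Type*} [TopologicalSpace M] [ChartedSpace (EuclideanSpace ℝ (Fin n)) M]
  [IsManifold (𝓡 n) ω M] {v p : TangentBundle (𝓡 n) M} {X S : Field n M}
  {U V : Set (TangentBundle (𝓡 n) M)} {E F : TangentBundle (𝓡 n) M → ℝ}

/-- Euler's relation for functions that are homogeneous of degree two in the fibre coordinates. -/
lemma derive_liouville_of_homogeneous (hE : MDifferentiableAt (𝓡 n).tangent 𝓘(ℝ, ℝ) E p)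
    (h : ∀ᶠ c : ℝ in 𝓝 1, E (⟨p.1, c • p.2⟩ : TangentBundle (𝓡 n) M) = c ^ 2 * E p) :
    derive (liouville n M) E p = 2 * E p := by
  have hp : p ∈ (chart p).source := mem_extChartAt_source p
  have hz := (chart p).map_source hp
  rw [derive_eq_along _ hp hE, along, toChart_liouville hp]
  set z := chart p p
  set g := E ∘ (chart p).symm
  have hg : DifferentiableAt ℝ g z := by
    have h1 : MDifferentiableAt 𝓘(ℝ, Coord n) 𝓘(ℝ, ℝ) g z :=
      MDifferentiableAt.comp (I' := (𝓡 n).tangent) _ (by rwa [(chart p).left_inv hp])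
        ((contMDiffAt_chart_symm hz).mdifferentiableAt (by simp))
    exact h1.differentiableAt
  let γ : ℝ → Coord n := fun c ↦ (z.1, c • z.2)
  have hγ : HasDerivAt γ (0, z.2) 1 := by
    have := (hasDerivAt_id (1 : ℝ)).smul_const z.2
    exact (hasDerivAt_const (1 : ℝ) z.1).prodMk (by simpa using this)
  have hγ1 : γ 1 = z := by simp [γ]
  have h1 : HasDerivAt (g ∘ γ) (fderiv ℝ g z (0, z.2)) 1 :=
    HasFDerivAt.comp_hasDerivAt 1 (by rw [hγ1]; exact hg.hasFDerivAt) hγ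
  have h2 : g ∘ γ =ᶠ[𝓝 1] fun c ↦ c ^ 2 * E p := by
    filter_upwards [h] with c hc
    rw [← hc]
    have h3 : (⟨p.1, c • p.2⟩ : TangentBundle (𝓡 n) M) ∈ (chart p).source :=
      mem_chart_source_iff.2 (mem_chart_source_iff.1 hp)
    have h4 : chart p (⟨p.1, c • p.2⟩ : TangentBundle (𝓡 n) M) = γ c := chart_smul hp c
    rw [Function.comp_apply, ← h4]
    exact congrArg E ((chart p).left_inv h3)
  have h3 : HasDerivAt (fun c : ℝ ↦ c ^ 2 * E p) (2 * E p) 1 := by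
    simpa using ((hasDerivAt_id (1 : ℝ)).pow 2).mul_const (E p)
  exact h1.unique (h3.congr_of_eventuallyEq h2)

lemma tendsto_smul_fibre (p : TangentBundle (𝓡 n) M) :
    Filter.Tendsto (fun c : ℝ ↦ (⟨p.1, c • p.2⟩ : TangentBundle (𝓡 n) M)) (𝓝 1) (𝓝 p) := by
  have hp : p ∈ (chart p).source := mem_extChartAt_source p
  have h1 : (fun c : ℝ ↦ (⟨p.1, c • p.2⟩ : TangentBundle (𝓡 n) M)) =
      fun c ↦ (chart p).symm ((chart p p).1, c • (chart p p).2) := by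
    funext c
    rw [← chart_smul hp c]
    have h3 : (⟨p.1, c • p.2⟩ : TangentBundle (𝓡 n) M) ∈ (chart p).source :=
      mem_chart_source_iff.2 (mem_chart_source_iff.1 hp)
    exact ((chart p).left_inv h3).symm
  rw [h1]
  refine (tendsto_chart_symm hp).comp ?_
  have h2 : Continuous fun c : ℝ ↦ (((chart p p).1, c • (chart p p).2) : Coord n) := by fun_prop
  have h3 := h2.tendsto 1
  rw [one_smul] at h3
  exact h3

/-- A function annihilated by the spray and satisfying its Euler–Lagrange equations is annihilated
by the horizontal vector fields, hence by their successive brackets. -/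
lemma IsHolonomyField.derive_eq_zero (hS : IsAnalyticSpray S) (hU : IsOpen U) (hUs : U ⊆ slit n M)
    (hE : ∀ p ∈ U, ContMDiffAt (𝓡 n).tangent 𝓘(ℝ, ℝ) ω E p) (hSE : ∀ p ∈ U, derive S E p = 0)
    (hEL : ∀ p ∈ U, ∀ W : Set (TangentBundle (𝓡 n) M), IsOpen W → p ∈ W →
      ∀ Y : Field n M, SmoothOn ∞ Y W → eulerLagrange S E Y p = 0)
    (hV : IsOpen V) (hX : IsHolonomyField S V X) :
    ∀ p ∈ U ∩ V, SmoothAt ∞ X p ∧ derive X E p = 0 := by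
  induction hX with
  | horizontal X hX =>
    intro p hp
    have hXp := hX.smooth.smoothAt hV hp.2
    refine ⟨hXp, ?_⟩
    have h1 := hEL p hp.1 V hV hp.2 X hX.smooth
    have h2 : derive S E =ᶠ[𝓝 p] 0 := by
      filter_upwards [hU.mem_nhds hp.1] with q hq using hSE q hq
    have h3 : SmoothAt ω S p := hS.analytic.contMDiffAt
      (Filter.mem_of_superset (hU.mem_nhds hp.1) hUs)
    rw [hS.eulerLagrange_eq_neg (Filter.mem_of_superset (hU.mem_nhds hp.1) hUs)
      ((hE p hp.1).of_le le_top) h2 (h3.of_le le_top) (hXp.of_le (by simp))] at h1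
    have h4 : derive (connection S X) E p = derive X E p :=
      congrArg (mfderiv (𝓡 n).tangent 𝓘(ℝ, ℝ) E p) (hX.connection_eq p hp.2)
    linarith
  | bracket X Y _ _ ihX ihY =>
    intro p hp
    have hev : ∀ᶠ q in 𝓝 p, q ∈ U ∩ V := (hU.inter hV).mem_nhds hp
    refine ⟨(ihX p hp).1.bracket (ihY p hp).1 (by simp), ?_⟩
    rw [derive_bracket ((ihX p hp).1.of_le (by simp)) ((ihY p hp).1.of_le (by simp))
      ((hE p hp.1).of_le le_top),
      derive_eq_zero_of_eventuallyEq (hev.mono fun q hq ↦ (ihX q hq).2),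
      derive_eq_zero_of_eventuallyEq (hev.mono fun q hq ↦ (ihY q hq).2), sub_zero]

lemma oneJetZero_of_eventuallyEq {φ : TangentBundle (𝓡 n) M → ℝ} (h : φ =ᶠ[𝓝 p] 0) :
    OneJetZero φ p :=
  ⟨h.self_of_nhds, h.mfderiv_eq.trans (mfderiv_const (c := (0 : ℝ)))⟩

lemma IsAnalyticFinslerOn.contMDiffAt_energy (hU : IsOpen U) (hF : IsAnalyticFinslerOn S U F)
    (hp : p ∈ U) : ContMDiffAt (𝓡 n).tangent 𝓘(ℝ, ℝ) ω (fun q ↦ F q ^ 2 / 2) p := by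
  have h1 : ContDiff ℝ ω fun x : ℝ ↦ x ^ 2 / 2 := by fun_prop
  exact (h1.contMDiff.contMDiffAt (x := F p)).comp p (hF.analytic.contMDiffAt (hU.mem_nhds hp))

lemma IsAnalyticFinslerOn.derive_liouville (hU : IsOpen U) (hF : IsAnalyticFinslerOn S U F)
    (hp : p ∈ U) : derive (liouville n M) (fun q ↦ F q ^ 2 / 2) p = 2 * (F p ^ 2 / 2) := by
  refine derive_liouville_of_homogeneous
    ((hF.contMDiffAt_energy hU hp).mdifferentiableAt (by simp)) ?_
  filter_upwards [(tendsto_smul_fibre p).eventually (hU.mem_nhds hp),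
    lt_mem_nhds (zero_lt_one (α := ℝ))] with c hc hc0
  rw [hF.homogeneous p hp c hc0 hc]
  ring

lemma IsAnalyticFinslerOn.derive_spray (hS : IsAnalyticSpray S) (hU : IsOpen U)
    (hUs : U ⊆ slit n M) (hF : IsAnalyticFinslerOn S U F) (hp : p ∈ U) :
    derive S (fun q ↦ F q ^ 2 / 2) p = 0 := by
  have hUp := hU.mem_nhds hp
  have h1 := hF.geodesics p hp U hU hp S
    ((hS.analytic.mono hUs).of_le le_top)
  rw [hS.eulerLagrange_eq (Filter.mem_of_superset hUp hUs)] at h1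
  have h2 : vertEndo (bracket S S) = 0 := by
    have h0 : bracket S S = 0 := VectorField.mlieBracket_self
    rw [h0, vertEndo_zero]
  have h3 : derive (vertEndo (bracket S S)) (fun q ↦ F q ^ 2 / 2) p = 0 := by
    rw [h2]
    exact (mfderiv (𝓡 n).tangent 𝓘(ℝ, ℝ) (fun q ↦ F q ^ 2 / 2) p).map_zero
  have h4 : derive (vertEndo S) (fun q ↦ F q ^ 2 / 2) =ᶠ[𝓝 p] fun q ↦ 2 * (F q ^ 2 / 2) := by
    filter_upwards [hUp] with q hq
    refine Eq.trans ?_ (hF.derive_liouville hU hq)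
    exact congrArg (mfderiv (𝓡 n).tangent 𝓘(ℝ, ℝ) (fun q ↦ F q ^ 2 / 2) q)
      (hS.vertEndo_eq q (hUs hq))
  have h5 : derive S (fun q ↦ 2 * (F q ^ 2 / 2)) p = 2 * derive S (fun q ↦ F q ^ 2 / 2) p := by
    have h6 := const_smul_mfderiv
      ((hF.contMDiffAt_energy hU hp).mdifferentiableAt (by simp)) (2 : ℝ)
    exact congrArg (fun f : TangentSpace (𝓡 n).tangent p →L[ℝ] ℝ ↦ f (S p)) h6
  rw [derive_congr h4, h5, h3] at h1
  linarith

/-- The energy of a Finsler metric whose geodesics are given by the spray solves the reduced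
system, so its second-order jet is positive definite initial data. -/
theorem LocallyFinslerMetrizable.hasPosDefInitialData (hS : IsAnalyticSpray S)
    (h : LocallyFinslerMetrizable S v) : HasPosDefInitialData S v := by
  obtain ⟨U, hU, hvU, hUs, F, hF⟩ := h
  refine ⟨fun q ↦ F q ^ 2 / 2, (hF.contMDiffAt_energy hU hvU).of_le le_top, ⟨?_, ?_⟩,
    hF.posDef v hvU⟩
  · refine oneJetZero_of_eventuallyEq ?_
    filter_upwards [hU.mem_nhds hvU] with q hq
    simp [hF.derive_liouville hU hq]
  · intro V hV hvV hVs X hX hXH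
    refine oneJetZero_of_eventuallyEq ?_
    filter_upwards [(hU.inter hV).mem_nhds ⟨hvU, hvV⟩] with q hq
    have h1 : holonomy S q ≤
        LinearMap.ker (mfderiv (𝓡 n).tangent 𝓘(ℝ, ℝ) (fun q ↦ F q ^ 2 / 2) q).toLinearMap := by
      refine Submodule.span_le.2 ?_
      rintro _ ⟨W, hW, hqW, hWs, Y, hY, rfl⟩
      exact (hY.derive_eq_zero hS hU hUs (fun p hp ↦ hF.contMDiffAt_energy hU hp)
        (fun p hp ↦ hF.derive_spray hS hU hUs hp) hF.geodesics hW q ⟨hq.1, hqW⟩).2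
    exact h1 (hXH q hq.2)

end Necessity

/-! ### Iterated brackets of horizontal lifts in coordinates -/

section Lifts

variable {V : Type*} [NormedAddCommGroup V] [NormedSpace ℝ V] {f : V × V → V} {T : Set (V × V)}
  {z : V × V}

/-- The derivative in the fibre direction of a function that is homogeneous of degree two in the
fibre coordinates is homogeneous of degree one. -/
lemma fderiv_fderiv_of_homogeneous {F : Type*} [NormedAddCommGroup F] [NormedSpace ℝ F]
    {g : V × V → F} (hg : ContDiffAt ℝ 2 g z)
    (h : ∀ᶠ x in 𝓝 z, fderiv ℝ g x (0, x.2) = (2 : ℝ) • g x) (w : V) :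
    fderiv ℝ (fderiv ℝ g) z (0, w) (0, z.2) = fderiv ℝ g z (0, w) := by
  let c : V × V →L[ℝ] V × V := (0 : V × V →L[ℝ] V).prod (ContinuousLinearMap.snd ℝ V V)
  have h1 : HasFDerivAt (fun x ↦ fderiv ℝ g x (c x))
      ((fderiv ℝ g z).comp c + (fderiv ℝ (fderiv ℝ g) z).flip (c z)) z :=
    ((hg.fderiv_right (m := 1) (by norm_num)).differentiableAt (by simp)).hasFDerivAt.clm_apply
      c.hasFDerivAt
  have h2 : HasFDerivAt (fun x ↦ (2 : ℝ) • g x) ((2 : ℝ) • fderiv ℝ g z) z :=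
    (hg.differentiableAt (by simp)).hasFDerivAt.const_smul 2
  have h3 := h1.unique (h2.congr_of_eventuallyEq h)
  have h4 := congrArg (fun L : V × V →L[ℝ] F ↦ L (0, w)) h3
  have h5 : fderiv ℝ g z (0, w) + fderiv ℝ (fderiv ℝ g) z (0, w) (0, z.2) =
      (2 : ℝ) • fderiv ℝ g z (0, w) := h4
  rw [two_smul] at h5
  exact add_left_cancel h5

/-- The horizontal lift of the constant vector field `w`, for the spray
`yⁱ ∂/∂xⁱ + fⁱ ∂/∂yⁱ`. -/
def horizontalLift (f : V × V → V) (w : V) (z : V × V) : V × V :=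
  (w, (1 / 2 : ℝ) • fderiv ℝ f z (0, w))

lemma horizontalLift_add (w w' : V) :
    horizontalLift f (w + w') z = horizontalLift f w z + horizontalLift f w' z := by
  have h : fderiv ℝ f z (0, w + w') = fderiv ℝ f z (0, w) + fderiv ℝ f z (0, w') := by
    rw [← map_add, Prod.mk_add_mk, add_zero]
  simp only [horizontalLift, h, smul_add, Prod.mk_add_mk]

lemma horizontalLift_smul (c : ℝ) (w : V) :
    horizontalLift f (c • w) z = c • horizontalLift f w z := by
  have h : fderiv ℝ f z (0, c • w) = c • fderiv ℝ f z (0, w) := by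
    rw [← map_smul, Prod.smul_mk, smul_zero]
  simp only [horizontalLift, h, Prod.smul_mk, smul_comm c]

/-- The iterated Lie brackets of the horizontal lifts of constant vector fields. -/
inductive IsLiftBracket (f : V × V → V) : (V × V → V × V) → Prop
  | lift (w : V) : IsLiftBracket f (horizontalLift f w)
  | bracket (X Y : V × V → V × V) : IsLiftBracket f X → IsLiftBracket f Y →
      IsLiftBracket f (VectorField.lieBracket ℝ X Y)

/-- `yⁱ ∂/∂xⁱ + fⁱ ∂/∂yⁱ` is an analytic spray on the open set `T`. The homogeneity of `f` is
expressed by Euler's relation. -/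
structure IsCoordSprayOn (f : V × V → V) (T : Set (V × V)) : Prop where
  isOpen : IsOpen T
  analytic : ∀ z ∈ T, AnalyticAt ℝ f z
  homogeneous : ∀ z ∈ T, fderiv ℝ f z (0, z.2) = (2 : ℝ) • f z

lemma _root_.AnalyticAt.lieBracket {W : Type*} [NormedAddCommGroup W] [NormedSpace ℝ W]
    [CompleteSpace W] {X Y : W → W} {x : W} (hX : AnalyticAt ℝ X x) (hY : AnalyticAt ℝ Y x) :
    AnalyticAt ℝ (VectorField.lieBracket ℝ X Y) x :=
  (hY.fderiv.clm_apply hX).fun_sub (hX.fderiv.clm_apply hY)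

/-- Vector fields that are, near `z`, combinations with smooth coefficients of iterated brackets of
horizontal lifts. -/
inductive IsLiftComb (f : V × V → V) (z : V × V) : (V × V → V × V) → Prop
  | basic (X : V × V → V × V) : IsLiftBracket f X → IsLiftComb f z X
  | zero : IsLiftComb f z 0
  | add (X Y : V × V → V × V) : IsLiftComb f z X → IsLiftComb f z Y → IsLiftComb f z (X + Y)
  | smul (c : V × V → ℝ) (X : V × V → V × V) : ContDiffAt ℝ ∞ c z → IsLiftComb f z X →
      IsLiftComb f z (fun x ↦ c x • X x)
  | congr (X Y : V × V → V × V) : IsLiftComb f z X → X =ᶠ[𝓝 z] Y → IsLiftComb f z Y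

/-- The span at `z` of the iterated brackets of horizontal lifts. -/
def liftSpan (f : V × V → V) (z : V × V) : Submodule ℝ (V × V) :=
  Submodule.span ℝ {u | ∃ Z, IsLiftBracket f Z ∧ Z z = u}

lemma IsLiftBracket.mem_liftSpan {Z : V × V → V × V} (hZ : IsLiftBracket f Z) :
    Z z ∈ liftSpan f z := Submodule.subset_span ⟨Z, hZ, rfl⟩

lemma IsLiftComb.mem_liftSpan {X : V × V → V × V} (hX : IsLiftComb f z X) :
    X z ∈ liftSpan f z := by
  induction hX with
  | basic X hX => exact hX.mem_liftSpan
  | zero => exact Submodule.zero_mem _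
  | add X Y _ _ ihX ihY => exact Submodule.add_mem _ ihX ihY
  | smul c X _ _ ih => exact Submodule.smul_mem _ _ ih
  | congr X Y _ h ih => exact h.self_of_nhds ▸ ih

lemma IsLiftComb.lieBracket_swap {X Y : V × V → V × V}
    (h : IsLiftComb f z (VectorField.lieBracket ℝ X Y)) :
    IsLiftComb f z (VectorField.lieBracket ℝ Y X) := by
  refine .congr _ _ (.smul (fun _ ↦ -1) _ contDiffAt_const h) (.of_forall fun x ↦ ?_)
  rw [VectorField.lieBracket_swap]
  simp

lemma IsLiftComb.sum {ι : Type*} (s : Finset ι) {c : ι → V × V → ℝ} {X : ι → V × V → V × V}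
    (hc : ∀ i, ContDiffAt ℝ ∞ (c i) z) (hX : ∀ i, IsLiftComb f z (X i)) :
    IsLiftComb f z (fun x ↦ ∑ i ∈ s, c i x • X i x) := by
  classical
  induction s using Finset.induction_on with
  | empty => simpa using! IsLiftComb.zero
  | insert i s hi ih =>
    simp only [Finset.sum_insert hi]
    exact .add _ _ (.smul _ _ (hc i) (hX i)) ih

/-- Horizontal vector fields are combinations of horizontal lifts. -/
lemma isLiftComb_of_horizontal [FiniteDimensional ℝ V] {X : V × V → V × V}
    (hX : ContDiffAt ℝ ∞ X z) (h : ∀ᶠ x in 𝓝 z, X x = horizontalLift f (X x).1 x) :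
    IsLiftComb f z X := by
  let b := Module.finBasis ℝ V
  refine .congr _ _ (.sum Finset.univ (c := fun i x ↦ b.coord i (X x).1)
    (X := fun i ↦ horizontalLift f (b i)) (fun i ↦ ?_) fun i ↦ .basic _ (.lift _)) ?_
  · exact (LinearMap.toContinuousLinearMap (b.coord i)).contDiff.contDiffAt.comp z hX.fst
  · filter_upwards [h] with x hx
    let L : V →ₗ[ℝ] V × V :=
      { toFun := fun w ↦ horizontalLift f w x
        map_add' := horizontalLift_add
        map_smul' := horizontalLift_smul }
    have h1 : L (∑ i, b.repr (X x).1 i • b i) = ∑ i, b.repr (X x).1 i • L (b i) := by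
      simp only [map_sum, map_smul]
    rw [b.sum_repr] at h1
    rw [hx]
    exact h1.symm

variable [CompleteSpace V]

lemma lieBracket_liouville_lift (hf : IsCoordSprayOn f T) (hz : z ∈ T) (w : V) :
    VectorField.lieBracket ℝ (fun x : V × V ↦ (0, x.2)) (horizontalLift f w) z = 0 := by
  let c : V × V →L[ℝ] V × V := (0 : V × V →L[ℝ] V).prod (ContinuousLinearMap.snd ℝ V V)
  have h1 : HasFDerivAt (fun x ↦ fderiv ℝ f x (0, w))
      ((fderiv ℝ (fderiv ℝ f) z).flip (0, w)) z := by
    simpa using (hf.analytic z hz).fderiv.differentiableAt.hasFDerivAt.clm_apply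
      (hasFDerivAt_const ((0 : V), w) z)
  have h2 : HasFDerivAt (horizontalLift f w) ((0 : V × V →L[ℝ] V).prod
      ((1 / 2 : ℝ) • (fderiv ℝ (fderiv ℝ f) z).flip (0, w))) z :=
    (hasFDerivAt_const w z).prodMk (h1.const_smul (1 / 2 : ℝ))
  have h3 : fderiv ℝ (fun x : V × V ↦ ((0 : V), x.2)) z = c := c.hasFDerivAt.fderiv
  have h4 : IsSymmSndFDerivAt ℝ f z :=
    ((hf.analytic z hz).contDiffAt (n := ω)).isSymmSndFDerivAt (by simp)
  have h5 := fderiv_fderiv_of_homogeneous (hf.analytic z hz).contDiffAt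
    (Filter.eventually_of_mem (hf.isOpen.mem_nhds hz) hf.homogeneous) w
  have h6 : fderiv ℝ (fderiv ℝ f) z (0, z.2) (0, w) = fderiv ℝ f z (0, w) :=
    (h4 _ _).trans h5
  rw [VectorField.lieBracket, h2.fderiv, h3]
  simp [c, horizontalLift, h6]

lemma analyticAt_horizontalLift (hf : AnalyticAt ℝ f z) (w : V) :
    AnalyticAt ℝ (horizontalLift f w) z :=
  analyticAt_const.prod (analyticAt_const.fun_smul (hf.fderiv.clm_apply analyticAt_const))

/-- By the Jacobi identity, iterated brackets of horizontal lifts commute with the Liouville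
field. -/
lemma IsLiftBracket.analyticAt_and_lieBracket_liouville {Z : V × V → V × V}
    (hZ : IsLiftBracket f Z) (hf : IsCoordSprayOn f T) : ∀ z ∈ T, AnalyticAt ℝ Z z ∧
      VectorField.lieBracket ℝ (fun x : V × V ↦ (0, x.2)) Z z = 0 := by
  induction hZ with
  | lift w =>
    exact fun z hz ↦ ⟨analyticAt_horizontalLift (hf.analytic z hz) w,
      lieBracket_liouville_lift hf hz w⟩
  | bracket X Y _ _ ihX ihY =>
    intro z hz
    refine ⟨(ihX z hz).1.lieBracket (ihY z hz).1, ?_⟩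
    have hc : ContDiffAt ℝ ω (fun x : V × V ↦ ((0 : V), x.2)) z := by fun_prop
    have hev {X : V × V → V × V} (h : ∀ z ∈ T, AnalyticAt ℝ X z ∧
        VectorField.lieBracket ℝ (fun x : V × V ↦ ((0 : V), x.2)) X z = 0) :
        VectorField.lieBracket ℝ (fun x : V × V ↦ ((0 : V), x.2)) X =ᶠ[𝓝 z] 0 :=
      Filter.eventually_of_mem (hf.isOpen.mem_nhds hz) fun x hx ↦ (h x hx).2
    rw [VectorField.leibniz_identity_lieBracket (n := ω) (by simp) hc (ihX z hz).1.contDiffAt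
      (ihY z hz).1.contDiffAt, (hev ihX).lieBracket_vectorField_eq .rfl,
      Filter.EventuallyEq.lieBracket_vectorField_eq .rfl (hev ihY)]
    simp

lemma IsLiftComb.contDiffAt {X : V × V → V × V} (hX : IsLiftComb f z X)
    (hf : IsCoordSprayOn f T) (hz : z ∈ T) : ContDiffAt ℝ ∞ X z := by
  induction hX with
  | basic X hX => exact (hX.analyticAt_and_lieBracket_liouville hf z hz).1.contDiffAt
  | zero => exact contDiffAt_const
  | add X Y _ _ ihX ihY => exact ihX.add ihY
  | smul c X hc _ ih => exact hc.smul ih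
  | congr X Y _ h ih => exact ih.congr_of_eventuallyEq h.symm

lemma eventually_differentiableAt {W F : Type*} [NormedAddCommGroup W] [NormedSpace ℝ W]
    [NormedAddCommGroup F] [NormedSpace ℝ F] {g : W → F} {x : W} (hg : ContDiffAt ℝ ∞ g x) :
    ∀ᶠ y in 𝓝 x, DifferentiableAt ℝ g y :=
  ((hg.of_le (m := 1) (by simp)).eventually (by simp)).mono fun y hy ↦
    hy.differentiableAt (by simp)

/-- Whether `[X, ·]` preserves the combinations has to be checked on iterated brackets of
horizontal lifts only. -/
lemma IsLiftComb.lieBracket_of_basic (hf : IsCoordSprayOn f T) (hz : z ∈ T)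
    {X Y : V × V → V × V} (hX : ContDiffAt ℝ ∞ X z)
    (h : ∀ Z, IsLiftBracket f Z → IsLiftComb f z (VectorField.lieBracket ℝ X Z))
    (hY : IsLiftComb f z Y) : IsLiftComb f z (VectorField.lieBracket ℝ X Y) := by
  induction hY with
  | basic Z hZ => exact h Z hZ
  | zero => simpa using IsLiftComb.zero
  | add Y Y' hY hY' ih ih' =>
    refine .congr _ _ (.add _ _ ih ih') ?_
    filter_upwards [eventually_differentiableAt (hY.contDiffAt hf hz),
      eventually_differentiableAt (hY'.contDiffAt hf hz)] with x h1 h2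
    exact (VectorField.lieBracket_add_right h1 h2).symm
  | smul c Y hc hY ih =>
    have h1 : ContDiffAt ℝ ∞ (along X c) z := contDiffAt_along hX (by simpa using hc)
    refine .congr _ _ (.add _ _ (.smul _ _ h1 hY) (.smul _ _ hc ih)) ?_
    filter_upwards [eventually_differentiableAt (hY.contDiffAt hf hz),
      eventually_differentiableAt hc] with x h1 h2
    exact (VectorField.lieBracket_smul_right h2 h1).symm
  | congr Y Y' _ hYY ih =>
    refine .congr _ _ ih ?_
    filter_upwards [hYY.eventually_nhds] with x hx
    exact Filter.EventuallyEq.lieBracket_vectorField_eq .rfl hx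

lemma IsLiftComb.lieBracket (hf : IsCoordSprayOn f T) (hz : z ∈ T) {X Y : V × V → V × V}
    (hX : IsLiftComb f z X) (hY : IsLiftComb f z Y) :
    IsLiftComb f z (VectorField.lieBracket ℝ X Y) := by
  refine .lieBracket_of_basic hf hz (hX.contDiffAt hf hz) (fun Z hZ ↦ ?_) hY
  refine .lieBracket_swap (.lieBracket_of_basic hf hz
    (hZ.analyticAt_and_lieBracket_liouville hf z hz).1.contDiffAt (fun Z' hZ' ↦ ?_) hX)
  exact .basic _ (.bracket _ _ hZ hZ')

/-- A distribution of locally constant rank spanned by iterated brackets of horizontal lifts has a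
local basis consisting of such brackets. -/
lemma exists_liftBracket_basis [FiniteDimensional ℝ V] (hf : IsCoordSprayOn f T) (hz : z ∈ T)
    {r : ℕ} (hr : ∀ᶠ x in 𝓝 z, Module.finrank ℝ (liftSpan f x) = r) :
    ∃ Z : Fin r → V × V → V × V, (∀ i, IsLiftBracket f (Z i)) ∧
      LinearIndependent ℝ (fun i ↦ Z i z) ∧
      ∀ᶠ x in 𝓝 z, liftSpan f x = Submodule.span ℝ (Set.range fun i ↦ Z i x) := by
  obtain ⟨b, hb, hbs, hbl⟩ := exists_linearIndependent ℝ {u | ∃ Z, IsLiftBracket f Z ∧ Z z = u}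
  have := hbl.setFinite.fintype
  have hcard : Fintype.card b = r := by
    have h1 := finrank_span_set_eq_card hbl
    rw [hbs, Set.toFinset_card] at h1
    exact h1.symm.trans hr.self_of_nhds
  let e : Fin r ≃ b := (Fintype.equivFinOfCardEq hcard).symm
  choose Z hZ hZe using fun i ↦ hb (e i).2
  have hlin : LinearIndependent ℝ fun i ↦ Z i z := by
    simp only [hZe]
    exact hbl.comp e e.injective
  refine ⟨Z, hZ, hlin, ?_⟩
  have hcont : ContinuousAt (fun x i ↦ Z i x) z := continuousAt_pi.2 fun i ↦
    ((hZ i).analyticAt_and_lieBracket_liouville hf z hz).1.continuousAt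
  filter_upwards [hr, hcont.eventually (isOpen_setOfPred_linearIndependent.mem_nhds hlin)] with x h1 h2
  refine (Submodule.eq_of_le_of_finrank_eq (Submodule.span_le.2 ?_) ?_).symm
  · rintro _ ⟨i, rfl⟩
    exact (hZ i).mem_liftSpan
  · rw [h1, finrank_span_eq_card h2, Fintype.card_fin]

end Lifts

/-! ### Sprays and their holonomy distributions in an induced chart -/

section Spray

variable {n : ℕ} {M : Type*} [TopologicalSpace M] [ChartedSpace (EuclideanSpace ℝ (Fin n)) M]
  [IsManifold (𝓡 n) ω M] {v p : TangentBundle (𝓡 n) M} {z : Coord n} {X Y S : Field n M}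
  {U : Set (TangentBundle (𝓡 n) M)}

/-- The part of the slit tangent bundle covered by the chart at `v`, in coordinates. -/
def slitTarget (v : TangentBundle (𝓡 n) M) : Set (Coord n) := {z ∈ (chart v).target | z.2 ≠ 0}

/-- The coefficients `fⁱ` of a spray `yⁱ ∂/∂xⁱ + fⁱ ∂/∂yⁱ` in the chart at `v`. -/
def sprayCoeff (v : TangentBundle (𝓡 n) M) (S : Field n M) :
    Coord n → EuclideanSpace ℝ (Fin n) := fun z ↦ (toChart v S z).2

lemma isOpen_slitTarget (v : TangentBundle (𝓡 n) M) : IsOpen (slitTarget v) :=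
  (isOpen_chart_target v).inter (isOpen_ne_fun continuous_snd continuous_const)

lemma isOpen_chart_source_inter_preimage (v : TangentBundle (𝓡 n) M) {B : Set (Coord n)}
    (hB : IsOpen B) : IsOpen ((chart v).source ∩ chart v ⁻¹' B) :=
  (continuousOn_extChartAt v).isOpen_inter_preimage (isOpen_chart_source v) hB

lemma chart_mem_slitTarget (hp : p ∈ (chart v).source) :
    chart v p ∈ slitTarget v ↔ p ∈ slit n M := by
  rw [mem_slit_iff hp]
  exact and_iff_right ((chart v).map_source hp)

lemma chart_symm_mem_slit (hz : z ∈ slitTarget v) : (chart v).symm z ∈ slit n M := by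
  rw [← chart_mem_slitTarget ((chart v).map_target hz.1), (chart v).right_inv hz.1]
  exact hz

lemma isOpen_source_inter_slit (v : TangentBundle (𝓡 n) M) :
    IsOpen ((chart v).source ∩ slit n M) := by
  have : (chart v).source ∩ slit n M = (chart v).source ∩ chart v ⁻¹' slitTarget v := by
    ext p
    exact and_congr_right fun hp ↦ (chart_mem_slitTarget hp).symm
  rw [this]
  exact isOpen_chart_source_inter_preimage v (isOpen_slitTarget v)

lemma forall_slitTarget {P : Coord n → Prop} (h : ∀ p ∈ (chart v).source, p ∈ slit n M →
    P (chart v p)) : ∀ z ∈ slitTarget v, P z := by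
  intro z hz
  rw [← (chart v).right_inv hz.1]
  exact h _ ((chart v).map_target hz.1) (chart_symm_mem_slit hz)

lemma IsAnalyticSpray.smoothAt (hS : IsAnalyticSpray S) (hp : p ∈ slit n M) : SmoothAt ω S p :=
  hS.analytic.smoothAt (U := slit n M) (by
    refine isOpen_iff_mem_nhds.2 fun q hq ↦ ?_
    exact Filter.mem_of_superset ((isOpen_source_inter_slit q).mem_nhds
      ⟨mem_extChartAt_source q, hq⟩) Set.inter_subset_right) hp

lemma IsAnalyticSpray.toChart_eq (hS : IsAnalyticSpray S) :
    ∀ z ∈ slitTarget v, toChart v S z = (z.2, sprayCoeff v S z) := by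
  refine forall_slitTarget fun p hp hps ↦ Prod.ext ?_ rfl
  have h1 : toChart v (vertEndo S) (chart v p) = toChart v (liouville n M) (chart v p) := by
    rw [toChart_chart hp, toChart_chart hp]
    exact congrArg (mfderiv (𝓡 n).tangent 𝓘(ℝ, Coord n) (chart v) p) (hS.vertEndo_eq p hps)
  rw [toChart_vertEndo hp, toChart_liouville hp] at h1
  exact congrArg Prod.snd h1

lemma IsAnalyticSpray.isCoordSprayOn (hS : IsAnalyticSpray S) (v : TangentBundle (𝓡 n) M) :
    IsCoordSprayOn (sprayCoeff v S) (slitTarget v) := by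
  have han : ∀ z ∈ slitTarget v, AnalyticAt ℝ (toChart v S) z :=
    forall_slitTarget fun p hp hps ↦ (contDiffAt_toChart hp (hS.smoothAt hps)).analyticAt
  refine ⟨isOpen_slitTarget v, fun z hz ↦
    ((han z hz).contDiffAt (n := ω)).snd.analyticAt, ?_⟩
  refine forall_slitTarget fun p hp hps ↦ ?_
  have hd := (han _ ((chart_mem_slitTarget hp).2 hps)).differentiableAt
  have h1 : toChart v (bracket (liouville n M) S) (chart v p) = toChart v S (chart v p) := by
    rw [toChart_chart hp, toChart_chart hp]
    exact congrArg (mfderiv (𝓡 n).tangent 𝓘(ℝ, Coord n) (chart v) p) (hS.homogeneous p hps)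
  rw [toChart_bracket hp ((smoothAt_liouville p).of_le le_top)
    ((hS.smoothAt hps).of_le le_top),
    (toChart_liouville_eventuallyEq hp).lieBracket_vectorField_eq .rfl] at h1
  let c : Coord n →L[ℝ] Coord n := (0 : Coord n →L[ℝ] EuclideanSpace ℝ (Fin n)).prod
    (ContinuousLinearMap.snd ℝ _ _)
  have h3 : fderiv ℝ (fun x : Coord n ↦ ((0 : EuclideanSpace ℝ (Fin n)), x.2)) (chart v p) = c :=
    c.hasFDerivAt.fderiv
  have h4 : fderiv ℝ (sprayCoeff v S) (chart v p) =
      (ContinuousLinearMap.snd ℝ _ _).comp (fderiv ℝ (toChart v S) (chart v p)) := hd.hasFDerivAt.snd.fderiv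
  have h5 := congrArg Prod.snd h1
  rw [VectorField.lieBracket, h3] at h5
  rw [h4, two_smul]
  exact sub_eq_iff_eq_add.1 h5

/-- The connection of a spray in coordinates: `Γ(a, b) = (a, ∂f/∂y · a - b)`. -/
lemma IsAnalyticSpray.toChart_connection (hS : IsAnalyticSpray S) (hp : p ∈ (chart v).source)
    (hps : p ∈ slit n M) (hY : SmoothAt 1 Y p) :
    toChart v (connection S Y) (chart v p) = ((toChart v Y (chart v p)).1,
      fderiv ℝ (sprayCoeff v S) (chart v p) (0, (toChart v Y (chart v p)).1) -
        (toChart v Y (chart v p)).2) := by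
  have hz := (chart_mem_slitTarget hp).2 hps
  have hSp : SmoothAt 1 S p := (hS.smoothAt hps).of_le le_top
  have hSd : HasFDerivAt (toChart v S) _ (chart v p) :=
    ((contDiffAt_toChart hp hSp).differentiableAt (by simp)).hasFDerivAt
  have hYd : HasFDerivAt (toChart v Y) _ (chart v p) :=
    ((contDiffAt_toChart hp hY).differentiableAt (by simp)).hasFDerivAt
  have hfd : fderiv ℝ (sprayCoeff v S) (chart v p) = (ContinuousLinearMap.snd ℝ _ _).comp
      (fderiv ℝ (toChart v S) (chart v p)) := hSd.snd.fderiv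
  have hS1 : ∀ u, (fderiv ℝ (toChart v S) (chart v p) u).1 = u.2 := by
    have h1 : (fun z ↦ (toChart v S z).1) =ᶠ[𝓝 (chart v p)] fun z ↦ z.2 := by
      filter_upwards [(isOpen_slitTarget v).mem_nhds hz] with x hx
      rw [hS.toChart_eq x hx]
    have h2 := hSd.fst.unique (hasFDerivAt_snd.congr_of_eventuallyEq h1)
    exact fun u ↦ congrArg (fun L : Coord n →L[ℝ] EuclideanSpace ℝ (Fin n) ↦ L u) h2
  have hJY : HasFDerivAt (fun z ↦ ((0 : EuclideanSpace ℝ (Fin n)), (toChart v Y z).1)) _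
      (chart v p) := (hasFDerivAt_const (0 : EuclideanSpace ℝ (Fin n)) _).prodMk hYd.fst
  have hsub : toChart v (connection S Y) (chart v p) =
      toChart v (bracket (vertEndo Y) S) (chart v p) -
        toChart v (vertEndo (bracket Y S)) (chart v p) := by
    simp only [toChart_chart hp]
    exact (mfderiv (𝓡 n).tangent 𝓘(ℝ, Coord n) (chart v) p).map_sub _ _
  rw [hsub, toChart_vertEndo hp, toChart_bracket hp hY hSp, toChart_bracket hp hY.vertEndo hSp,
    (toChart_vertEndo_eventuallyEq hp Y).lieBracket_vectorField_eq .rfl, VectorField.lieBracket,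
    VectorField.lieBracket, hJY.fderiv, hfd]
  generalize fderiv ℝ (toChart v S) (chart v p) = A at hS1 ⊢
  generalize fderiv ℝ (toChart v Y) (chart v p) = B
  generalize toChart v Y (chart v p) = u
  refine Prod.ext ?_ ?_
  · simp [hS1]
  · simp [hS1]

/-- A smooth vector field is horizontal if and only if, in coordinates, its values are horizontal
lifts. -/
lemma IsAnalyticSpray.connection_eq_iff (hS : IsAnalyticSpray S) (hp : p ∈ (chart v).source)
    (hps : p ∈ slit n M) (hY : SmoothAt 1 Y p) : connection S Y p = Y p ↔
      toChart v Y (chart v p) =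
        horizontalLift (sprayCoeff v S) (toChart v Y (chart v p)).1 (chart v p) := by
  have h1 : connection S Y p = Y p ↔
      toChart v (connection S Y) (chart v p) = toChart v Y (chart v p) := by
    rw [toChart_chart hp, toChart_chart hp]
    exact (isInvertible_mfderiv_chart hp).injective.eq_iff.symm
  rw [h1, hS.toChart_connection hp hps hY, horizontalLift]
  set u := toChart v Y (chart v p)
  set d := fderiv ℝ (sprayCoeff v S) (chart v p) (0, u.1)
  constructor <;> intro h <;> refine Prod.ext rfl ?_
  · have h2 : d - u.2 = u.2 := congrArg Prod.snd h
    rw [sub_eq_iff_eq_add.1 h2, ← two_smul ℝ u.2, smul_smul]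
    norm_num
  · have h2 : u.2 = (1 / 2 : ℝ) • d := congrArg Prod.snd h
    have h3 : d = (2 : ℝ) • u.2 := by rw [h2, smul_smul]; norm_num
    rw [h3, two_smul, add_sub_cancel_right]

/-- The iterated brackets of horizontal lifts are coordinate expressions of holonomy fields. -/
lemma IsLiftBracket.exists_isHolonomyField (hS : IsAnalyticSpray S) {Z : Coord n → Coord n}
    (hZ : IsLiftBracket (sprayCoeff v S) Z) :
    ∃ X : Field n M, IsHolonomyField S ((chart v).source ∩ slit n M) X ∧
      (∀ p ∈ (chart v).source ∩ slit n M, SmoothAt ω X p) ∧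
      ∀ z ∈ slitTarget v, toChart v X z = Z z := by
  have hf := hS.isCoordSprayOn v
  -- The regularity of `X` follows from its coordinate expression.
  have hsm {Z : Coord n → Coord n} (hZ : IsLiftBracket (sprayCoeff v S) Z) {X : Field n M}
      (hX : ∀ z ∈ slitTarget v, toChart v X z = Z z) :
      ∀ p ∈ (chart v).source ∩ slit n M, SmoothAt ω X p := by
    intro p hp
    have hz := (chart_mem_slitTarget hp.1).2 hp.2
    refine contMDiffAt_of_toChart hp.1 ?_
    exact (hZ.analyticAt_and_lieBracket_liouville hf _ hz).1.contDiffAt.congr_of_eventuallyEq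
      (Filter.eventually_of_mem ((isOpen_slitTarget v).mem_nhds hz) hX)
  suffices h : ∃ X : Field n M, IsHolonomyField S ((chart v).source ∩ slit n M) X ∧
      ∀ z ∈ slitTarget v, toChart v X z = Z z by
    obtain ⟨X, h1, h2⟩ := h
    exact ⟨X, h1, hsm hZ h2, h2⟩
  induction hZ with
  | lift w =>
    have h1 : ∀ z ∈ slitTarget v, toChart v
        (ofChart v (horizontalLift (sprayCoeff v S) w) : Field n M) z =
        horizontalLift (sprayCoeff v S) w z := fun z hz ↦ toChart_ofChart hz.1 _
    have h2 := hsm (.lift w) h1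
    refine ⟨_, .horizontal _ ⟨fun p hp ↦ ((h2 p hp).of_le le_top).contMDiffWithinAt,
      fun p hp ↦ ?_⟩, h1⟩
    rw [hS.connection_eq_iff hp.1 hp.2 ((h2 p hp).of_le le_top),
      h1 _ ((chart_mem_slitTarget hp.1).2 hp.2)]
    rfl
  | bracket Z Z' hZ hZ' ih ih' =>
    obtain ⟨X, hX, hXZ⟩ := ih
    obtain ⟨X', hX', hXZ'⟩ := ih'
    refine ⟨_, .bracket X X' hX hX', forall_slitTarget fun p hp hps ↦ ?_⟩
    have hz := (isOpen_slitTarget v).mem_nhds ((chart_mem_slitTarget hp).2 hps)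
    rw [toChart_bracket hp ((hsm hZ hXZ p ⟨hp, hps⟩).of_le le_top)
      ((hsm hZ' hXZ' p ⟨hp, hps⟩).of_le le_top)]
    exact Filter.EventuallyEq.lieBracket_vectorField_eq (Filter.eventually_of_mem hz hXZ)
      (Filter.eventually_of_mem hz hXZ')

/-- Holonomy fields are, in coordinates, combinations with smooth coefficients of the iterated
brackets of horizontal lifts. -/
lemma IsHolonomyField.isLiftComb (hS : IsAnalyticSpray S) (hU : IsOpen U) (hUs : U ⊆ slit n M)
    (hX : IsHolonomyField S U X) : ∀ p ∈ U, p ∈ (chart v).source →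
      SmoothAt ∞ X p ∧ IsLiftComb (sprayCoeff v S) (chart v p) (toChart v X) := by
  have hf := hS.isCoordSprayOn v
  induction hX with
  | horizontal X hX =>
    intro p hpU hp
    have hXp := hX.smooth.smoothAt hU hpU
    refine ⟨hXp, isLiftComb_of_horizontal (contDiffAt_toChart hp hXp) ?_⟩
    filter_upwards [(tendsto_chart_symm hp).eventually (hU.mem_nhds hpU),
      (isOpen_chart_target v).mem_nhds ((chart v).map_source hp)] with z hzU hz
    have h1 := (hS.connection_eq_iff ((chart v).map_target hz) (hUs hzU)
      ((hX.smooth.smoothAt hU hzU).of_le (by simp))).1 (hX.connection_eq _ hzU)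
    rwa [(chart v).right_inv hz] at h1
  | bracket X Y _ _ ihX ihY =>
    intro p hpU hp
    obtain ⟨hX, hX'⟩ := ihX p hpU hp
    obtain ⟨hY, hY'⟩ := ihY p hpU hp
    refine ⟨hX.bracket hY (by simp), .congr _ _
      (hX'.lieBracket hf ((chart_mem_slitTarget hp).2 (hUs hpU)) hY') ?_⟩
    exact (toChart_bracket_eventuallyEq hp (hX.of_le (by simp)) (hY.of_le (by simp))).symm

/-- The derivative at `p` of the chart at `v`. -/
def chartDeriv (v p : TangentBundle (𝓡 n) M) : TangentSpace (𝓡 n).tangent p →ₗ[ℝ] Coord n :=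
  (mfderiv (𝓡 n).tangent 𝓘(ℝ, Coord n) (chart v) p).toLinearMap

lemma chartDeriv_injective (hp : p ∈ (chart v).source) : Function.Injective (chartDeriv v p) :=
  (isInvertible_mfderiv_chart hp).injective

lemma chartDeriv_apply (hp : p ∈ (chart v).source) (X : Field n M) :
    chartDeriv v p (X p) = toChart v X (chart v p) :=
  (toChart_chart hp X).symm

/-- In coordinates, the holonomy distribution is spanned by the iterated brackets of horizontal
lifts. -/
lemma IsAnalyticSpray.map_holonomy (hS : IsAnalyticSpray S) (hp : p ∈ (chart v).source)
    (hps : p ∈ slit n M) :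
    (holonomy S p).map (chartDeriv v p) = liftSpan (sprayCoeff v S) (chart v p) := by
  refine le_antisymm ?_ ?_
  · rw [holonomy, Submodule.map_span_le]
    rintro _ ⟨U, hU, hpU, hUs, X, hX, rfl⟩
    rw [chartDeriv_apply hp]
    exact (hX.isLiftComb (v := v) hS hU hUs p hpU hp).2.mem_liftSpan
  · refine Submodule.span_le.2 ?_
    rintro _ ⟨Z, hZ, rfl⟩
    obtain ⟨X, hX, -, hXZ⟩ := hZ.exists_isHolonomyField hS
    refine ⟨X p, Submodule.subset_span ⟨_, isOpen_source_inter_slit v, ⟨hp, hps⟩,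
      Set.inter_subset_right, X, hX, rfl⟩, ?_⟩
    rw [chartDeriv_apply hp, hXZ _ ((chart_mem_slitTarget hp).2 hps)]

lemma IsAnalyticSpray.mem_holonomy_iff (hS : IsAnalyticSpray S) (hp : p ∈ (chart v).source)
    (hps : p ∈ slit n M) (X : Field n M) : X p ∈ holonomy S p ↔
      toChart v X (chart v p) ∈ liftSpan (sprayCoeff v S) (chart v p) := by
  rw [← hS.map_holonomy hp hps, ← chartDeriv_apply hp]
  exact ((chartDeriv_injective hp).mem_set_image (s := holonomy S p)).symm

lemma IsAnalyticSpray.finrank_holonomy (hS : IsAnalyticSpray S) (hp : p ∈ (chart v).source)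
    (hps : p ∈ slit n M) : Module.finrank ℝ (holonomy S p) =
      Module.finrank ℝ (liftSpan (sprayCoeff v S) (chart v p)) := by
  rw [← hS.map_holonomy hp hps]
  exact (Submodule.equivMapOfInjective (chartDeriv v p) (chartDeriv_injective hp)
    (holonomy S p)).finrank_eq

end Spray

/-! ### Construction of the Finsler metric from positive definite initial data -/

section Homogeneous

variable {V : Type*} [NormedAddCommGroup V] [NormedSpace ℝ V]

/-- On a convex set, Euler's relation integrates to homogeneity. -/
lemma eq_sq_mul_of_euler {B : Set (V × V)} (hB : Convex ℝ B) {G : V × V → ℝ}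
    (hG : ∀ z ∈ B, DifferentiableAt ℝ G z) (h : ∀ z ∈ B, fderiv ℝ G z (0, z.2) = 2 * G z) {x y : V}
    {c : ℝ} (hc : 0 < c) (h1 : (x, y) ∈ B) (h2 : (x, c • y) ∈ B) :
    G (x, c • y) = c ^ 2 * G (x, y) := by
  -- On this interval `G (x, t y) / t ^ 2` has zero derivative.
  let s : Set ℝ := {t | 0 < t ∧ (x, t • y) ∈ B}
  have hs : Convex ℝ s := by
    intro t ht t' ht' a b ha hb hab
    refine ⟨convex_Ioi (0 : ℝ) ht.1 ht'.1 ha hb hab, ?_⟩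
    have h3 : (x, (a • t + b • t') • y) = a • (x, t • y) + b • (x, t' • y) := by
      ext <;> simp [← add_smul, hab, smul_smul]
    rw [h3]
    exact hB ht.2 ht'.2 ha hb hab
  have hd : ∀ t ∈ s, HasDerivWithinAt (fun t ↦ G (x, t • y) / t ^ 2) 0 s t := by
    intro t ht
    have h3 : HasDerivAt (fun t : ℝ ↦ (x, t • y)) (0, y) t := by
      have := (hasDerivAt_id t).smul_const y
      exact (hasDerivAt_const t x).prodMk (by simpa using this)
    have h4 := (hG _ ht.2).hasFDerivAt.comp_hasDerivAt t h3
    have h5 := (h4.fun_div ((hasDerivAt_id t).fun_pow 2) (by simpa using ht.1.ne')).hasDerivWithinAt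
      (s := s)
    have h6 : ((0 : V), t • y) = t • ((0 : V), y) := by simp
    have h7 : fderiv ℝ G (x, t • y) (0, t • y) = 2 * G (x, t • y) := h _ ht.2
    rw [h6, map_smul, smul_eq_mul] at h7
    have h8 : fderiv ℝ G (x, t • y) (0, y) * t ^ 2 = G (x, t • y) * (2 * t) := by
      linear_combination t * h7
    exact h5.congr_deriv (by simp [h8])
  have h3 := hs.norm_image_sub_le_of_norm_hasDerivWithin_le (C := 0) hd (by simp)
    (x := 1) (y := c) ⟨one_pos, by simpa using h1⟩ ⟨hc, h2⟩
  simp only [zero_mul, norm_le_zero_iff, sub_eq_zero, one_smul, one_pow, div_one] at h3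
  rw [div_eq_iff (by positivity)] at h3
  rw [h3, mul_comm]

/-- Positive definiteness is an open condition. -/
lemma eventually_forall_pos {W X : Type*} [FiniteDimensional ℝ V] [NormedAddCommGroup W]
    [NormedSpace ℝ W] [TopologicalSpace X] {x₀ : X} {Q : X → W →L[ℝ] W →L[ℝ] ℝ}
    (hQ : ContinuousAt Q x₀) (L : V →L[ℝ] W) (h : ∀ u, u ≠ 0 → 0 < Q x₀ (L u) (L u)) :
    ∀ᶠ x in 𝓝 x₀, ∀ u, u ≠ 0 → 0 < Q x (L u) (L u) := by
  have := FiniteDimensional.proper_real V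
  have h1 : ∀ᶠ x in 𝓝 x₀, ∀ u ∈ Metric.sphere (0 : V) 1, 0 < Q x (L u) (L u) := by
    refine (isCompact_sphere _ _).eventually_forall_of_forall_eventually fun u hu ↦ ?_
    have hL : ContinuousAt (fun z : X × V ↦ L z.2) (x₀, u) := by fun_prop
    have hQ' : ContinuousAt (fun z : X × V ↦ Q z.1) (x₀, u) := hQ.comp' continuousAt_fst
    have hc : ContinuousAt (fun z : X × V ↦ Q z.1 (L z.2) (L z.2)) (x₀, u) :=
      (hQ'.clm_apply hL).clm_apply hL
    exact hc.eventually (lt_mem_nhds (h u (Metric.ne_of_mem_sphere hu one_ne_zero)))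
  filter_upwards [h1] with x hx u hu
  have hu' : 0 < ‖u‖ := norm_pos_iff.2 hu
  have h2 := hx (‖u‖⁻¹ • u) (by simp [norm_smul, hu'.ne'])
  simp only [map_smul, smul_apply, smul_eq_mul] at h2
  exact (pos_of_mul_pos_right (pos_of_mul_pos_right h2 (by positivity)) (by positivity))

end Homogeneous

section Sufficiency

variable {n : ℕ} {M : Type*} [TopologicalSpace M] [ChartedSpace (EuclideanSpace ℝ (Fin n)) M]
  [IsManifold (𝓡 n) ω M] {v p : TangentBundle (𝓡 n) M} {X S : Field n M}
  {E φ : TangentBundle (𝓡 n) M → ℝ}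

lemma posDefAt_iff (hp : p ∈ (chart v).source)
    (hE : ContDiffAt ℝ 2 (E ∘ (chart v).symm) (chart v p)) :
    PosDefAt E p ↔ ∀ u, u ≠ 0 →
      0 < fderiv ℝ (fderiv ℝ (E ∘ (chart v).symm)) (chart v p) (0, u) (0, u) := by
  have hx := mem_chart_source_iff.1 hp
  constructor
  · intro h u hu
    obtain ⟨w, rfl⟩ := fibreChart_surjective (v := v) hx u
    have h1 := h w (by rintro rfl; exact hu (map_zero _))
    exact h1.trans_eq (fundamentalTensor_eq hp hE w w)
  · intro h w hw
    rw [fundamentalTensor_eq hp hE]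
    exact h _ fun h0 ↦ hw (fibreChart_injective hx (h0.trans (map_zero _).symm))

lemma OneJetZero.oneJetEq (hp : p ∈ (chart v).source)
    (hφ : MDifferentiableAt (𝓡 n).tangent 𝓘(ℝ, ℝ) φ p) (h : OneJetZero φ p) :
    OneJetEq (φ ∘ (chart v).symm) 0 (chart v p) := by
  refine ⟨(congrArg φ ((chart v).left_inv hp)).trans h.1, ?_⟩
  refine ContinuousLinearMap.ext fun w ↦ ?_
  have h1 := derive_eq_along (ofChart v fun _ ↦ w) hp hφ
  rw [along, toChart_ofChart ((chart v).map_source hp)] at h1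
  rw [← h1]
  have h2 := congrArg (fun f : TangentSpace (𝓡 n).tangent p →L[ℝ] ℝ ↦ f (ofChart v (fun _ ↦ w) p)) h.2
  have h3 : fderiv ℝ (0 : Coord n → ℝ) (chart v p) = 0 :=
    (hasFDerivAt_const (0 : ℝ) _).fderiv
  rw [h3]
  exact h2

lemma OneJetEq.congr_left {W : Type*} [NormedAddCommGroup W] [NormedSpace ℝ W] {x : W}
    {f f' g : W → ℝ} (h : OneJetEq f g x) (hf : f =ᶠ[𝓝 x] f') : OneJetEq f' g x :=
  ⟨hf.self_of_nhds.symm.trans h.zero, hf.fderiv_eq.symm.trans h.one⟩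

/-- Positive definite initial data are the second-order jet of an analytic function, in
coordinates, that solves the reduced system. -/
lemma HasPosDefInitialData.exists_analytic (hS : IsAnalyticSpray S) (hv : v ∈ slit n M)
    (hC : liouville n M v ∉ holonomy S v)
    (hrank : ∃ r : ℕ, ∀ᶠ p in 𝓝 v, Module.finrank ℝ (holonomy S p) = r)
    (h : HasPosDefInitialData S v) :
    ∃ G : Coord n → ℝ, AnalyticAt ℝ G (chart v v) ∧
      (∀ᶠ z in 𝓝 (chart v v), ∀ u ∈ liftSpan (sprayCoeff v S) z, fderiv ℝ G z u = 0) ∧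
      (∀ᶠ z in 𝓝 (chart v v), fderiv ℝ G z (0, z.2) = 2 * G z) ∧
      ∀ u, u ≠ 0 → 0 < fderiv ℝ (fderiv ℝ G) (chart v v) (0, u) (0, u) := by
  have hvs : v ∈ (chart v).source := mem_extChartAt_source v
  have hz : chart v v ∈ slitTarget v := (chart_mem_slitTarget hvs).2 hv
  have hf := hS.isCoordSprayOn v
  obtain ⟨r, hr⟩ := hrank
  obtain ⟨E, hE, ⟨hCE, hXE⟩, hpos⟩ := h
  have hE2 : ContMDiffAt (𝓡 n).tangent 𝓘(ℝ, ℝ) 2 E v := hE.of_le ENat.LEInfty.out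
  have hE1 : ContMDiffAt (𝓡 n).tangent 𝓘(ℝ, ℝ) 1 E v := hE.of_le (by simp)
  have hder {X : Field n M} (hX : SmoothAt 1 X v) :
      MDifferentiableAt (𝓡 n).tangent 𝓘(ℝ, ℝ) (derive X E) v :=
    (contMDiffAt_derive (k := 1) hX (by norm_num; exact hE2)).mdifferentiableAt (by simp)
  have hr' : ∀ᶠ z in 𝓝 (chart v v), Module.finrank ℝ (liftSpan (sprayCoeff v S) z) = r := by
    filter_upwards [(tendsto_chart_symm hvs).eventually hr, (isOpen_slitTarget v).mem_nhds hz]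
      with z h1 h2
    have h3 := hS.finrank_holonomy ((chart v).map_target h2.1) (chart_symm_mem_slit h2)
    rw [(chart v).right_inv h2.1] at h3
    exact h3.symm.trans h1
  obtain ⟨Z, hZ, hlin, hspan⟩ := exists_liftBracket_basis hf hz hr'
  have hZan (i : Fin r) := (hZ i).analyticAt_and_lieBracket_liouville hf
  obtain ⟨G, hG, hZG, hCG, hjet⟩ := exists_analytic_solution (C := fun x ↦ (0, x.2))
    (E := E ∘ (chart v).symm) (fun i ↦ (hZan i _ hz).1) hlin
    (fun i j ↦ by
      filter_upwards [hspan] with z h1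
      rw [← h1]
      exact (IsLiftBracket.bracket _ _ (hZ i) (hZ j)).mem_liftSpan)
    (analyticAt_const.prod analyticAt_snd)
    (fun i ↦ Filter.eventually_of_mem ((isOpen_slitTarget v).mem_nhds hz) fun z h1 ↦
      (hZan i z h1).2)
    (by
      rw [← hspan.self_of_nhds, ← toChart_liouville (M := M) hvs, ← hS.mem_holonomy_iff hvs hv]
      exact hC)
    (contDiffAt_comp_chart_symm hvs hE)
    (fun i ↦ by
      obtain ⟨X, hX, hXs, hXZ⟩ := (hZ i).exists_isHolonomyField hS
      have hU := isOpen_source_inter_slit v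
      have h1 := hXE _ hU ⟨hvs, hv⟩ Set.inter_subset_right X
        (fun p hp ↦ ((hXs p hp).of_le le_top).contMDiffWithinAt)
        (fun p hp ↦ Submodule.subset_span ⟨_, hU, hp, Set.inter_subset_right, X, hX, rfl⟩)
      refine (h1.oneJetEq hvs (hder ((hXs v ⟨hvs, hv⟩).of_le le_top))).congr_left
        ((derive_comp_chart_symm hvs X hE1).trans ?_)
      filter_upwards [(isOpen_slitTarget v).mem_nhds hz] with z h2
      simp only [along, hXZ z h2])
    (by
      have hm : MDifferentiableAt (𝓡 n).tangent 𝓘(ℝ, ℝ) (fun p ↦ derive (liouville n M) E p - 2 * E p) v :=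
        (hder ((smoothAt_liouville v).of_le le_top)).sub
          ((hE1.mdifferentiableAt (by simp)).const_smul (2 : ℝ))
      refine (hCE.oneJetEq hvs hm).congr_left ?_
      filter_upwards [derive_comp_chart_symm hvs (liouville n M) hE1,
        toChart_liouville_eventuallyEq (M := M) hvs] with z h1 h2
      simp only [along, h2, Function.comp_apply] at h1
      simp only [along, Function.comp_apply, h1])
  refine ⟨G, hG, ?_, hCG, ?_⟩
  · filter_upwards [hspan, Filter.eventually_all.2 hZG] with z h1 h2 u hu
    rw [h1] at hu
    have h3 : Submodule.span ℝ (Set.range fun i ↦ Z i z) ≤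
        LinearMap.ker (fderiv ℝ G z).toLinearMap := by
      refine Submodule.span_le.2 ?_
      rintro _ ⟨i, rfl⟩
      exact h2 i
    exact h3 hu
  · rw [hjet.two]
    exact (posDefAt_iff hvs (contDiffAt_comp_chart_symm hvs hE2)).1 hpos

/-- The square root of twice an analytic solution of the reduced system is a Finsler metric whose
geodesics are given by the spray. -/
theorem HasPosDefInitialData.locallyFinslerMetrizable (hS : IsAnalyticSpray S) (hv : v ∈ slit n M)
    (hC : liouville n M v ∉ holonomy S v)
    (hrank : ∃ r : ℕ, ∀ᶠ p in 𝓝 v, Module.finrank ℝ (holonomy S p) = r)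
    (h : HasPosDefInitialData S v) : LocallyFinslerMetrizable S v := by
  have hvs : v ∈ (chart v).source := mem_extChartAt_source v
  have hz : chart v v ∈ slitTarget v := (chart_mem_slitTarget hvs).2 hv
  have hf := hS.isCoordSprayOn v
  obtain ⟨G, hG, hHG, hCG, hpos⟩ := h.exists_analytic hS hv hC hrank
  -- By Euler's relation, twice the value of `G` is its fundamental tensor evaluated on `y`.
  have hGv : 0 < G (chart v v) := by
    have h1 := fderiv_fderiv_of_homogeneous hG.contDiffAt hCG (chart v v).2
    have h2 := hpos _ hz.2
    rw [h1, hCG.self_of_nhds] at h2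
    linarith
  have hposev := eventually_forall_pos hG.fderiv.fderiv.continuousAt
    (ContinuousLinearMap.inr ℝ (EuclideanSpace ℝ (Fin n)) (EuclideanSpace ℝ (Fin n))) hpos
  have hev : ∀ᶠ z in 𝓝 (chart v v), z ∈ slitTarget v ∧ AnalyticAt ℝ G z ∧
      (∀ u ∈ liftSpan (sprayCoeff v S) z, fderiv ℝ G z u = 0) ∧
      fderiv ℝ G z (0, z.2) = 2 * G z ∧
      (∀ u, u ≠ 0 → 0 < fderiv ℝ (fderiv ℝ G) z (0, u) (0, u)) ∧ 0 < G z := by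
    filter_upwards [(isOpen_slitTarget v).mem_nhds hz, hG.eventually_analyticAt, hHG, hCG, hposev,
      hG.continuousAt.eventually (lt_mem_nhds hGv)] with z h1 h2 h3 h4 h5 h6
    exact ⟨h1, h2, h3, h4, h5, h6⟩
  obtain ⟨ε, hε, hball⟩ := Metric.eventually_nhds_iff_ball.1 hev
  set B := Metric.ball (chart v v) ε
  choose! hBs hBan hBH hBC hBpos hBG using hball
  have hB : IsOpen B := Metric.isOpen_ball
  set U := (chart v).source ∩ chart v ⁻¹' B
  have hU : IsOpen U := isOpen_chart_source_inter_preimage v hB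
  have hUs : U ⊆ slit n M := fun p hp ↦ (chart_mem_slitTarget hp.1).1 (hBs _ hp.2)
  let F : TangentBundle (𝓡 n) M → ℝ := fun q ↦ √(2 * G (chart v q))
  set e : TangentBundle (𝓡 n) M → ℝ := fun q ↦ F q ^ 2 / 2
  -- The energy of `F` is `G` in coordinates.
  have heG : ∀ p ∈ U, e ∘ (chart v).symm =ᶠ[𝓝 (chart v p)] G := by
    intro p hp
    filter_upwards [hB.mem_nhds hp.2] with z hzB
    have h1 : 0 ≤ 2 * G z := by linarith [hBG z hzB]
    simp only [e, F, Function.comp_apply]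
    rw [(chart v).right_inv (hBs z hzB).1, Real.sq_sqrt h1]
    ring
  have he : ∀ p ∈ U, ContMDiffAt (𝓡 n).tangent 𝓘(ℝ, ℝ) ω e p := fun p hp ↦
    contMDiffAt_of_comp_chart_symm hp.1
      ((hBan _ hp.2).contDiffAt.congr_of_eventuallyEq (heG p hp))
  have hder : ∀ p ∈ U, ∀ X : Field n M,
      derive X e p = fderiv ℝ G (chart v p) (toChart v X (chart v p)) := by
    intro p hp X
    rw [derive_eq_along X hp.1 ((he p hp).mdifferentiableAt (by simp))]
    exact (along_congr (heG p hp)).self_of_nhds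
  have hlift : ∀ p ∈ U, ∀ w, fderiv ℝ G (chart v p)
      (horizontalLift (sprayCoeff v S) w (chart v p)) = 0 := fun p hp w ↦
    hBH _ hp.2 _ (IsLiftBracket.lift w).mem_liftSpan
  have hSe : ∀ p ∈ U, derive S e p = 0 := by
    intro p hp
    have h1 := hBs _ hp.2
    have h2 := hlift p hp (chart v p).2
    -- By Euler's relation for `f`, the spray at `(x, y)` is the horizontal lift of `y`.
    rw [horizontalLift, hf.homogeneous _ h1, smul_smul] at h2
    rw [hder p hp, hS.toChart_eq _ h1]
    norm_num at h2
    exact h2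
  refine ⟨U, hU, ⟨hvs, Metric.mem_ball_self hε⟩, hUs, F, ⟨fun p hp ↦ ?_, fun p hp ↦ ?_,
    fun p hp c hc hcU ↦ ?_, fun p hp ↦ ?_, fun p hp V hV hpV Y hY ↦ ?_⟩⟩
  · have h1 : ContDiffAt ℝ ω (fun z ↦ √(2 * G z)) (chart v p) :=
      (contDiffAt_const.mul (hBan _ hp.2).contDiffAt).sqrt (by linarith [hBG _ hp.2])
    exact (contMDiffAt_comp_chart hp.1 h1).contMDiffWithinAt
  · exact Real.sqrt_pos.2 (by linarith [hBG _ hp.2])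
  · have h1 := chart_smul (v := v) hp.1 c
    have h2 := hcU.2
    rw [Set.mem_preimage, h1] at h2
    have h3 : G ((chart v p).1, c • (chart v p).2) = c ^ 2 * G (chart v p) :=
      eq_sq_mul_of_euler (convex_ball _ _) (fun z hz ↦ (hBan z hz).differentiableAt) hBC hc hp.2 h2
    simp only [F]
    rw [h1, h3, mul_left_comm, Real.sqrt_mul (sq_nonneg c), Real.sqrt_sq hc.le]
  · refine (posDefAt_iff hp.1 ((hBan _ hp.2).contDiffAt.congr_of_eventuallyEq (heG p hp))).2 ?_
    rw [(heG p hp).fderiv.fderiv_eq]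
    exact hBpos _ hp.2
  · have hUp := hU.mem_nhds hp
    have hYp : SmoothAt 1 Y p := (hY.smoothAt hV hpV).of_le (by simp)
    rw [hS.eulerLagrange_eq_neg (Filter.mem_of_superset hUp hUs) ((he p hp).of_le le_top)
      (Filter.eventually_of_mem hUp hSe) ((hS.smoothAt (hUs hp)).of_le le_top) hYp, hder p hp,
      hder p hp, hS.toChart_connection hp.1 (hUs hp) hYp]
    -- `Γ Y + Y` is twice a horizontal lift.
    have h1 := hlift p hp (toChart v Y (chart v p)).1
    generalize toChart v Y (chart v p) = u at h1 ⊢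
    rw [horizontalLift] at h1
    generalize fderiv ℝ (sprayCoeff v S) (chart v p) (0, u.1) = d at h1 ⊢
    have h2 : ((u.1, d - u.2) : Coord n) + u = (2 : ℝ) • (u.1, (1 / 2 : ℝ) • d) := by
      refine Prod.ext ?_ ?_
      · simp [two_smul]
      · simp [smul_smul]
    have h3 := congrArg (fderiv ℝ G (chart v p)) h2
    rw [map_add, map_smul, h1, smul_zero] at h3
    linarith

end Sufficiency

end FinslerMetrizability

end

theorem mainTheorem3 {n : ℕ} {M : Type*} [TopologicalSpace M]
    [ChartedSpace (EuclideanSpace ℝ (Fin n)) M] [IsManifold (𝓡 n) ω M]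
    (S : FinslerMetrizability.Field n M) (hS : FinslerMetrizability.IsAnalyticSpray S)
    (v : TangentBundle (𝓡 n) M) (hv : v ∈ FinslerMetrizability.slit n M)
    (hC : FinslerMetrizability.liouville n M v ∉ FinslerMetrizability.holonomy S v)
    (hrank : ∃ r : ℕ, ∀ᶠ p in 𝓝 v,
      Module.finrank ℝ (FinslerMetrizability.holonomy S p) = r) :
    FinslerMetrizability.LocallyFinslerMetrizable S v ↔
      FinslerMetrizability.HasPosDefInitialData S v :=
  ⟨fun h ↦ h.hasPosDefInitialData hS,
    fun h ↦ h.locallyFinslerMetrizable hS hv hC hrank⟩
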